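/- Let $n\ge 3$ be an integer, $m=n/2$ (so that the Coxeter group is $I_2(n)=I_2(2m)$), and let $D\subseteq\{(u,v)\in\mathbb R^2: u>0\}$ be open. Consider the dispersionless system (the flow of the principal hierarchy of the Frobenius manifold, $c=0$) $$u_t=\partial_x[v],\qquad v_t=\partial_x\Big[\tfrac{4m^2}{2m-1}u^{2m-1}\Big].\tag{1}$$ A second order deformation of (1) on $D$ is a system of conservation laws $$u_t=\partial_x\big[v+\epsilon^2(a_{13}u_{xx}+a_{14}v_{xx}+a_{15}u_x^2+a_{16}v_x^2+a_{17}u_xv_x)\big],$$ $$v_t=\partial_x\big[\tfrac{4m^2}{2m-1}u^{2m-1}+\epsilon^2(a_{23}u_{xx}+a_{24}v_{xx}+a_{25}u_x^2+a_{26}v_x^2+a_{27}u_xv_x)\big]$$ whose coefficients $a_{ij}=a_{ij}(u,v)$ are smooth on $D$. It is integrable (up to order $\epsilon^2$) if for every open $V\subseteq D$, every flow $u_\tau=\partial_x p(u,v)$, $v_\tau=\partial_x q(u,v)$ with $p,q$ smooth on $V$ that commutes with (1) extends to a flow $$u_\tau=\partial_x[p+\epsilon p_1+\epsilon^2p_2],\qquad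 v_\tau=\partial_x[q+\epsilon q_1+\epsilon^2q_2]$$ that commutes with the deformed system up to $O(\epsilon^3)$, where $p_k,q_k$ are homogeneous differential polynomials of degree $k$ in $u,v$ (with $\deg\partial_x^k u=\deg\partial_x^k v=k$) with coefficients smooth on $V$. Given functions $F_1,F_2$ of one variable, put $F(u,v)=F_1(v+2u^m)+F_2(v-2u^m)$; the arguments $v\pm2u^m$ are Riemann invariants of (1). The normal form associated with $F$ is the system $$u_t=\partial_x\big[v+\epsilon^2(a_{15}u_x^2+a_{16}v_x^2+a_{17}u_xv_x)\big],$$ $$v_t=\partial_x\Big[\tfrac{4m^2}{2m-1}u^{2m-1}+\epsilon^2\Big(a_{23}u_{xx}+a_{24}v_{xx}+a_{25}u_x^2-\frac{u^{-2m+2}a_{25}}{4m^2}v_x^2\Big)\Big],$$ where $$a_{15}=\tfrac38F_{vv}u^{2m-3}+\tfrac1{32}\tfrac{m-2}{m(m-1)}\tfrac{F_u}{u^2},\qquad a_{16}=-\tfrac1{32m^2}\tfrac{F_{vv}}{u}-\tfrac1{128}\tfrac{m-2}{m^3(m-1)}\tfrac{F_u}{u^{2m}},\qquad a_{17}=\tfrac1{16m^2}\tfrac{F_{uv}}{u},$$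 $$a_{23}=-\tfrac12F_vu^{2m-3},\qquad a_{24}=-\tfrac1{8m^2}\tfrac{F_u}{u},\qquad a_{25}=-\tfrac14F_{uv}u^{2m-3}+\tfrac18\tfrac{2m-3}{m-1}F_vu^{2m-4}.$$ Theorem. (i) Every integrable second order deformation of (1) on $D$ can be reduced to this normal form: there are smooth functions $\beta_{ij}$ on $D$ such that the Miura transformation $$\tilde u=u+\epsilon^2\partial_x(\beta_{11}u_x+\beta_{12}v_x),\qquad \tilde v=v+\epsilon^2\partial_x(\beta_{21}u_x+\beta_{22}v_x)$$ has the following property. Every point of $D$ has an open neighbourhood $U\subseteq D$ on which, for suitable smooth functions $F_1,F_2$ (defined on the images of $U$ under $v+2u^m$ and $v-2u^m$ respectively), the transformation carries the deformed system, up to $O(\epsilon^3)$, to the normal form associated with $F=F_1(v+2u^m)+F_2(v-2u^m)$. (ii) $F_1$ and $F_2$ are arbitrary: for all functions $F_1,F_2$ of one variable, smooth on the images of $D$ under $v+2u^m$ and $v-2u^m$ respectively, the normal form associated with $F$ is an integrable second order deformation of (1) on $D$. -/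

import Mathlib

open Filter Topology Asymptotics
open scoped ContDiff

namespace DihedralDeformation

noncomputable section

/-- The partial derivative `∂f/∂u` of a function of `(u, v)`. -/
def pdu (f : ℝ × ℝ → ℝ) (z : ℝ × ℝ) : ℝ := deriv (fun s => f (s, z.2)) z.1

/-- The partial derivative `∂f/∂v` of a function of `(u, v)`. -/
def pdv (f : ℝ × ℝ → ℝ) (z : ℝ × ℝ) : ℝ := deriv (fun s => f (z.1, s)) z.2

/-- The coefficients of a current, truncated after `ε²`, whose `εᵏ` part is a homogeneous
differential polynomial of degree `k`:
`lead + ε (ux u_x + vx v_x)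
  + ε² (uxx u_xx + vxx v_xx + uxux u_x² + vxvx v_x² + uxvx u_x v_x)`,
all coefficients being functions of `(u, v)`. -/
structure Current where
  lead : ℝ × ℝ → ℝ
  ux : ℝ × ℝ → ℝ
  vx : ℝ × ℝ → ℝ
  uxx : ℝ × ℝ → ℝ
  vxx : ℝ × ℝ → ℝ
  uxux : ℝ × ℝ → ℝ
  vxvx : ℝ × ℝ → ℝ
  uxvx : ℝ × ℝ → ℝ

/-- All coefficients of the current are smooth on `D`. -/
def Current.SmoothOn (A : Current) (D : Set (ℝ × ℝ)) : Prop :=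
  ContDiffOn ℝ ∞ A.lead D ∧ ContDiffOn ℝ ∞ A.ux D ∧ ContDiffOn ℝ ∞ A.vx D ∧
  ContDiffOn ℝ ∞ A.uxx D ∧ ContDiffOn ℝ ∞ A.vxx D ∧ ContDiffOn ℝ ∞ A.uxux D ∧
  ContDiffOn ℝ ∞ A.vxvx D ∧ ContDiffOn ℝ ∞ A.uxvx D

/-- The value at `x` of the current on the pair of functions `u, v` of `x`. -/
def Current.eval (A : Current) (ε : ℝ) (u v : ℝ → ℝ) (x : ℝ) : ℝ :=
  A.lead (u x, v x)
  + ε * (A.ux (u x, v x) * deriv u x + A.vx (u x, v x) * deriv v x)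
  + ε ^ 2 * (A.uxx (u x, v x) * deriv (deriv u) x + A.vxx (u x, v x) * deriv (deriv v) x
      + A.uxux (u x, v x) * deriv u x ^ 2 + A.vxvx (u x, v x) * deriv v x ^ 2
      + A.uxvx (u x, v x) * (deriv u x * deriv v x))

/-- The `x`-derivative of a current: the right-hand side of a conservation law. -/
def Current.rate (A : Current) (ε : ℝ) (u v : ℝ → ℝ) : ℝ → ℝ :=
  fun x => deriv (A.eval ε u v) x

/-- A system of two conservation laws `u_t = ∂ₓ(fst)`, `v_t = ∂ₓ(snd)`. -/
structure System where
  fst : Current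
  snd : Current

/-- All coefficients of the system are smooth on `D`. -/
def System.SmoothOn (S : System) (D : Set (ℝ × ℝ)) : Prop :=
  S.fst.SmoothOn D ∧ S.snd.SmoothOn D

/-- The system `u_t = ∂ₓ p(u, v)`, `v_t = ∂ₓ q(u, v)`. -/
def hydro (p q : ℝ × ℝ → ℝ) : System where
  fst := { lead := p, ux := 0, vx := 0, uxx := 0, vxx := 0, uxux := 0, vxvx := 0, uxvx := 0 }
  snd := { lead := q, ux := 0, vx := 0, uxx := 0, vxx := 0, uxux := 0, vxvx := 0, uxvx := 0 }

/-- The derivative of the functional `G` at `(u, v)` (evaluated at `x`) along the flow of `S`. -/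
def System.derivAlong (S : System) (ε : ℝ) (G : (ℝ → ℝ) → (ℝ → ℝ) → ℝ → ℝ)
    (u v : ℝ → ℝ) (x : ℝ) : ℝ :=
  deriv (fun s : ℝ => G (u + s • S.fst.rate ε u v) (v + s • S.snd.rate ε u v) x) 0

/-- The commutator of the flows of `S` (time `t`) and `T` (time `τ`): the two components of
`∂_τ ∂_t (u, v) - ∂_t ∂_τ (u, v)`. -/
def System.commutator (S T : System) (ε : ℝ) (u v : ℝ → ℝ) (x : ℝ) : ℝ × ℝ :=
  (T.derivAlong ε (S.fst.rate ε) u v x - S.derivAlong ε (T.fst.rate ε) u v x,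
   T.derivAlong ε (S.snd.rate ε) u v x - S.derivAlong ε (T.snd.rate ε) u v x)

/-- On `V`, the flow `u_τ = ∂ₓ p`, `v_τ = ∂ₓ q` commutes with the dispersionless limit (`ε = 0`)
of `S`. -/
def System.DispersionlessSymmetry (S : System) (p q : ℝ × ℝ → ℝ) (V : Set (ℝ × ℝ)) : Prop :=
  ∀ u v : ℝ → ℝ, ContDiff ℝ ∞ u → ContDiff ℝ ∞ v → ∀ x : ℝ, (u x, v x) ∈ V →
    S.commutator (hydro p q) 0 u v x = 0

/-- On `V`, the flows of `S` and `T` commute up to terms of order `ε³`. -/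
def System.CommutesToSecondOrder (S T : System) (V : Set (ℝ × ℝ)) : Prop :=
  ∀ u v : ℝ → ℝ, ContDiff ℝ ∞ u → ContDiff ℝ ∞ v → ∀ x : ℝ, (u x, v x) ∈ V →
    (fun ε : ℝ => S.commutator T ε u v x) =O[𝓝 0] (fun ε : ℝ => ε ^ 3)

/-- Integrability up to order `ε²` on `D`: every (locally defined) symmetry of the dispersionless
limit extends to a symmetry of the whole system up to order `ε²`. -/
def System.IntegrableToSecondOrder (S : System) (D : Set (ℝ × ℝ)) : Prop :=
  ∀ V : Set (ℝ × ℝ), IsOpen V → V ⊆ D → ∀ p q : ℝ × ℝ → ℝ,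
    ContDiffOn ℝ ∞ p V → ContDiffOn ℝ ∞ q V → S.DispersionlessSymmetry p q V →
    ∃ T : System, T.SmoothOn V ∧ T.fst.lead = p ∧ T.snd.lead = q ∧ S.CommutesToSecondOrder T V

/-- `S` is a second order deformation, with coefficients smooth on `D`, of the system
`u_t = ∂ₓ v`, `v_t = ∂ₓ (4m²/(2m-1) u^(2m-1))`. -/
def IsSecondOrderDeformation (m : ℝ) (D : Set (ℝ × ℝ)) (S : System) : Prop :=
  S.SmoothOn D ∧
  ∀ z ∈ D, S.fst.lead z = z.2 ∧ S.snd.lead z = 4 * m ^ 2 / (2 * m - 1) * z.1 ^ (2 * m - 1) ∧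
    S.fst.ux z = 0 ∧ S.fst.vx z = 0 ∧ S.snd.ux z = 0 ∧ S.snd.vx z = 0

/-- The coefficients of a Miura transformation
`ũ = u + ε² ∂ₓ(b11 u_x + b12 v_x)`, `ṽ = v + ε² ∂ₓ(b21 u_x + b22 v_x)`. -/
structure Miura where
  b11 : ℝ × ℝ → ℝ
  b12 : ℝ × ℝ → ℝ
  b21 : ℝ × ℝ → ℝ
  b22 : ℝ × ℝ → ℝ

/-- All coefficients of the Miura transformation are smooth on `D`. -/
def Miura.SmoothOn (β : Miura) (D : Set (ℝ × ℝ)) : Prop :=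
  ContDiffOn ℝ ∞ β.b11 D ∧ ContDiffOn ℝ ∞ β.b12 D ∧
  ContDiffOn ℝ ∞ β.b21 D ∧ ContDiffOn ℝ ∞ β.b22 D

/-- The first transformed function `ũ`. -/
def Miura.mapU (β : Miura) (ε : ℝ) (u v : ℝ → ℝ) : ℝ → ℝ := fun x =>
  u x + ε ^ 2 * deriv (fun y => β.b11 (u y, v y) * deriv u y + β.b12 (u y, v y) * deriv v y) x

/-- The second transformed function `ṽ`. -/
def Miura.mapV (β : Miura) (ε : ℝ) (u v : ℝ → ℝ) : ℝ → ℝ := fun x =>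
  v x + ε ^ 2 * deriv (fun y => β.b21 (u y, v y) * deriv u y + β.b22 (u y, v y) * deriv v y) x

/-- On `U`, the Miura transformation carries the system `S` to the system `S'` up to terms of
order `ε³`: if `(u, v)` evolves by `S`, then the time derivatives of `ũ` and `ṽ` are the
right-hand sides of `S'` at `(ũ, ṽ)`, modulo `O(ε³)`. -/
def Miura.Transforms (β : Miura) (S S' : System) (U : Set (ℝ × ℝ)) : Prop :=
  ∀ u v : ℝ → ℝ, ContDiff ℝ ∞ u → ContDiff ℝ ∞ v → ∀ x : ℝ, (u x, v x) ∈ U →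
    (fun ε : ℝ => S.derivAlong ε (β.mapU ε) u v x
      - S'.fst.rate ε (β.mapU ε u v) (β.mapV ε u v) x) =O[𝓝 0] (fun ε : ℝ => ε ^ 3) ∧
    (fun ε : ℝ => S.derivAlong ε (β.mapV ε) u v x
      - S'.snd.rate ε (β.mapU ε u v) (β.mapV ε u v) x) =O[𝓝 0] (fun ε : ℝ => ε ^ 3)

/-- The Riemann invariant `v + 2 u^m`. -/
def riemannPlus (m : ℝ) (z : ℝ × ℝ) : ℝ := z.2 + 2 * z.1 ^ m

/-- The Riemann invariant `v - 2 u^m`. -/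
def riemannMinus (m : ℝ) (z : ℝ × ℝ) : ℝ := z.2 - 2 * z.1 ^ m

/-- `F = F₁(v + 2 u^m) + F₂(v - 2 u^m)`. -/
def potential (m : ℝ) (F₁ F₂ : ℝ → ℝ) (z : ℝ × ℝ) : ℝ :=
  F₁ (riemannPlus m z) + F₂ (riemannMinus m z)

def a15 (m : ℝ) (F : ℝ × ℝ → ℝ) (z : ℝ × ℝ) : ℝ :=
  3 / 8 * pdv (pdv F) z * z.1 ^ (2 * m - 3)
    + 1 / 32 * ((m - 2) / (m * (m - 1))) * (pdu F z / z.1 ^ 2)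

def a16 (m : ℝ) (F : ℝ × ℝ → ℝ) (z : ℝ × ℝ) : ℝ :=
  -(1 / (32 * m ^ 2)) * (pdv (pdv F) z / z.1)
    - 1 / 128 * ((m - 2) / (m ^ 3 * (m - 1))) * (pdu F z / z.1 ^ (2 * m))

def a17 (m : ℝ) (F : ℝ × ℝ → ℝ) (z : ℝ × ℝ) : ℝ :=
  1 / (16 * m ^ 2) * (pdu (pdv F) z / z.1)

def a23 (m : ℝ) (F : ℝ × ℝ → ℝ) (z : ℝ × ℝ) : ℝ :=
  -(1 / 2) * pdv F z * z.1 ^ (2 * m - 3)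

def a24 (m : ℝ) (F : ℝ × ℝ → ℝ) (z : ℝ × ℝ) : ℝ :=
  -(1 / (8 * m ^ 2)) * (pdu F z / z.1)

def a25 (m : ℝ) (F : ℝ × ℝ → ℝ) (z : ℝ × ℝ) : ℝ :=
  -(1 / 4) * pdu (pdv F) z * z.1 ^ (2 * m - 3)
    + 1 / 8 * ((2 * m - 3) / (m - 1)) * pdv F z * z.1 ^ (2 * m - 4)

/-- The system
`u_t = ∂ₓ[v + ε² (a15 u_x² + a16 v_x² + a17 u_x v_x)]`,
`v_t = ∂ₓ[4m²/(2m-1) u^(2m-1)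
  + ε² (a23 u_xx + a24 v_xx + a25 u_x² - u^(2-2m) a25 / (4m²) v_x²)]`. -/
def normalForm (m : ℝ) (F : ℝ × ℝ → ℝ) : System where
  fst :=
    { lead := fun z => z.2
      ux := 0
      vx := 0
      uxx := 0
      vxx := 0
      uxux := a15 m F
      vxvx := a16 m F
      uxvx := a17 m F }
  snd :=
    { lead := fun z => 4 * m ^ 2 / (2 * m - 1) * z.1 ^ (2 * m - 1)
      ux := 0
      vx := 0
      uxx := a23 m F
      vxx := a24 m F
      uxux := a25 m F
      vxvx := fun z => -(z.1 ^ (-2 * m + 2) * a25 m F z / (4 * m ^ 2))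
      uxvx := 0 }

end

end DihedralDeformation

open DihedralDeformation

namespace DihedralDeformation

open TopologicalSpace (Opens)

/-! ### Partial derivatives of smooth functions on open subsets of the plane -/

section PartialDerivatives

variable {V : Set (ℝ × ℝ)} {f g : ℝ × ℝ → ℝ} {z : ℝ × ℝ}

/-! Write (1) as `u_t = v_x`, `v_t = w u_x` with `w = 4 m² u^(2m-2)`. A flow `(p, q)` commutes with
it exactly when `q_u = w p_v` and `q_v = p_u`; then `α = p_v` solves `α_uu = w α_vv`.

Commutation up to `ε²` is first turned into algebra. By symmetry of second derivatives, the
variation of a right-hand side is the `x`-derivative of the linearized current, so at each point the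
commutator is a polynomial in `ε`, and being `O(ε³)` means that its first three coefficients vanish.
If one of the two systems has no terms of order `ε`, the `ε²` coefficient is the `x`-derivative of a
difference of homogeneous cubic differential polynomials (`Current.flow_cubic`). Jets of `u` and `v`
can be prescribed freely, so such a derivative vanishes only if all ten coefficients agree
(`Cubic.eq_of_deriv_eval`). What remains are identities in the ring of smooth functions with its two
commuting derivations, abstracted as `IsDihedralRing`.

For (i), one symmetry is enough: `p = u v`, `q = v²/2 + 2m u^(2m)`, for which `α = u`. The four
Miura coefficients can be chosen on all of `D`, by algebra alone, so that the second derivatives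
disappear from the first current while the second has no `u_x v_x` term and opposite `u_x²` and `w
v_x²` terms (`miura_reduces`). The same transformation applied to the extended symmetry preserves
commutation (`miura_flow_eq`). The resulting equations are then solved (`normal_of_flow`): every
coefficient is expressed through `a = a23` and `b = a24`, and these satisfy `a_u = w b_v + (2m-3)
a/u`, `b_u = a_v + (m-2) b/u`. This system says that two combinations of `a` and `b` are constant
along the two families of characteristics, hence locally functions of `v ± 2u^m`; their
antiderivatives are `F₁` and `F₂` (`riemann_equation`, `exists_local_potential`).

For (ii), `F` solves `F_uu = (m-1) F_u / u + w F_vv` (`riemannComp_wave`), which gives the same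
first order system for `a` and `b`. Every symmetry then has an explicit extension, linear in `α` and
its derivatives (`symmetryFst`, `symmetrySnd`), whose commutation with the normal form is a direct
verification (`normal_flow_symmetry`). -/

theorem hasFDerivAt_of_smoothOn (hV : IsOpen V) (hf : ContDiffOn ℝ ∞ f V) (hz : z ∈ V) :
    HasFDerivAt f (fderiv ℝ f z) z :=
  ((hf.contDiffAt (hV.mem_nhds hz)).differentiableAt (by simp)).hasFDerivAt

theorem hasDerivAt_comp_pair (hV : IsOpen V) (hf : ContDiffOn ℝ ∞ f V) {u v : ℝ → ℝ}
    {u' v' x : ℝ} (hx : (u x, v x) ∈ V) (hu : HasDerivAt u u' x) (hv : HasDerivAt v v' x) :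
    HasDerivAt (fun y => f (u y, v y)) (fderiv ℝ f (u x, v x) (u', v')) x :=
  (hasFDerivAt_of_smoothOn hV hf hx).comp_hasDerivAt x (hu.prodMk hv)

theorem pdu_eq_fderiv (hV : IsOpen V) (hf : ContDiffOn ℝ ∞ f V) (hz : z ∈ V) :
    pdu f z = fderiv ℝ f z (1, 0) :=
  (hasDerivAt_comp_pair (u := fun s => s) (v := fun _ => z.2) hV hf hz (hasDerivAt_id z.1)
    (hasDerivAt_const z.1 z.2)).deriv

theorem pdv_eq_fderiv (hV : IsOpen V) (hf : ContDiffOn ℝ ∞ f V) (hz : z ∈ V) :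
    pdv f z = fderiv ℝ f z (0, 1) :=
  (hasDerivAt_comp_pair (u := fun _ => z.1) (v := fun s => s) hV hf hz
    (hasDerivAt_const z.2 z.1) (hasDerivAt_id z.2)).deriv

theorem hasDerivAt_pdu (hV : IsOpen V) (hf : ContDiffOn ℝ ∞ f V) {a b : ℝ} (hz : (a, b) ∈ V) :
    HasDerivAt (fun s => f (s, b)) (pdu f (a, b)) a := by
  have := hasDerivAt_comp_pair (u := fun s => s) (v := fun _ => b) hV hf hz (hasDerivAt_id a)
    (hasDerivAt_const a b)
  rw [pdu_eq_fderiv hV hf hz]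
  exact this

theorem hasDerivAt_pdv (hV : IsOpen V) (hf : ContDiffOn ℝ ∞ f V) {a b : ℝ} (hz : (a, b) ∈ V) :
    HasDerivAt (fun s => f (a, s)) (pdv f (a, b)) b := by
  have := hasDerivAt_comp_pair (u := fun _ => a) (v := fun s => s) hV hf hz (hasDerivAt_const b a)
    (hasDerivAt_id b)
  rw [pdv_eq_fderiv hV hf hz]
  exact this

/-- The chain rule along a curve in the plane. -/
theorem hasDerivAt_comp_curve (hV : IsOpen V) (hf : ContDiffOn ℝ ∞ f V) {u v : ℝ → ℝ}
    {u' v' x : ℝ} (hx : (u x, v x) ∈ V) (hu : HasDerivAt u u' x) (hv : HasDerivAt v v' x) :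
    HasDerivAt (fun y => f (u y, v y)) (pdu f (u x, v x) * u' + pdv f (u x, v x) * v') x := by
  have h := hasDerivAt_comp_pair hV hf hx hu hv
  have e : ((u', v') : ℝ × ℝ) = u' • ((1, 0) : ℝ × ℝ) + v' • ((0, 1) : ℝ × ℝ) := by simp
  rw [e, map_add, map_smul, map_smul, ← pdu_eq_fderiv hV hf hx, ← pdv_eq_fderiv hV hf hx] at h
  convert h using 1
  simp only [smul_eq_mul]
  ring

theorem smoothOn_pdu (hV : IsOpen V) (hf : ContDiffOn ℝ ∞ f V) : ContDiffOn ℝ ∞ (pdu f) V :=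
  ((hf.fderiv_of_isOpen hV (m := ∞) (by simp)).clm_apply contDiffOn_const).congr
    fun _ hz => pdu_eq_fderiv hV hf hz

theorem smoothOn_pdv (hV : IsOpen V) (hf : ContDiffOn ℝ ∞ f V) : ContDiffOn ℝ ∞ (pdv f) V :=
  ((hf.fderiv_of_isOpen hV (m := ∞) (by simp)).clm_apply contDiffOn_const).congr
    fun _ hz => pdv_eq_fderiv hV hf hz

theorem smoothOn_deriv {O : Set ℝ} {h : ℝ → ℝ} (hO : IsOpen O) (hh : ContDiffOn ℝ ∞ h O) :
    ContDiffOn ℝ ∞ (deriv h) O :=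
  hh.deriv_of_isOpen hO (by simp)

theorem hasDerivAt_of_smoothOn {O : Set ℝ} {h : ℝ → ℝ} (hO : IsOpen O) (hh : ContDiffOn ℝ ∞ h O)
    {x : ℝ} (hx : x ∈ O) : HasDerivAt h (deriv h x) x :=
  ((hh.contDiffAt (hO.mem_nhds hx)).differentiableAt (by simp)).hasDerivAt

theorem pdu_congr (hV : IsOpen V) (h : Set.EqOn f g V) : Set.EqOn (pdu f) (pdu g) V := by
  intro z hz
  have : (fun s => (s, z.2)) ⁻¹' V ∈ 𝓝 z.1 :=
    (hV.preimage (by fun_prop : Continuous fun s : ℝ => (s, z.2))).mem_nhds hz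
  exact Filter.EventuallyEq.deriv_eq (by filter_upwards [this] with s hs using h hs)

theorem pdv_congr (hV : IsOpen V) (h : Set.EqOn f g V) : Set.EqOn (pdv f) (pdv g) V := by
  intro z hz
  have : (fun s => (z.1, s)) ⁻¹' V ∈ 𝓝 z.2 :=
    (hV.preimage (by fun_prop : Continuous fun s : ℝ => (z.1, s))).mem_nhds hz
  exact Filter.EventuallyEq.deriv_eq (by filter_upwards [this] with s hs using h hs)

/-- Needed twice: as commutation of the two derivations of the ring of smooth functions, and, with
the plane of pairs (variation parameter, `x`), to exchange a variation with an `x`-derivative. -/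
theorem pdu_pdv_comm (hV : IsOpen V) (hf : ContDiffOn ℝ ∞ f V) (hz : z ∈ V) :
    pdu (pdv f) z = pdv (pdu f) z := by
  have hd : HasFDerivAt (fderiv ℝ f) (fderiv ℝ (fderiv ℝ f) z) z :=
    (((hf.fderiv_of_isOpen hV (m := ∞) (by simp)).contDiffAt (hV.mem_nhds hz)).differentiableAt
      (by simp)).hasFDerivAt
  have key : ∀ w : ℝ × ℝ, HasFDerivAt (fun y => fderiv ℝ f y w)
      ((fderiv ℝ (fderiv ℝ f) z).flip w) z := fun w => by
    refine (hd.clm_apply (hasFDerivAt_const w z)).congr_fderiv ?_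
    ext <;> simp
  have hsymm : IsSymmSndFDerivAt ℝ f z :=
    (hf.contDiffAt (hV.mem_nhds hz)).isSymmSndFDerivAt (by simpa using ENat.LEInfty.out)
  rw [pdu_eq_fderiv hV (smoothOn_pdv hV hf) hz, pdv_eq_fderiv hV (smoothOn_pdu hV hf) hz]
  have e1 : fderiv ℝ (pdv f) z = (fderiv ℝ (fderiv ℝ f) z).flip (0, 1) := by
    refine ((key (0, 1)).congr_of_eventuallyEq ?_).fderiv
    filter_upwards [hV.mem_nhds hz] with y hy using pdv_eq_fderiv hV hf hy
  have e2 : fderiv ℝ (pdu f) z = (fderiv ℝ (fderiv ℝ f) z).flip (1, 0) := by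
    refine ((key (1, 0)).congr_of_eventuallyEq ?_).fderiv
    filter_upwards [hV.mem_nhds hz] with y hy using pdu_eq_fderiv hV hf hy
  rw [e1, e2]
  exact hsymm _ _

theorem pdu_add (hV : IsOpen V) (hf : ContDiffOn ℝ ∞ f V) (hg : ContDiffOn ℝ ∞ g V) (hz : z ∈ V) :
    pdu (f + g) z = pdu f z + pdu g z :=
  ((hasDerivAt_pdu hV hf hz).add (hasDerivAt_pdu hV hg hz)).deriv

theorem pdv_add (hV : IsOpen V) (hf : ContDiffOn ℝ ∞ f V) (hg : ContDiffOn ℝ ∞ g V) (hz : z ∈ V) :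
    pdv (f + g) z = pdv f z + pdv g z :=
  ((hasDerivAt_pdv hV hf hz).add (hasDerivAt_pdv hV hg hz)).deriv

theorem pdu_mul (hV : IsOpen V) (hf : ContDiffOn ℝ ∞ f V) (hg : ContDiffOn ℝ ∞ g V) (hz : z ∈ V) :
    pdu (f * g) z = f z * pdu g z + g z * pdu f z := by
  refine ((hasDerivAt_pdu hV hf hz).mul (hasDerivAt_pdu hV hg hz)).deriv.trans ?_
  simp only [Prod.mk.eta]
  ring

theorem pdv_mul (hV : IsOpen V) (hf : ContDiffOn ℝ ∞ f V) (hg : ContDiffOn ℝ ∞ g V) (hz : z ∈ V) :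
    pdv (f * g) z = f z * pdv g z + g z * pdv f z := by
  refine ((hasDerivAt_pdv hV hf hz).mul (hasDerivAt_pdv hV hg hz)).deriv.trans ?_
  simp only [Prod.mk.eta]
  ring

theorem pdu_const_smul (hV : IsOpen V) (hf : ContDiffOn ℝ ∞ f V) (c : ℝ) (hz : z ∈ V) :
    pdu (c • f) z = c * pdu f z :=
  ((hasDerivAt_pdu hV hf hz).const_smul c).deriv

theorem pdv_const_smul (hV : IsOpen V) (hf : ContDiffOn ℝ ∞ f V) (c : ℝ) (hz : z ∈ V) :
    pdv (c • f) z = c * pdv f z :=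
  ((hasDerivAt_pdv hV hf hz).const_smul c).deriv

end PartialDerivatives

/-! ### The differential ring of smooth functions on an open set -/

section SmoothRing

/-- The algebra of smooth functions on an open subset of the plane. -/
def smoothAlg (V : Opens (ℝ × ℝ)) : Subalgebra ℝ (V → ℝ) where
  carrier := {f | ∃ g : ℝ × ℝ → ℝ, ContDiffOn ℝ ∞ g V ∧ ∀ z : V, g z = f z}
  mul_mem' := by
    rintro _ _ ⟨g, hg, hg'⟩ ⟨k, hk, hk'⟩
    exact ⟨g * k, hg.mul hk, fun z => by simp [hg', hk']⟩
  add_mem' := by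
    rintro _ _ ⟨g, hg, hg'⟩ ⟨k, hk, hk'⟩
    exact ⟨g + k, hg.add hk, fun z => by simp [hg', hk']⟩
  algebraMap_mem' c := ⟨fun _ => c, contDiffOn_const, fun _ => rfl⟩

variable {V : Opens (ℝ × ℝ)}

/-- A smooth function on `V` as an element of the algebra of smooth functions. -/
def toAlg (g : ℝ × ℝ → ℝ) (hg : ContDiffOn ℝ ∞ g V) : smoothAlg V :=
  ⟨fun z => g z, g, hg, fun _ => rfl⟩

/-- An extension of a smooth function on `V` to the plane. -/
noncomputable def extend (f : smoothAlg V) : ℝ × ℝ → ℝ := f.2.choose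

theorem smoothOn_extend (f : smoothAlg V) : ContDiffOn ℝ ∞ (extend f) V := f.2.choose_spec.1

theorem extend_apply (f : smoothAlg V) (z : V) : extend f z = f.1 z := f.2.choose_spec.2 z

theorem extend_toAlg {g : ℝ × ℝ → ℝ} (hg : ContDiffOn ℝ ∞ g V) :
    Set.EqOn (extend (toAlg g hg)) g V := fun z hz => extend_apply (toAlg g hg) ⟨z, hz⟩

theorem toAlg_congr {g k : ℝ × ℝ → ℝ} (hg : ContDiffOn ℝ ∞ g V) (hk : ContDiffOn ℝ ∞ k V)
    (h : Set.EqOn g k V) : toAlg g hg = toAlg k hk :=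
  Subtype.ext (funext fun z => h z.2)

theorem toAlg_extend (f : smoothAlg V) : toAlg (extend f) (smoothOn_extend f) = f :=
  Subtype.ext (funext fun z => extend_apply f z)

theorem exists_toAlg (f : smoothAlg V) :
    ∃ (g : ℝ × ℝ → ℝ) (hg : ContDiffOn ℝ ∞ g V), f = toAlg g hg :=
  ⟨_, smoothOn_extend f, (toAlg_extend f).symm⟩

/-- Evaluation at a point of `V`. -/
def evalAt (z : V) : smoothAlg V →ₐ[ℝ] ℝ :=
  (Pi.evalAlgHom ℝ (fun _ : V => ℝ) z).comp (smoothAlg V).val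

theorem evalAt_toAlg {g : ℝ × ℝ → ℝ} (hg : ContDiffOn ℝ ∞ g V) (z : V) :
    evalAt z (toAlg g hg) = g z := rfl

theorem eq_of_evalAt {f g : smoothAlg V} (h : ∀ z, evalAt z f = evalAt z g) : f = g :=
  Subtype.ext (funext h)

/-- Ring identities may be checked after applying algebra homomorphisms to `ℝ`, where division by
nonzero values is available. This is the form in which the abstract ring below receives the
principle. -/
theorem eq_of_algHom {f g : smoothAlg V} (h : ∀ φ : smoothAlg V →ₐ[ℝ] ℝ, φ f = φ g) : f = g :=
  eq_of_evalAt fun z => h (evalAt z)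

/-- The derivation `∂/∂u`. -/
noncomputable def algU (V : Opens (ℝ × ℝ)) : Derivation ℝ (smoothAlg V) (smoothAlg V) :=
  Derivation.mk'
    { toFun := fun f => toAlg (pdu (extend f)) (smoothOn_pdu V.2 (smoothOn_extend f))
      map_add' := fun f g => Subtype.ext <| funext fun z => by
        refine Eq.trans ?_ (pdu_add V.2 (smoothOn_extend f) (smoothOn_extend g) z.2)
        exact pdu_congr V.2 (fun y hy => by
          simp only [Pi.add_apply]
          rw [extend_apply _ ⟨y, hy⟩, extend_apply _ ⟨y, hy⟩, extend_apply _ ⟨y, hy⟩]; rfl) z.2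
      map_smul' := fun c f => Subtype.ext <| funext fun z => by
        refine Eq.trans ?_ (pdu_const_smul V.2 (smoothOn_extend f) c z.2)
        exact pdu_congr V.2 (fun y hy => by
          simp only [Pi.smul_apply]
          rw [extend_apply _ ⟨y, hy⟩, extend_apply _ ⟨y, hy⟩]; rfl) z.2 }
    fun f g => Subtype.ext <| funext fun z => by
      have h := pdu_mul V.2 (smoothOn_extend f) (smoothOn_extend g) z.2
      rw [extend_apply, extend_apply] at h
      refine Eq.trans ?_ h
      exact pdu_congr V.2 (fun y hy => by
        simp only [Pi.mul_apply]
        rw [extend_apply _ ⟨y, hy⟩, extend_apply _ ⟨y, hy⟩, extend_apply _ ⟨y, hy⟩]; rfl) z.2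

/-- The derivation `∂/∂v`. -/
noncomputable def algV (V : Opens (ℝ × ℝ)) : Derivation ℝ (smoothAlg V) (smoothAlg V) :=
  Derivation.mk'
    { toFun := fun f => toAlg (pdv (extend f)) (smoothOn_pdv V.2 (smoothOn_extend f))
      map_add' := fun f g => Subtype.ext <| funext fun z => by
        refine Eq.trans ?_ (pdv_add V.2 (smoothOn_extend f) (smoothOn_extend g) z.2)
        exact pdv_congr V.2 (fun y hy => by
          simp only [Pi.add_apply]
          rw [extend_apply _ ⟨y, hy⟩, extend_apply _ ⟨y, hy⟩, extend_apply _ ⟨y, hy⟩]; rfl) z.2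
      map_smul' := fun c f => Subtype.ext <| funext fun z => by
        refine Eq.trans ?_ (pdv_const_smul V.2 (smoothOn_extend f) c z.2)
        exact pdv_congr V.2 (fun y hy => by
          simp only [Pi.smul_apply]
          rw [extend_apply _ ⟨y, hy⟩, extend_apply _ ⟨y, hy⟩]; rfl) z.2 }
    fun f g => Subtype.ext <| funext fun z => by
      have h := pdv_mul V.2 (smoothOn_extend f) (smoothOn_extend g) z.2
      rw [extend_apply, extend_apply] at h
      refine Eq.trans ?_ h
      exact pdv_congr V.2 (fun y hy => by
        simp only [Pi.mul_apply]
        rw [extend_apply _ ⟨y, hy⟩, extend_apply _ ⟨y, hy⟩, extend_apply _ ⟨y, hy⟩]; rfl) z.2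

theorem algU_toAlg {g : ℝ × ℝ → ℝ} (hg : ContDiffOn ℝ ∞ g V) :
    algU V (toAlg g hg) = toAlg (pdu g) (smoothOn_pdu V.2 hg) :=
  toAlg_congr (smoothOn_pdu V.2 (smoothOn_extend _)) _ (pdu_congr V.2 (extend_toAlg hg))

theorem algV_toAlg {g : ℝ × ℝ → ℝ} (hg : ContDiffOn ℝ ∞ g V) :
    algV V (toAlg g hg) = toAlg (pdv g) (smoothOn_pdv V.2 hg) :=
  toAlg_congr (smoothOn_pdv V.2 (smoothOn_extend _)) _ (pdv_congr V.2 (extend_toAlg hg))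

theorem algV_algU_comm (f : smoothAlg V) : algV V (algU V f) = algU V (algV V f) := by
  obtain ⟨g, hg, rfl⟩ := exists_toAlg f
  rw [algU_toAlg, algV_toAlg, algV_toAlg, algU_toAlg]
  exact toAlg_congr _ _ fun z hz => (pdu_pdv_comm V.2 hg hz).symm

end SmoothRing

/-! ### Linearization of currents along flows -/

/-- The linearization of the `ε⁰` part of a current. -/
noncomputable def Current.lin0 (A : Current) (u v f g : ℝ → ℝ) (y : ℝ) : ℝ :=
  pdu A.lead (u y, v y) * f y + pdv A.lead (u y, v y) * g y

/-- The linearization of the `ε¹` part of a current. -/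
noncomputable def Current.lin1 (A : Current) (u v f g : ℝ → ℝ) (y : ℝ) : ℝ :=
  (pdu A.ux (u y, v y) * f y + pdv A.ux (u y, v y) * g y) * deriv u y
    + A.ux (u y, v y) * deriv f y
    + ((pdu A.vx (u y, v y) * f y + pdv A.vx (u y, v y) * g y) * deriv v y
    + A.vx (u y, v y) * deriv g y)

/-- The linearization of the `ε²` part of a current. -/
noncomputable def Current.lin2 (A : Current) (u v f g : ℝ → ℝ) (y : ℝ) : ℝ :=
  (pdu A.uxx (u y, v y) * f y + pdv A.uxx (u y, v y) * g y) * deriv (deriv u) y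
    + A.uxx (u y, v y) * deriv (deriv f) y
    + ((pdu A.vxx (u y, v y) * f y + pdv A.vxx (u y, v y) * g y) * deriv (deriv v) y
    + A.vxx (u y, v y) * deriv (deriv g) y)
    + ((pdu A.uxux (u y, v y) * f y + pdv A.uxux (u y, v y) * g y) * deriv u y ^ 2
    + A.uxux (u y, v y) * (2 * deriv u y * deriv f y))
    + ((pdu A.vxvx (u y, v y) * f y + pdv A.vxvx (u y, v y) * g y) * deriv v y ^ 2
    + A.vxvx (u y, v y) * (2 * deriv v y * deriv g y))
    + ((pdu A.uxvx (u y, v y) * f y + pdv A.uxvx (u y, v y) * g y) * (deriv u y * deriv v y)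
    + A.uxvx (u y, v y) * (deriv u y * deriv g y + deriv f y * deriv v y))

/-- The linearization of a current at `(u, v)` in the direction `(f, g)`. -/
noncomputable def Current.lin (A : Current) (ε : ℝ) (u v f g : ℝ → ℝ) (y : ℝ) : ℝ :=
  A.lin0 u v f g y + ε * A.lin1 u v f g y + ε ^ 2 * A.lin2 u v f g y

section Linearization

variable {V : Set (ℝ × ℝ)} {O : Set ℝ} {u v f g : ℝ → ℝ} {A : Current}

theorem smoothOn_comp_curve {h : ℝ × ℝ → ℝ} (hh : ContDiffOn ℝ ∞ h V) (hu : ContDiffOn ℝ ∞ u O)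
    (hv : ContDiffOn ℝ ∞ v O) (hc : ∀ y ∈ O, (u y, v y) ∈ V) :
    ContDiffOn ℝ ∞ (fun y => h (u y, v y)) O :=
  hh.comp (hu.prodMk hv) hc

theorem Current.smoothOn_eval (hO : IsOpen O) (hA : A.SmoothOn V) (hu : ContDiffOn ℝ ∞ u O)
    (hv : ContDiffOn ℝ ∞ v O) (hc : ∀ y ∈ O, (u y, v y) ∈ V) (ε : ℝ) :
    ContDiffOn ℝ ∞ (A.eval ε u v) O := by
  obtain ⟨h1, h2, h3, h4, h5, h6, h7, h8⟩ := hA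
  have c := fun {h : ℝ × ℝ → ℝ} (hh : ContDiffOn ℝ ∞ h V) => smoothOn_comp_curve hh hu hv hc
  have hu1 := smoothOn_deriv hO hu
  have hv1 := smoothOn_deriv hO hv
  have hu2 := smoothOn_deriv hO hu1
  have hv2 := smoothOn_deriv hO hv1
  exact ((c h1).add (contDiffOn_const.mul (((c h2).mul hu1).add ((c h3).mul hv1)))).add
    (contDiffOn_const.mul ((((((c h4).mul hu2).add ((c h5).mul hv2)).add
      ((c h6).mul (hu1.pow 2))).add ((c h7).mul (hv1.pow 2))).add ((c h8).mul (hu1.mul hv1))))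

theorem Current.smoothOn_rate (hO : IsOpen O) (hA : A.SmoothOn V) (hu : ContDiffOn ℝ ∞ u O)
    (hv : ContDiffOn ℝ ∞ v O) (hc : ∀ y ∈ O, (u y, v y) ∈ V) (ε : ℝ) :
    ContDiffOn ℝ ∞ (A.rate ε u v) O :=
  smoothOn_deriv hO (A.smoothOn_eval hO hA hu hv hc ε)

theorem Current.smoothOn_lin0 (hV : IsOpen V) (hA : A.SmoothOn V)
    (hu : ContDiffOn ℝ ∞ u O) (hv : ContDiffOn ℝ ∞ v O) (hc : ∀ y ∈ O, (u y, v y) ∈ V)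
    (hf : ContDiffOn ℝ ∞ f O) (hg : ContDiffOn ℝ ∞ g O) : ContDiffOn ℝ ∞ (A.lin0 u v f g) O := by
  have c := fun {h : ℝ × ℝ → ℝ} (hh : ContDiffOn ℝ ∞ h V) => smoothOn_comp_curve hh hu hv hc
  exact ((c (smoothOn_pdu hV hA.1)).mul hf).add ((c (smoothOn_pdv hV hA.1)).mul hg)

theorem Current.smoothOn_lin1 (hV : IsOpen V) (hO : IsOpen O) (hA : A.SmoothOn V)
    (hu : ContDiffOn ℝ ∞ u O) (hv : ContDiffOn ℝ ∞ v O) (hc : ∀ y ∈ O, (u y, v y) ∈ V)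
    (hf : ContDiffOn ℝ ∞ f O) (hg : ContDiffOn ℝ ∞ g O) : ContDiffOn ℝ ∞ (A.lin1 u v f g) O := by
  obtain ⟨h1, h2, h3, h4, h5, h6, h7, h8⟩ := hA
  have c := fun {h : ℝ × ℝ → ℝ} (hh : ContDiffOn ℝ ∞ h V) => smoothOn_comp_curve hh hu hv hc
  have d := fun {h : ℝ × ℝ → ℝ} (hh : ContDiffOn ℝ ∞ h V) =>
    ((c (smoothOn_pdu hV hh)).mul hf).add ((c (smoothOn_pdv hV hh)).mul hg)
  exact (((d h2).mul (smoothOn_deriv hO hu)).add ((c h2).mul (smoothOn_deriv hO hf))).add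
    (((d h3).mul (smoothOn_deriv hO hv)).add ((c h3).mul (smoothOn_deriv hO hg)))

theorem Current.smoothOn_lin2 (hV : IsOpen V) (hO : IsOpen O) (hA : A.SmoothOn V)
    (hu : ContDiffOn ℝ ∞ u O) (hv : ContDiffOn ℝ ∞ v O) (hc : ∀ y ∈ O, (u y, v y) ∈ V)
    (hf : ContDiffOn ℝ ∞ f O) (hg : ContDiffOn ℝ ∞ g O) : ContDiffOn ℝ ∞ (A.lin2 u v f g) O := by
  obtain ⟨h1, h2, h3, h4, h5, h6, h7, h8⟩ := hA
  have c := fun {h : ℝ × ℝ → ℝ} (hh : ContDiffOn ℝ ∞ h V) => smoothOn_comp_curve hh hu hv hc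
  have d := fun {h : ℝ × ℝ → ℝ} (hh : ContDiffOn ℝ ∞ h V) =>
    ((c (smoothOn_pdu hV hh)).mul hf).add ((c (smoothOn_pdv hV hh)).mul hg)
  have hu1 := smoothOn_deriv hO hu
  have hv1 := smoothOn_deriv hO hv
  have hf1 := smoothOn_deriv hO hf
  have hg1 := smoothOn_deriv hO hg
  have hu2 := smoothOn_deriv hO hu1
  have hv2 := smoothOn_deriv hO hv1
  have hf2 := smoothOn_deriv hO hf1
  have hg2 := smoothOn_deriv hO hg1
  have two : ContDiffOn ℝ ∞ (fun _ : ℝ => (2 : ℝ)) O := contDiffOn_const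
  exact ((((((d h4).mul hu2).add ((c h4).mul hf2)).add
    (((d h5).mul hv2).add ((c h5).mul hg2))).add
    (((d h6).mul (hu1.pow 2)).add ((c h6).mul ((two.mul hu1).mul hf1)))).add
    (((d h7).mul (hv1.pow 2)).add ((c h7).mul ((two.mul hv1).mul hg1)))).add
    (((d h8).mul (hu1.mul hv1)).add ((c h8).mul ((hu1.mul hg1).add (hf1.mul hv1))))

/-- The current evaluated on the variation `(u + s f, v + s g)`, as a function of `(s, y)`. -/
noncomputable def Current.variation (A : Current) (ε : ℝ) (u v f g : ℝ → ℝ) (q : ℝ × ℝ) : ℝ :=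
  A.eval ε (u + q.1 • f) (v + q.1 • g) q.2

theorem deriv_add_smul (hO : IsOpen O) (hu : ContDiffOn ℝ ∞ u O) (hf : ContDiffOn ℝ ∞ f O) (s : ℝ) :
    Set.EqOn (deriv (u + s • f)) (deriv u + s • deriv f) O := fun _ hy =>
  ((hasDerivAt_of_smoothOn hO hu hy).add ((hasDerivAt_of_smoothOn hO hf hy).const_smul s)).deriv

theorem deriv_eqOn {h k : ℝ → ℝ} (hO : IsOpen O) (e : Set.EqOn h k O) :
    Set.EqOn (deriv h) (deriv k) O := fun _ hy =>
  Filter.EventuallyEq.deriv_eq (e.eventuallyEq_of_mem (hO.mem_nhds hy))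

theorem Current.variation_eq (hO : IsOpen O) (hu : ContDiffOn ℝ ∞ u O) (hv : ContDiffOn ℝ ∞ v O)
    (hf : ContDiffOn ℝ ∞ f O) (hg : ContDiffOn ℝ ∞ g O) (ε s : ℝ) {y : ℝ} (hy : y ∈ O) :
    A.variation ε u v f g (s, y) =
      A.lead (u y + s * f y, v y + s * g y)
      + ε * (A.ux (u y + s * f y, v y + s * g y) * (deriv u y + s * deriv f y)
        + A.vx (u y + s * f y, v y + s * g y) * (deriv v y + s * deriv g y))
      + ε ^ 2 * (A.uxx (u y + s * f y, v y + s * g y) * (deriv (deriv u) y + s * deriv (deriv f) y)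
        + A.vxx (u y + s * f y, v y + s * g y) * (deriv (deriv v) y + s * deriv (deriv g) y)
        + A.uxux (u y + s * f y, v y + s * g y) * (deriv u y + s * deriv f y) ^ 2
        + A.vxvx (u y + s * f y, v y + s * g y) * (deriv v y + s * deriv g y) ^ 2
        + A.uxvx (u y + s * f y, v y + s * g y)
          * ((deriv u y + s * deriv f y) * (deriv v y + s * deriv g y))) := by
  have e1 := deriv_add_smul hO hu hf s hy
  have e2 := deriv_add_smul hO hv hg s hy
  have e3 := (deriv_eqOn hO (deriv_add_smul hO hu hf s) hy).trans
    (deriv_add_smul hO (smoothOn_deriv hO hu) (smoothOn_deriv hO hf) s hy)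
  have e4 := (deriv_eqOn hO (deriv_add_smul hO hv hg s) hy).trans
    (deriv_add_smul hO (smoothOn_deriv hO hv) (smoothOn_deriv hO hg) s hy)
  simp only [Current.variation, Current.eval]
  rw [e1, e2, e3, e4]
  simp only [Pi.add_apply, Pi.smul_apply, smul_eq_mul]

/-- The parameters `(s, y)` for which the variation stays in `V`. -/
def variationDomain (V : Set (ℝ × ℝ)) (O : Set ℝ) (u v f g : ℝ → ℝ) : Set (ℝ × ℝ) :=
  {q | q.2 ∈ O ∧ (u q.2 + q.1 * f q.2, v q.2 + q.1 * g q.2) ∈ V}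

theorem smoothOn_variation_pair (hu : ContDiffOn ℝ ∞ u O) (hv : ContDiffOn ℝ ∞ v O)
    (hf : ContDiffOn ℝ ∞ f O) (hg : ContDiffOn ℝ ∞ g O) :
    ContDiffOn ℝ ∞ (fun q : ℝ × ℝ => (u q.2 + q.1 * f q.2, v q.2 + q.1 * g q.2))
      {q : ℝ × ℝ | q.2 ∈ O} := by
  have s := fun {h : ℝ → ℝ} (hh : ContDiffOn ℝ ∞ h O) =>
    (hh.comp (contDiff_snd (𝕜 := ℝ) (E := ℝ) (F := ℝ)).contDiffOn (fun q hq => hq) :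
      ContDiffOn ℝ ∞ (h ∘ Prod.snd) {q : ℝ × ℝ | q.2 ∈ O})
  exact ((s hu).add (contDiff_fst.contDiffOn.mul (s hf))).prodMk
    ((s hv).add (contDiff_fst.contDiffOn.mul (s hg)))

theorem isOpen_variationDomain (hV : IsOpen V) (hO : IsOpen O) (hu : ContDiffOn ℝ ∞ u O)
    (hv : ContDiffOn ℝ ∞ v O) (hf : ContDiffOn ℝ ∞ f O) (hg : ContDiffOn ℝ ∞ g O) :
    IsOpen (variationDomain V O u v f g) :=
  (smoothOn_variation_pair hu hv hf hg).continuousOn.isOpen_inter_preimage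
    (hO.preimage continuous_snd) hV

theorem Current.smoothOn_variation (hO : IsOpen O) (hA : A.SmoothOn V)
    (hu : ContDiffOn ℝ ∞ u O) (hv : ContDiffOn ℝ ∞ v O) (hf : ContDiffOn ℝ ∞ f O)
    (hg : ContDiffOn ℝ ∞ g O) (ε : ℝ) :
    ContDiffOn ℝ ∞ (A.variation ε u v f g) (variationDomain V O u v f g) := by
  obtain ⟨h1, h2, h3, h4, h5, h6, h7, h8⟩ := hA
  have c := fun {h : ℝ × ℝ → ℝ} (hh : ContDiffOn ℝ ∞ h V) =>
    hh.comp ((smoothOn_variation_pair hu hv hf hg).mono (fun q hq => hq.1 :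
      variationDomain V O u v f g ⊆ _)) (fun q hq => hq.2)
  have s := fun {h : ℝ → ℝ} (hh : ContDiffOn ℝ ∞ h O) =>
    (hh.comp (contDiff_snd (𝕜 := ℝ) (E := ℝ) (F := ℝ)).contDiffOn (fun q hq => hq.1) :
      ContDiffOn ℝ ∞ (h ∘ Prod.snd) (variationDomain V O u v f g))
  have l := fun {h k : ℝ → ℝ} (hh : ContDiffOn ℝ ∞ h O) (hk : ContDiffOn ℝ ∞ k O) =>
    (s hh).add (contDiff_fst.contDiffOn.mul (s hk))
  have hu1 := l (smoothOn_deriv hO hu) (smoothOn_deriv hO hf)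
  have hv1 := l (smoothOn_deriv hO hv) (smoothOn_deriv hO hg)
  have hu2 := l (smoothOn_deriv hO (smoothOn_deriv hO hu)) (smoothOn_deriv hO (smoothOn_deriv hO hf))
  have hv2 := l (smoothOn_deriv hO (smoothOn_deriv hO hv)) (smoothOn_deriv hO (smoothOn_deriv hO hg))
  refine ContDiffOn.congr ?_ fun q hq => Current.variation_eq hO hu hv hf hg ε q.1 hq.1
  exact ((c h1).add (contDiffOn_const.mul (((c h2).mul hu1).add ((c h3).mul hv1)))).add
    (contDiffOn_const.mul ((((((c h4).mul hu2).add ((c h5).mul hv2)).add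
      ((c h6).mul (hu1.pow 2))).add ((c h7).mul (hv1.pow 2))).add ((c h8).mul (hu1.mul hv1))))

theorem hasDerivAt_affine (a b s : ℝ) : HasDerivAt (fun t => a + t * b) b s := by
  simpa using ((hasDerivAt_id s).mul_const b).const_add a

/-- This justifies the formulas for `lin0`, `lin1` and `lin2`: differentiating the expanded
variation term by term at parameter `0` produces exactly them. -/
theorem Current.pdu_variation (hV : IsOpen V) (hO : IsOpen O) (hA : A.SmoothOn V)
    (hu : ContDiffOn ℝ ∞ u O) (hv : ContDiffOn ℝ ∞ v O) (hc : ∀ y ∈ O, (u y, v y) ∈ V)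
    (hf : ContDiffOn ℝ ∞ f O) (hg : ContDiffOn ℝ ∞ g O) (ε : ℝ) {y : ℝ} (hy : y ∈ O) :
    pdu (A.variation ε u v f g) (0, y) = A.lin ε u v f g y := by
  obtain ⟨h1, h2, h3, h4, h5, h6, h7, h8⟩ := hA
  have c : ∀ {h : ℝ × ℝ → ℝ} (hh : ContDiffOn ℝ ∞ h V),
      HasDerivAt (fun s => h (u y + s * f y, v y + s * g y))
        (pdu h (u y, v y) * f y + pdv h (u y, v y) * g y) 0 := by
    intro h hh
    have := hasDerivAt_comp_curve (u := fun s => u y + s * f y) (v := fun s => v y + s * g y)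
      (x := 0) hV hh (by simpa using hc y hy) (hasDerivAt_affine _ _ _) (hasDerivAt_affine _ _ _)
    simpa using this
  have l := fun a b => hasDerivAt_affine a b 0
  refine HasDerivAt.deriv (f := fun s => A.variation ε u v f g (s, y)) ?_
  rw [funext fun s => Current.variation_eq (A := A) hO hu hv hf hg ε s hy]
  refine HasDerivAt.congr_deriv (((c h1).add ((((c h2).mul (l _ _)).add ((c h3).mul (l _ _))).const_mul ε)).add
    (((((((c h4).mul (l _ _)).add ((c h5).mul (l _ _))).add
      ((c h6).mul ((l _ _).pow 2))).add ((c h7).mul ((l _ _).pow 2))).add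
      ((c h8).mul ((l _ _).mul (l _ _)))).const_mul (ε ^ 2))) ?_
  simp only [Current.lin, Current.lin0, Current.lin1, Current.lin2, zero_mul, add_zero, Pi.pow_apply,
    Pi.mul_apply]
  push_cast
  ring

/-- The derivative of the rate in the direction `(f, g)` is the `x`-derivative of the linearized
current. -/
theorem Current.hasDerivAt_rate (hV : IsOpen V) (hO : IsOpen O) (hA : A.SmoothOn V)
    (hu : ContDiffOn ℝ ∞ u O) (hv : ContDiffOn ℝ ∞ v O) (hc : ∀ y ∈ O, (u y, v y) ∈ V)
    (hf : ContDiffOn ℝ ∞ f O) (hg : ContDiffOn ℝ ∞ g O) (ε : ℝ) {x : ℝ} (hx : x ∈ O) :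
    HasDerivAt (fun s : ℝ => A.rate ε (u + s • f) (v + s • g) x)
      (deriv (A.lin ε u v f g) x) 0 := by
  have hW := isOpen_variationDomain hV hO hu hv hf hg
  have hS := Current.smoothOn_variation hO hA hu hv hf hg ε
  have h0 : ∀ y ∈ O, ((0 : ℝ), y) ∈ variationDomain V O u v f g := fun y hy =>
    ⟨hy, by simpa using hc y hy⟩
  have h := hasDerivAt_pdu hW (smoothOn_pdv hW hS) (h0 x hx)
  -- The rate is an `x`-derivative of the variation; exchanging the two partial derivatives moves
  -- the variation inside, onto the current.
  rw [pdu_pdv_comm hW hS (h0 x hx)] at h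
  have e : pdv (pdu (A.variation ε u v f g)) (0, x) = deriv (A.lin ε u v f g) x :=
    Filter.EventuallyEq.deriv_eq (by
      filter_upwards [hO.mem_nhds hx] with y hy using
        Current.pdu_variation hV hO hA hu hv hc hf hg ε hy)
  rw [e] at h
  exact h

/-- The rate along a variation depends smoothly on the parameter. -/
theorem System.derivAlong_rate {S : System} (hV : IsOpen V) (hO : IsOpen O) (hA : A.SmoothOn V)
    (hS : S.SmoothOn V) (hu : ContDiffOn ℝ ∞ u O) (hv : ContDiffOn ℝ ∞ v O)
    (hc : ∀ y ∈ O, (u y, v y) ∈ V) (ε δ : ℝ) {x : ℝ} (hx : x ∈ O) :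
    S.derivAlong ε (A.rate δ) u v x =
      deriv (A.lin δ u v (S.fst.rate ε u v) (S.snd.rate ε u v)) x :=
  (Current.hasDerivAt_rate hV hO hA hu hv hc (S.fst.smoothOn_rate hO hS.1 hu hv hc ε)
    (S.snd.smoothOn_rate hO hS.2 hu hv hc ε) δ hx).deriv

end Linearization

/-! ### Second order currents over a differential ring -/

/-- The coefficients of the `ε⁰` and `ε²` parts of a current, in an arbitrary ring. -/
@[ext]
structure AlgCurrent (R : Type*) where
  lead : R
  uxx : R
  vxx : R
  uxux : R
  vxvx : R
  uxvx : R

/-- The coefficients of a homogeneous differential polynomial of degree `3`. -/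
@[ext]
structure Cubic (R : Type*) where
  u3 : R
  v3 : R
  u1u2 : R
  v1u2 : R
  u1v2 : R
  v1v2 : R
  u1u1u1 : R
  u1u1v1 : R
  u1v1v1 : R
  v1v1v1 : R

/-- The `ε²` part of the derivative of the current `A` along the flow `u_t = ∂ₓ P`, `v_t = ∂ₓ Q`. -/
def AlgCurrent.flow {R : Type*} [CommRing R] (du dv : R → R) (A P Q : AlgCurrent R) : Cubic R where
  u3 := du A.lead * P.uxx + dv A.lead * Q.uxx + A.uxx * du P.lead + A.vxx * du Q.lead
  v3 := du A.lead * P.vxx + dv A.lead * Q.vxx + A.uxx * dv P.lead + A.vxx * dv Q.lead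
  u1u2 := du A.lead * (du P.uxx + 2 * P.uxux) + dv A.lead * (du Q.uxx + 2 * Q.uxux)
    + A.uxx * (3 * du (du P.lead)) + A.vxx * (3 * du (du Q.lead))
    + du P.lead * du A.uxx + du Q.lead * dv A.uxx + 2 * A.uxux * du P.lead + A.uxvx * du Q.lead
  v1u2 := du A.lead * (dv P.uxx + P.uxvx) + dv A.lead * (dv Q.uxx + Q.uxvx)
    + A.uxx * (3 * dv (du P.lead)) + A.vxx * (3 * dv (du Q.lead))
    + dv P.lead * du A.uxx + dv Q.lead * dv A.uxx + 2 * A.vxvx * du Q.lead + A.uxvx * du P.lead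
  u1v2 := du A.lead * (du P.vxx + P.uxvx) + dv A.lead * (du Q.vxx + Q.uxvx)
    + A.uxx * (3 * dv (du P.lead)) + A.vxx * (3 * dv (du Q.lead))
    + du P.lead * du A.vxx + du Q.lead * dv A.vxx + 2 * A.uxux * dv P.lead + A.uxvx * dv Q.lead
  v1v2 := du A.lead * (dv P.vxx + 2 * P.vxvx) + dv A.lead * (dv Q.vxx + 2 * Q.vxvx)
    + A.uxx * (3 * dv (dv P.lead)) + A.vxx * (3 * dv (dv Q.lead))
    + dv P.lead * du A.vxx + dv Q.lead * dv A.vxx + 2 * A.vxvx * dv Q.lead + A.uxvx * dv P.lead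
  u1u1u1 := du A.lead * du P.uxux + dv A.lead * du Q.uxux
    + A.uxx * du (du (du P.lead)) + A.vxx * du (du (du Q.lead))
    + du P.lead * du A.uxux + du Q.lead * dv A.uxux
    + 2 * A.uxux * du (du P.lead) + A.uxvx * du (du Q.lead)
  u1u1v1 := du A.lead * (dv P.uxux + du P.uxvx) + dv A.lead * (dv Q.uxux + du Q.uxvx)
    + A.uxx * (3 * dv (du (du P.lead))) + A.vxx * (3 * dv (du (du Q.lead)))
    + dv P.lead * du A.uxux + dv Q.lead * dv A.uxux + du P.lead * du A.uxvx + du Q.lead * dv A.uxvx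
    + 4 * A.uxux * dv (du P.lead) + 2 * A.vxvx * du (du Q.lead)
    + A.uxvx * (2 * dv (du Q.lead) + du (du P.lead))
  u1v1v1 := du A.lead * (du P.vxvx + dv P.uxvx) + dv A.lead * (du Q.vxvx + dv Q.uxvx)
    + A.uxx * (3 * dv (dv (du P.lead))) + A.vxx * (3 * dv (dv (du Q.lead)))
    + du P.lead * du A.vxvx + du Q.lead * dv A.vxvx + dv P.lead * du A.uxvx + dv Q.lead * dv A.uxvx
    + 2 * A.uxux * dv (dv P.lead) + 4 * A.vxvx * dv (du Q.lead)
    + A.uxvx * (dv (dv Q.lead) + 2 * dv (du P.lead))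
  v1v1v1 := du A.lead * dv P.vxvx + dv A.lead * dv Q.vxvx
    + A.uxx * dv (dv (dv P.lead)) + A.vxx * dv (dv (dv Q.lead))
    + dv P.lead * du A.vxvx + dv Q.lead * dv A.vxvx
    + 2 * A.vxvx * dv (dv Q.lead) + A.uxvx * dv (dv P.lead)

/-- The `ε⁰` and `ε²` parts of a smooth current. -/
def Current.coeffs {V : Opens (ℝ × ℝ)} (A : Current) (hA : A.SmoothOn V) :
    AlgCurrent (smoothAlg V) where
  lead := toAlg A.lead hA.1
  uxx := toAlg A.uxx hA.2.2.2.1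
  vxx := toAlg A.vxx hA.2.2.2.2.1
  uxux := toAlg A.uxux hA.2.2.2.2.2.1
  vxvx := toAlg A.vxvx hA.2.2.2.2.2.2.1
  uxvx := toAlg A.uxvx hA.2.2.2.2.2.2.2

/-- The value of a cubic differential polynomial on a pair of functions. -/
noncomputable def Cubic.eval {V : Opens (ℝ × ℝ)} (K : Cubic (smoothAlg V)) (u v : ℝ → ℝ) (y : ℝ) :
    ℝ :=
  extend K.u3 (u y, v y) * deriv (deriv (deriv u)) y
  + extend K.v3 (u y, v y) * deriv (deriv (deriv v)) y
  + extend K.u1u2 (u y, v y) * (deriv u y * deriv (deriv u) y)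
  + extend K.v1u2 (u y, v y) * (deriv v y * deriv (deriv u) y)
  + extend K.u1v2 (u y, v y) * (deriv u y * deriv (deriv v) y)
  + extend K.v1v2 (u y, v y) * (deriv v y * deriv (deriv v) y)
  + extend K.u1u1u1 (u y, v y) * deriv u y ^ 3
  + extend K.u1u1v1 (u y, v y) * (deriv u y ^ 2 * deriv v y)
  + extend K.u1v1v1 (u y, v y) * (deriv u y * deriv v y ^ 2)
  + extend K.v1v1v1 (u y, v y) * deriv v y ^ 3

/-! ### Chain rule along a curve, up to third derivatives -/

section Curve

variable {V : Opens (ℝ × ℝ)} {O : Set ℝ} {u v : ℝ → ℝ}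

theorem extend_eq_evalAt (h : smoothAlg V) {z : ℝ × ℝ} (hz : z ∈ V) :
    extend h z = evalAt ⟨z, hz⟩ h := extend_apply h ⟨z, hz⟩

theorem eqOn_extend_toAlg {h : ℝ × ℝ → ℝ} (hh : ContDiffOn ℝ ∞ h V)
    (hc : ∀ y ∈ O, (u y, v y) ∈ V) :
    Set.EqOn (fun y => h (u y, v y)) (fun y => extend (toAlg h hh) (u y, v y)) O := fun y hy =>
  (extend_toAlg hh (hc y hy)).symm

theorem pdu_eq_extend {h : ℝ × ℝ → ℝ} (hh : ContDiffOn ℝ ∞ h V) {z : ℝ × ℝ} (hz : z ∈ V) :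
    pdu h z = extend (algU V (toAlg h hh)) z := by
  rw [algU_toAlg, extend_toAlg _ hz]

theorem pdv_eq_extend {h : ℝ × ℝ → ℝ} (hh : ContDiffOn ℝ ∞ h V) {z : ℝ × ℝ} (hz : z ∈ V) :
    pdv h z = extend (algV V (toAlg h hh)) z := by
  rw [algV_toAlg, extend_toAlg _ hz]

theorem hasDerivAt_extend (h : smoothAlg V) {x u' v' : ℝ} (hx : (u x, v x) ∈ V)
    (hu : HasDerivAt u u' x) (hv : HasDerivAt v v' x) :
    HasDerivAt (fun y => extend h (u y, v y))
      (extend (algU V h) (u x, v x) * u' + extend (algV V h) (u x, v x) * v') x := by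
  have := hasDerivAt_comp_curve V.2 (smoothOn_extend h) hx hu hv
  rwa [pdu_eq_extend (smoothOn_extend h) hx, pdv_eq_extend (smoothOn_extend h) hx,
    toAlg_extend] at this

theorem deriv_extend (hO : IsOpen O) (hu : ContDiffOn ℝ ∞ u O) (hv : ContDiffOn ℝ ∞ v O)
    (hc : ∀ y ∈ O, (u y, v y) ∈ V) (h : smoothAlg V) :
    Set.EqOn (deriv fun y => extend h (u y, v y))
      (fun y => extend (algU V h) (u y, v y) * deriv u y
        + extend (algV V h) (u y, v y) * deriv v y) O := fun y hy =>
  (hasDerivAt_extend h (hc y hy) (hasDerivAt_of_smoothOn hO hu hy)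
    (hasDerivAt_of_smoothOn hO hv hy)).deriv

theorem deriv2_extend (hO : IsOpen O) (hu : ContDiffOn ℝ ∞ u O) (hv : ContDiffOn ℝ ∞ v O)
    (hc : ∀ y ∈ O, (u y, v y) ∈ V) (h : smoothAlg V) :
    Set.EqOn (deriv (deriv fun y => extend h (u y, v y)))
      (fun y => extend (algU V h) (u y, v y) * deriv (deriv u) y
        + extend (algV V h) (u y, v y) * deriv (deriv v) y
        + extend (algU V (algU V h)) (u y, v y) * deriv u y ^ 2
        + 2 * extend (algV V (algU V h)) (u y, v y) * (deriv u y * deriv v y)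
        + extend (algV V (algV V h)) (u y, v y) * deriv v y ^ 2) O := by
  intro y hy
  have e := fun k : smoothAlg V => hasDerivAt_extend k (hc y hy) (hasDerivAt_of_smoothOn hO hu hy)
    (hasDerivAt_of_smoothOn hO hv hy)
  have hu2 := hasDerivAt_of_smoothOn hO (smoothOn_deriv hO hu) hy
  have hv2 := hasDerivAt_of_smoothOn hO (smoothOn_deriv hO hv) hy
  rw [deriv_eqOn hO (deriv_extend hO hu hv hc h) hy]
  refine (((e (algU V h)).mul hu2).add ((e (algV V h)).mul hv2)).deriv.trans ?_
  rw [← algV_algU_comm]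
  ring

theorem deriv3_extend (hO : IsOpen O) (hu : ContDiffOn ℝ ∞ u O) (hv : ContDiffOn ℝ ∞ v O)
    (hc : ∀ y ∈ O, (u y, v y) ∈ V) (h : smoothAlg V) :
    Set.EqOn (deriv (deriv (deriv fun y => extend h (u y, v y))))
      (fun y => extend (algU V h) (u y, v y) * deriv (deriv (deriv u)) y
        + extend (algV V h) (u y, v y) * deriv (deriv (deriv v)) y
        + 3 * extend (algU V (algU V h)) (u y, v y) * (deriv u y * deriv (deriv u) y)
        + 3 * extend (algV V (algU V h)) (u y, v y)
          * (deriv u y * deriv (deriv v) y + deriv v y * deriv (deriv u) y)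
        + 3 * extend (algV V (algV V h)) (u y, v y) * (deriv v y * deriv (deriv v) y)
        + extend (algU V (algU V (algU V h))) (u y, v y) * deriv u y ^ 3
        + 3 * extend (algV V (algU V (algU V h))) (u y, v y) * (deriv u y ^ 2 * deriv v y)
        + 3 * extend (algV V (algV V (algU V h))) (u y, v y) * (deriv u y * deriv v y ^ 2)
        + extend (algV V (algV V (algV V h))) (u y, v y) * deriv v y ^ 3) O := by
  intro y hy
  have e := fun k : smoothAlg V => hasDerivAt_extend k (hc y hy) (hasDerivAt_of_smoothOn hO hu hy)
    (hasDerivAt_of_smoothOn hO hv hy)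
  have hu2 := hasDerivAt_of_smoothOn hO (smoothOn_deriv hO hu) hy
  have hv2 := hasDerivAt_of_smoothOn hO (smoothOn_deriv hO hv) hy
  have hu3 := hasDerivAt_of_smoothOn hO (smoothOn_deriv hO (smoothOn_deriv hO hu)) hy
  have hv3 := hasDerivAt_of_smoothOn hO (smoothOn_deriv hO (smoothOn_deriv hO hv)) hy
  rw [deriv_eqOn hO (deriv2_extend hO hu hv hc h) hy]
  refine ((((((e (algU V h)).mul hu3).add ((e (algV V h)).mul hv3)).add
    ((e (algU V (algU V h))).mul (hu2.pow 2))).add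
    (((e (algV V (algU V h))).const_mul 2).mul (hu2.mul hv2))).add
    ((e (algV V (algV V h))).mul (hv2.pow 2))).deriv.trans ?_
  rw [← algV_algU_comm (algU V h), ← algV_algU_comm (algV V h), ← algV_algU_comm h]
  simp only [Pi.mul_apply, Pi.pow_apply]
  push_cast
  ring

end Curve

/-! ### Expansion of the commutator in powers of `ε` -/

/-- The `ε⁰` part of the value of a current. -/
def Current.ev0 (A : Current) (u v : ℝ → ℝ) (y : ℝ) : ℝ := A.lead (u y, v y)

/-- The `ε¹` part of the value of a current. -/
noncomputable def Current.ev1 (A : Current) (u v : ℝ → ℝ) (y : ℝ) : ℝ :=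
  A.ux (u y, v y) * deriv u y + A.vx (u y, v y) * deriv v y

/-- The `ε²` part of the value of a current. -/
noncomputable def Current.ev2 (A : Current) (u v : ℝ → ℝ) (y : ℝ) : ℝ :=
  A.uxx (u y, v y) * deriv (deriv u) y + A.vxx (u y, v y) * deriv (deriv v) y
      + A.uxux (u y, v y) * deriv u y ^ 2 + A.vxvx (u y, v y) * deriv v y ^ 2
      + A.uxvx (u y, v y) * (deriv u y * deriv v y)

section Expansion

variable {V : Set (ℝ × ℝ)} {O : Set ℝ} {u v : ℝ → ℝ} {A : Current} {T : System}

theorem Current.smoothOn_ev0 (hA : A.SmoothOn V) (hu : ContDiffOn ℝ ∞ u O)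
    (hv : ContDiffOn ℝ ∞ v O) (hc : ∀ y ∈ O, (u y, v y) ∈ V) : ContDiffOn ℝ ∞ (A.ev0 u v) O :=
  smoothOn_comp_curve hA.1 hu hv hc

theorem Current.smoothOn_ev1 (hO : IsOpen O) (hA : A.SmoothOn V) (hu : ContDiffOn ℝ ∞ u O)
    (hv : ContDiffOn ℝ ∞ v O) (hc : ∀ y ∈ O, (u y, v y) ∈ V) : ContDiffOn ℝ ∞ (A.ev1 u v) O :=
  ((smoothOn_comp_curve hA.2.1 hu hv hc).mul (smoothOn_deriv hO hu)).add
    ((smoothOn_comp_curve hA.2.2.1 hu hv hc).mul (smoothOn_deriv hO hv))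

theorem Current.smoothOn_ev2 (hO : IsOpen O) (hA : A.SmoothOn V) (hu : ContDiffOn ℝ ∞ u O)
    (hv : ContDiffOn ℝ ∞ v O) (hc : ∀ y ∈ O, (u y, v y) ∈ V) : ContDiffOn ℝ ∞ (A.ev2 u v) O := by
  obtain ⟨h1, h2, h3, h4, h5, h6, h7, h8⟩ := hA
  have c := fun {h : ℝ × ℝ → ℝ} (hh : ContDiffOn ℝ ∞ h V) => smoothOn_comp_curve hh hu hv hc
  have hu1 := smoothOn_deriv hO hu
  have hv1 := smoothOn_deriv hO hv
  have hu2 := smoothOn_deriv hO hu1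
  have hv2 := smoothOn_deriv hO hv1
  exact ((((((c h4).mul hu2).add ((c h5).mul hv2)).add
      ((c h6).mul (hu1.pow 2))).add ((c h7).mul (hv1.pow 2))).add ((c h8).mul (hu1.mul hv1)))

theorem deriv_combination (hO : IsOpen O) {f₀ f₁ f₂ : ℝ → ℝ} (h0 : ContDiffOn ℝ ∞ f₀ O)
    (h1 : ContDiffOn ℝ ∞ f₁ O) (h2 : ContDiffOn ℝ ∞ f₂ O) (ε : ℝ) :
    Set.EqOn (deriv (f₀ + ε • f₁ + ε ^ 2 • f₂)) (deriv f₀ + ε • deriv f₁ + ε ^ 2 • deriv f₂) O :=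
  fun _ hy => (((hasDerivAt_of_smoothOn hO h0 hy).add
    ((hasDerivAt_of_smoothOn hO h1 hy).const_smul ε)).add
    ((hasDerivAt_of_smoothOn hO h2 hy).const_smul (ε ^ 2))).deriv

theorem Current.rate_eqOn (hO : IsOpen O) (hA : A.SmoothOn V) (hu : ContDiffOn ℝ ∞ u O)
    (hv : ContDiffOn ℝ ∞ v O) (hc : ∀ y ∈ O, (u y, v y) ∈ V) (ε : ℝ) :
    Set.EqOn (A.rate ε u v)
      (deriv (A.ev0 u v) + ε • deriv (A.ev1 u v) + ε ^ 2 • deriv (A.ev2 u v)) O :=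
  deriv_combination hO (A.smoothOn_ev0 hA hu hv hc) (A.smoothOn_ev1 hO hA hu hv hc)
    (A.smoothOn_ev2 hO hA hu hv hc) ε

/-- The `ε⁰` part of the derivative of `A` along `T`. -/
noncomputable def Current.flow0 (A : Current) (T : System) (u v : ℝ → ℝ) : ℝ → ℝ :=
  A.lin0 u v (deriv (T.fst.ev0 u v)) (deriv (T.snd.ev0 u v))

/-- The `ε¹` part of the derivative of `A` along `T`. -/
noncomputable def Current.flow1 (A : Current) (T : System) (u v : ℝ → ℝ) : ℝ → ℝ :=
  A.lin0 u v (deriv (T.fst.ev1 u v)) (deriv (T.snd.ev1 u v))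
    + A.lin1 u v (deriv (T.fst.ev0 u v)) (deriv (T.snd.ev0 u v))

/-- The `ε²` part of the derivative of `A` along `T`. -/
noncomputable def Current.flow2 (A : Current) (T : System) (u v : ℝ → ℝ) : ℝ → ℝ :=
  A.lin0 u v (deriv (T.fst.ev2 u v)) (deriv (T.snd.ev2 u v))
    + A.lin1 u v (deriv (T.fst.ev1 u v)) (deriv (T.snd.ev1 u v))
    + A.lin2 u v (deriv (T.fst.ev0 u v)) (deriv (T.snd.ev0 u v))

/-- The rates have degree 2 in `ε` and the linearization adds at most two more powers, so the result
has degree 4. Only the first three coefficients matter; of the other two, smoothness is all that is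
used. -/
theorem Current.lin_rate (hV : IsOpen V) (hO : IsOpen O) (hA : A.SmoothOn V) (hT : T.SmoothOn V)
    (hu : ContDiffOn ℝ ∞ u O) (hv : ContDiffOn ℝ ∞ v O) (hc : ∀ y ∈ O, (u y, v y) ∈ V) :
    ContDiffOn ℝ ∞ (A.flow0 T u v) O ∧ ContDiffOn ℝ ∞ (A.flow1 T u v) O ∧
    ContDiffOn ℝ ∞ (A.flow2 T u v) O ∧
    ∃ B₃ B₄ : ℝ → ℝ, ContDiffOn ℝ ∞ B₃ O ∧ ContDiffOn ℝ ∞ B₄ O ∧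
      ∀ ε, Set.EqOn (A.lin ε u v (T.fst.rate ε u v) (T.snd.rate ε u v))
        (A.flow0 T u v + ε • A.flow1 T u v + ε ^ 2 • A.flow2 T u v + ε ^ 3 • B₃ + ε ^ 4 • B₄) O := by
  have f0 := smoothOn_deriv hO (T.fst.smoothOn_ev0 hT.1 hu hv hc)
  have f1 := smoothOn_deriv hO (T.fst.smoothOn_ev1 hO hT.1 hu hv hc)
  have f2 := smoothOn_deriv hO (T.fst.smoothOn_ev2 hO hT.1 hu hv hc)
  have g0 := smoothOn_deriv hO (T.snd.smoothOn_ev0 hT.2 hu hv hc)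
  have g1 := smoothOn_deriv hO (T.snd.smoothOn_ev1 hO hT.2 hu hv hc)
  have g2 := smoothOn_deriv hO (T.snd.smoothOn_ev2 hO hT.2 hu hv hc)
  have l0 := fun {f g} (hf : ContDiffOn ℝ ∞ f O) (hg : ContDiffOn ℝ ∞ g O) =>
    A.smoothOn_lin0 hV hA hu hv hc hf hg
  have l1 := fun {f g} (hf : ContDiffOn ℝ ∞ f O) (hg : ContDiffOn ℝ ∞ g O) =>
    A.smoothOn_lin1 hV hO hA hu hv hc hf hg
  have l2 := fun {f g} (hf : ContDiffOn ℝ ∞ f O) (hg : ContDiffOn ℝ ∞ g O) =>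
    A.smoothOn_lin2 hV hO hA hu hv hc hf hg
  refine ⟨l0 f0 g0, (l0 f1 g1).add (l1 f0 g0), ((l0 f2 g2).add (l1 f1 g1)).add (l2 f0 g0),
    A.lin1 u v (deriv (T.fst.ev2 u v)) (deriv (T.snd.ev2 u v))
      + A.lin2 u v (deriv (T.fst.ev1 u v)) (deriv (T.snd.ev1 u v)),
    A.lin2 u v (deriv (T.fst.ev2 u v)) (deriv (T.snd.ev2 u v)),
    (l1 f2 g2).add (l2 f1 g1), l2 f2 g2, fun ε y hy => ?_⟩
  have e1 := T.fst.rate_eqOn hO hT.1 hu hv hc ε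
  have e2 := T.snd.rate_eqOn hO hT.2 hu hv hc ε
  have d1 := (deriv_eqOn hO e1).trans (deriv_combination hO f0 f1 f2 ε)
  have d2 := (deriv_eqOn hO e2).trans (deriv_combination hO g0 g1 g2 ε)
  have dd1 := (deriv_eqOn hO d1).trans (deriv_combination hO (smoothOn_deriv hO f0)
    (smoothOn_deriv hO f1) (smoothOn_deriv hO f2) ε)
  have dd2 := (deriv_eqOn hO d2).trans (deriv_combination hO (smoothOn_deriv hO g0)
    (smoothOn_deriv hO g1) (smoothOn_deriv hO g2) ε)
  simp only [Current.flow0, Current.flow1, Current.flow2, Current.lin, Current.lin0, Current.lin1,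
    Current.lin2, Pi.add_apply, Pi.smul_apply, smul_eq_mul]
  rw [e1 hy, e2 hy, d1 hy, d2 hy, dd1 hy, dd2 hy]
  simp only [Pi.add_apply, Pi.smul_apply, smul_eq_mul]
  ring

theorem Current.deriv_lin_rate (hV : IsOpen V) (hO : IsOpen O) (hA : A.SmoothOn V)
    (hT : T.SmoothOn V) (hu : ContDiffOn ℝ ∞ u O) (hv : ContDiffOn ℝ ∞ v O)
    (hc : ∀ y ∈ O, (u y, v y) ∈ V) {x : ℝ} (hx : x ∈ O) :
    ∃ d₃ d₄ : ℝ, ∀ ε, deriv (A.lin ε u v (T.fst.rate ε u v) (T.snd.rate ε u v)) x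
      = deriv (A.flow0 T u v) x + ε * deriv (A.flow1 T u v) x + ε ^ 2 * deriv (A.flow2 T u v) x
        + ε ^ 3 * d₃ + ε ^ 4 * d₄ := by
  obtain ⟨h0, h1, h2, B₃, B₄, h3, h4, h⟩ := Current.lin_rate hV hO hA hT hu hv hc
  refine ⟨deriv B₃ x, deriv B₄ x, fun ε => ?_⟩
  rw [deriv_eqOn hO (h ε) hx]
  exact (((((hasDerivAt_of_smoothOn hO h0 hx).add
    ((hasDerivAt_of_smoothOn hO h1 hx).const_smul ε)).add
    ((hasDerivAt_of_smoothOn hO h2 hx).const_smul (ε ^ 2))).add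
    ((hasDerivAt_of_smoothOn hO h3 hx).const_smul (ε ^ 3))).add
    ((hasDerivAt_of_smoothOn hO h4 hx).const_smul (ε ^ 4))).deriv

end Expansion

/-! ### The `ε²` part of a derivative along a flow as a cubic differential polynomial -/

section FlowCubic

variable {V : Opens (ℝ × ℝ)} {O : Set ℝ} {u v : ℝ → ℝ} {A : Current} {T : System}

theorem Current.deriv_ev0 (hO : IsOpen O) (hA : A.SmoothOn V)
    (hc : ∀ y ∈ O, (u y, v y) ∈ V) :
    Set.EqOn (deriv (A.ev0 u v)) (deriv fun y => extend (A.coeffs hA).lead (u y, v y)) O :=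
  deriv_eqOn hO (eqOn_extend_toAlg hA.1 hc)

theorem Current.deriv_ev2 (hO : IsOpen O) (hA : A.SmoothOn V) (hu : ContDiffOn ℝ ∞ u O)
    (hv : ContDiffOn ℝ ∞ v O) (hc : ∀ y ∈ O, (u y, v y) ∈ V) :
    Set.EqOn (deriv (A.ev2 u v)) (fun y =>
      extend (A.coeffs hA).uxx (u y, v y) * deriv (deriv (deriv u)) y
      + extend (A.coeffs hA).vxx (u y, v y) * deriv (deriv (deriv v)) y
      + (extend (algU V (A.coeffs hA).uxx) (u y, v y) + 2 * extend (A.coeffs hA).uxux (u y, v y))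
        * (deriv u y * deriv (deriv u) y)
      + (extend (algV V (A.coeffs hA).uxx) (u y, v y) + extend (A.coeffs hA).uxvx (u y, v y))
        * (deriv v y * deriv (deriv u) y)
      + (extend (algU V (A.coeffs hA).vxx) (u y, v y) + extend (A.coeffs hA).uxvx (u y, v y))
        * (deriv u y * deriv (deriv v) y)
      + (extend (algV V (A.coeffs hA).vxx) (u y, v y) + 2 * extend (A.coeffs hA).vxvx (u y, v y))
        * (deriv v y * deriv (deriv v) y)
      + extend (algU V (A.coeffs hA).uxux) (u y, v y) * deriv u y ^ 3
      + (extend (algV V (A.coeffs hA).uxux) (u y, v y) + extend (algU V (A.coeffs hA).uxvx) (u y, v y))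
        * (deriv u y ^ 2 * deriv v y)
      + (extend (algU V (A.coeffs hA).vxvx) (u y, v y) + extend (algV V (A.coeffs hA).uxvx) (u y, v y))
        * (deriv u y * deriv v y ^ 2)
      + extend (algV V (A.coeffs hA).vxvx) (u y, v y) * deriv v y ^ 3) O := by
  intro y hy
  have e : Set.EqOn (A.ev2 u v) (fun y =>
      extend (A.coeffs hA).uxx (u y, v y) * deriv (deriv u) y
      + extend (A.coeffs hA).vxx (u y, v y) * deriv (deriv v) y
      + extend (A.coeffs hA).uxux (u y, v y) * deriv u y ^ 2
      + extend (A.coeffs hA).vxvx (u y, v y) * deriv v y ^ 2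
      + extend (A.coeffs hA).uxvx (u y, v y) * (deriv u y * deriv v y)) O := by
    intro y hy
    simp only [Current.coeffs, Current.ev2]
    rw [extend_toAlg _ (hc y hy), extend_toAlg _ (hc y hy), extend_toAlg _ (hc y hy),
      extend_toAlg _ (hc y hy), extend_toAlg _ (hc y hy)]
  have d := fun k : smoothAlg V => hasDerivAt_extend k (hc y hy) (hasDerivAt_of_smoothOn hO hu hy)
    (hasDerivAt_of_smoothOn hO hv hy)
  have hu2 := hasDerivAt_of_smoothOn hO (smoothOn_deriv hO hu) hy
  have hv2 := hasDerivAt_of_smoothOn hO (smoothOn_deriv hO hv) hy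
  have hu3 := hasDerivAt_of_smoothOn hO (smoothOn_deriv hO (smoothOn_deriv hO hu)) hy
  have hv3 := hasDerivAt_of_smoothOn hO (smoothOn_deriv hO (smoothOn_deriv hO hv)) hy
  rw [deriv_eqOn hO e hy]
  refine ((((((d _).mul hu3).add ((d _).mul hv3)).add ((d _).mul (hu2.pow 2))).add
    ((d _).mul (hv2.pow 2))).add ((d _).mul (hu2.mul hv2))).deriv.trans ?_
  simp only [Pi.mul_apply, Pi.pow_apply]
  push_cast
  ring

-- Here the ten expressions in the definition of `AlgCurrent.flow` are checked against actual
-- derivatives. The two summands are the ways to reach `ε²` without first order terms: the leading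
-- part of `A` with the second order part of the flow, and conversely.
set_option maxHeartbeats 1600000 in
theorem Current.flow_cubic (hO : IsOpen O) (hA : A.SmoothOn V) (hT : T.SmoothOn V)
    (hu : ContDiffOn ℝ ∞ u O) (hv : ContDiffOn ℝ ∞ v O) (hc : ∀ y ∈ O, (u y, v y) ∈ V) :
    Set.EqOn (A.lin0 u v (deriv (T.fst.ev2 u v)) (deriv (T.snd.ev2 u v))
        + A.lin2 u v (deriv (T.fst.ev0 u v)) (deriv (T.snd.ev0 u v)))
      (((A.coeffs hA).flow (algU V) (algV V) (T.fst.coeffs hT.1) (T.snd.coeffs hT.2)).eval u v)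
      O := by
  intro y hy
  have hz := hc y hy
  have f1 := T.fst.deriv_ev0 hO hT.1 hc
  have g1 := T.snd.deriv_ev0 hO hT.2 hc
  have f1' := f1.trans (deriv_extend hO hu hv hc _)
  have g1' := g1.trans (deriv_extend hO hu hv hc _)
  have f2 := (deriv_eqOn hO f1).trans (deriv2_extend hO hu hv hc _)
  have g2 := (deriv_eqOn hO g1).trans (deriv2_extend hO hu hv hc _)
  have f3 := (deriv_eqOn hO (deriv_eqOn hO f1)).trans (deriv3_extend hO hu hv hc _)
  have g3 := (deriv_eqOn hO (deriv_eqOn hO g1)).trans (deriv3_extend hO hu hv hc _)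
  have k := fun {h : ℝ × ℝ → ℝ} (hh : ContDiffOn ℝ ∞ h V) =>
    (show h (u y, v y) = extend (toAlg h hh) (u y, v y) from (extend_toAlg hh hz).symm)
  have ku := fun {h : ℝ × ℝ → ℝ} (hh : ContDiffOn ℝ ∞ h V) => pdu_eq_extend hh hz
  have kv := fun {h : ℝ × ℝ → ℝ} (hh : ContDiffOn ℝ ∞ h V) => pdv_eq_extend hh hz
  obtain ⟨h1, h2, h3, h4, h5, h6, h7, h8⟩ := id hA
  have a1u : pdu A.lead (u y, v y) = extend (algU V (A.coeffs hA).lead) (u y, v y) := ku h1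
  have a1v : pdv A.lead (u y, v y) = extend (algV V (A.coeffs hA).lead) (u y, v y) := kv h1
  have a4 : A.uxx (u y, v y) = extend (A.coeffs hA).uxx (u y, v y) := k h4
  have a4u : pdu A.uxx (u y, v y) = extend (algU V (A.coeffs hA).uxx) (u y, v y) := ku h4
  have a4v : pdv A.uxx (u y, v y) = extend (algV V (A.coeffs hA).uxx) (u y, v y) := kv h4
  have a5 : A.vxx (u y, v y) = extend (A.coeffs hA).vxx (u y, v y) := k h5
  have a5u : pdu A.vxx (u y, v y) = extend (algU V (A.coeffs hA).vxx) (u y, v y) := ku h5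
  have a5v : pdv A.vxx (u y, v y) = extend (algV V (A.coeffs hA).vxx) (u y, v y) := kv h5
  have a6 : A.uxux (u y, v y) = extend (A.coeffs hA).uxux (u y, v y) := k h6
  have a6u : pdu A.uxux (u y, v y) = extend (algU V (A.coeffs hA).uxux) (u y, v y) := ku h6
  have a6v : pdv A.uxux (u y, v y) = extend (algV V (A.coeffs hA).uxux) (u y, v y) := kv h6
  have a7 : A.vxvx (u y, v y) = extend (A.coeffs hA).vxvx (u y, v y) := k h7
  have a7u : pdu A.vxvx (u y, v y) = extend (algU V (A.coeffs hA).vxvx) (u y, v y) := ku h7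
  have a7v : pdv A.vxvx (u y, v y) = extend (algV V (A.coeffs hA).vxvx) (u y, v y) := kv h7
  have a8 : A.uxvx (u y, v y) = extend (A.coeffs hA).uxvx (u y, v y) := k h8
  have a8u : pdu A.uxvx (u y, v y) = extend (algU V (A.coeffs hA).uxvx) (u y, v y) := ku h8
  have a8v : pdv A.uxvx (u y, v y) = extend (algV V (A.coeffs hA).uxvx) (u y, v y) := kv h8
  simp only [Pi.add_apply, Current.lin0, Current.lin2]
  rw [f1' hy, g1' hy, f2 hy, g2 hy, f3 hy, g3 hy, T.fst.deriv_ev2 hO hT.1 hu hv hc hy,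
    T.snd.deriv_ev2 hO hT.2 hu hv hc hy, a1u, a1v, a4, a4u, a4v, a5, a5u, a5v, a6, a6u, a6v,
    a7, a7u, a7v, a8, a8u, a8v]
  clear * - hz
  generalize A.coeffs hA = a
  generalize T.fst.coeffs hT.1 = p
  generalize T.snd.coeffs hT.2 = q
  simp only [Cubic.eval, AlgCurrent.flow, extend_eq_evalAt _ hz, map_add, map_mul, map_ofNat]
  ring

end FlowCubic

/-! ### Differential polynomials with vanishing `x`-derivative -/

/-- A Taylor polynomial of degree 4. Fourth derivatives are needed because the `x`-derivative of a
cubic differential polynomial contains `u_xxxx` and `v_xxxx`. -/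
theorem exists_jet (a₀ a₁ a₂ a₃ a₄ : ℝ) : ∃ f : ℝ → ℝ, ContDiff ℝ ∞ f ∧ f 0 = a₀ ∧ deriv f 0 = a₁ ∧
    deriv (deriv f) 0 = a₂ ∧ deriv (deriv (deriv f)) 0 = a₃ ∧
    deriv (deriv (deriv (deriv f))) 0 = a₄ := by
  have step : ∀ b₀ b₁ b₂ b₃ b₄ : ℝ,
      deriv (fun y : ℝ => b₀ + b₁ * y + b₂ * y ^ 2 + b₃ * y ^ 3 + b₄ * y ^ 4)
        = fun y => b₁ + 2 * b₂ * y + 3 * b₃ * y ^ 2 + 4 * b₄ * y ^ 3 + 0 * y ^ 4 := by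
    intro b₀ b₁ b₂ b₃ b₄
    funext y
    have h := hasDerivAt_id y
    refine (((((hasDerivAt_const y b₀).add (h.const_mul b₁)).add ((h.pow 2).const_mul b₂)).add
      ((h.pow 3).const_mul b₃)).add ((h.pow 4).const_mul b₄)).deriv.trans ?_
    simp only [id]
    push_cast
    ring
  refine ⟨fun y => a₀ + a₁ * y + a₂ / 2 * y ^ 2 + a₃ / 6 * y ^ 3 + a₄ / 24 * y ^ 4,
    by fun_prop, ?_⟩
  simp only [step]
  refine ⟨by ring, by ring, by ring, by ring, by ring⟩

section Extraction

variable {V : Opens (ℝ × ℝ)} {O : Set ℝ} {u v : ℝ → ℝ}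

/-- The `x`-derivative of a cubic differential polynomial at given jets of `u` and `v`. -/
noncomputable def Cubic.jetDeriv (K : Cubic (smoothAlg V)) (z : V) (u₁ u₂ u₃ u₄ v₁ v₂ v₃ v₄ : ℝ) : ℝ :=
      (evalAt z (algU V K.u3) * u₁ + evalAt z (algV V K.u3) * v₁) * u₃ + evalAt z K.u3 * u₄
      + ((evalAt z (algU V K.v3) * u₁ + evalAt z (algV V K.v3) * v₁) * v₃ + evalAt z K.v3 * v₄)
      + ((evalAt z (algU V K.u1u2) * u₁ + evalAt z (algV V K.u1u2) * v₁) * (u₁ * u₂)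
        + evalAt z K.u1u2 * (u₂ * u₂ + u₁ * u₃))
      + ((evalAt z (algU V K.v1u2) * u₁ + evalAt z (algV V K.v1u2) * v₁) * (v₁ * u₂)
        + evalAt z K.v1u2 * (v₂ * u₂ + v₁ * u₃))
      + ((evalAt z (algU V K.u1v2) * u₁ + evalAt z (algV V K.u1v2) * v₁) * (u₁ * v₂)
        + evalAt z K.u1v2 * (u₂ * v₂ + u₁ * v₃))
      + ((evalAt z (algU V K.v1v2) * u₁ + evalAt z (algV V K.v1v2) * v₁) * (v₁ * v₂)
        + evalAt z K.v1v2 * (v₂ * v₂ + v₁ * v₃))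
      + ((evalAt z (algU V K.u1u1u1) * u₁ + evalAt z (algV V K.u1u1u1) * v₁) * u₁ ^ 3
        + evalAt z K.u1u1u1 * (3 * u₁ ^ 2 * u₂))
      + ((evalAt z (algU V K.u1u1v1) * u₁ + evalAt z (algV V K.u1u1v1) * v₁) * (u₁ ^ 2 * v₁)
        + evalAt z K.u1u1v1 * (2 * u₁ * u₂ * v₁ + u₁ ^ 2 * v₂))
      + ((evalAt z (algU V K.u1v1v1) * u₁ + evalAt z (algV V K.u1v1v1) * v₁) * (u₁ * v₁ ^ 2)
        + evalAt z K.u1v1v1 * (u₂ * v₁ ^ 2 + u₁ * (2 * v₁ * v₂)))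
      + ((evalAt z (algU V K.v1v1v1) * u₁ + evalAt z (algV V K.v1v1v1) * v₁) * v₁ ^ 3
        + evalAt z K.v1v1v1 * (3 * v₁ ^ 2 * v₂))

theorem Cubic.deriv_eval (hO : IsOpen O) (hu : ContDiffOn ℝ ∞ u O) (hv : ContDiffOn ℝ ∞ v O)
    (hc : ∀ y ∈ O, (u y, v y) ∈ V) (K : Cubic (smoothAlg V)) {x : ℝ} (hx : x ∈ O)
    {z : V} (hz : (u x, v x) = z.1) {u₁ u₂ u₃ u₄ v₁ v₂ v₃ v₄ : ℝ}
    (e1 : deriv u x = u₁) (e2 : deriv (deriv u) x = u₂) (e3 : deriv (deriv (deriv u)) x = u₃)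
    (e4 : deriv (deriv (deriv (deriv u))) x = u₄)
    (e1' : deriv v x = v₁) (e2' : deriv (deriv v) x = v₂) (e3' : deriv (deriv (deriv v)) x = v₃)
    (e4' : deriv (deriv (deriv (deriv v))) x = v₄) :
    HasDerivAt (K.eval u v) (K.jetDeriv z u₁ u₂ u₃ u₄ v₁ v₂ v₃ v₄) x := by
  have d := fun k : smoothAlg V => hasDerivAt_extend k (hc x hx) (hasDerivAt_of_smoothOn hO hu hx)
    (hasDerivAt_of_smoothOn hO hv hx)
  have su1 := smoothOn_deriv hO hu
  have sv1 := smoothOn_deriv hO hv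
  have su2 := smoothOn_deriv hO su1
  have sv2 := smoothOn_deriv hO sv1
  have su3 := smoothOn_deriv hO su2
  have sv3 := smoothOn_deriv hO sv2
  have u1' := hasDerivAt_of_smoothOn hO su1 hx
  have v1' := hasDerivAt_of_smoothOn hO sv1 hx
  have u2' := hasDerivAt_of_smoothOn hO su2 hx
  have v2' := hasDerivAt_of_smoothOn hO sv2 hx
  have u3' := hasDerivAt_of_smoothOn hO su3 hx
  have v3' := hasDerivAt_of_smoothOn hO sv3 hx
  have ee : ∀ k : smoothAlg V, extend k (u x, v x) = evalAt z k := fun k => by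
    rw [hz]; exact extend_apply k z
  refine ((((((((((((d _).mul u3').add ((d _).mul v3')).add ((d _).mul (u1'.mul u2'))).add
    ((d _).mul (v1'.mul u2'))).add ((d _).mul (u1'.mul v2'))).add ((d _).mul (v1'.mul v2'))).add
    ((d _).mul (u1'.pow 3))).add ((d _).mul ((u1'.pow 2).mul v1'))).add
    ((d _).mul (u1'.mul (v1'.pow 2)))).add ((d _).mul (v1'.pow 3)))).congr_deriv ?_
  simp only [Cubic.jetDeriv, Pi.mul_apply, Pi.pow_apply, ee, e1, e2, e3, e4, e1', e2', e3', e4']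
  push_cast
  ring

/-- A cubic differential polynomial is determined by its `x`-derivative. -/
theorem Cubic.eq_of_deriv_eval {K L : Cubic (smoothAlg V)}
    (h : ∀ u v : ℝ → ℝ, ContDiff ℝ ∞ u → ContDiff ℝ ∞ v → ∀ x : ℝ, (u x, v x) ∈ V →
      deriv (K.eval u v) x = deriv (L.eval u v) x) : K = L := by
  have key := fun (z : V) (u₁ u₂ u₃ u₄ v₁ v₂ v₃ v₄ : ℝ) => show
      K.jetDeriv z u₁ u₂ u₃ u₄ v₁ v₂ v₃ v₄ = L.jetDeriv z u₁ u₂ u₃ u₄ v₁ v₂ v₃ v₄ by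
    obtain ⟨u, hu, hu0, hu1, hu2, hu3, hu4⟩ := exists_jet z.1.1 u₁ u₂ u₃ u₄
    obtain ⟨v, hv, hv0, hv1, hv2, hv3, hv4⟩ := exists_jet z.1.2 v₁ v₂ v₃ v₄
    have hz : (u 0, v 0) = z.1 := by rw [hu0, hv0]
    have hO : IsOpen {y : ℝ | (u y, v y) ∈ V} :=
      V.2.preimage (hu.continuous.prodMk hv.continuous)
    have hx : (0 : ℝ) ∈ {y : ℝ | (u y, v y) ∈ V} := by
      simp only [Set.mem_ofPred_eq, hz]; exact z.2
    have hK := Cubic.deriv_eval hO hu.contDiffOn hv.contDiffOn (fun _ hy => hy) K hx hz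
      hu1 hu2 hu3 hu4 hv1 hv2 hv3 hv4
    have hL := Cubic.deriv_eval hO hu.contDiffOn hv.contDiffOn (fun _ hy => hy) L hx hz
      hu1 hu2 hu3 hu4 hv1 hv2 hv3 hv4
    exact hK.deriv.symm.trans ((h u v hu hv 0 hx).trans hL.deriv)
  obtain ⟨k1, k2, k3, k4, k5, k6, k7, k8, k9, k10⟩ := K
  obtain ⟨l1, l2, l3, l4, l5, l6, l7, l8, l9, l10⟩ := L
  simp only [Cubic.jetDeriv] at key
  -- The coefficients are isolated one after another. Jets with a single nonzero entry give those of
  -- `u_xxxx`, `v_xxxx`, `u_xx²` and `v_xx²`. Each further one comes from a jet with one nonzero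
  -- first derivative and one nonzero higher derivative, compared with the jet having that first
  -- derivative alone.
  have q1 : k1 = l1 := eq_of_evalAt fun z => by simpa using key z 0 0 0 1 0 0 0 0
  have q2 : k2 = l2 := eq_of_evalAt fun z => by simpa using key z 0 0 0 0 0 0 0 1
  have q3 : k3 = l3 := eq_of_evalAt fun z => by simpa using key z 0 1 0 0 0 0 0 0
  have q6 : k6 = l6 := eq_of_evalAt fun z => by simpa using key z 0 0 0 0 0 1 0 0
  subst q1 q2 q3 q6
  have q4 : k4 = l4 := eq_of_evalAt fun z => by
    have := key z 0 0 1 0 1 0 0 0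
    simp only [mul_zero, mul_one, zero_mul, zero_add, add_zero] at this
    linarith [key z 0 0 0 0 1 0 0 0]
  have q5 : k5 = l5 := eq_of_evalAt fun z => by
    linarith [key z 1 0 0 0 0 0 1 0, key z 1 0 0 0 0 0 0 0]
  subst q4 q5
  have q7 : k7 = l7 := eq_of_evalAt fun z => by
    linarith [key z 1 1 0 0 0 0 0 0, key z 1 0 0 0 0 0 0 0]
  have q10 : k10 = l10 := eq_of_evalAt fun z => by
    linarith [key z 0 0 0 0 1 1 0 0, key z 0 0 0 0 1 0 0 0]
  have q8 : k8 = l8 := eq_of_evalAt fun z => by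
    linarith [key z 1 0 0 0 0 1 0 0, key z 1 0 0 0 0 0 0 0]
  have q9 : k9 = l9 := eq_of_evalAt fun z => by
    linarith [key z 0 1 0 0 1 0 0 0, key z 0 0 0 0 1 0 0 0]
  subst q7 q8 q9 q10
  rfl

end Extraction

/-! ### Commutation of flows in terms of coefficients -/

/-- The `ε⁰` part of the derivative of `A` along the flow `u_t = ∂ₓ P`, `v_t = ∂ₓ Q`. -/
def AlgCurrent.flowLead {R : Type*} [CommRing R] (du dv : R → R) (A P Q : AlgCurrent R) : R × R :=
  (du A.lead * du P.lead + dv A.lead * du Q.lead, du A.lead * dv P.lead + dv A.lead * dv Q.lead)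

/-- Dividing by `ε^k` away from `0` and letting `ε → 0` kills the lower coefficients successively;
the terms with `ε³` and `ε⁴` are always negligible. -/
theorem polynomial_isBigO_cube {c₀ c₁ c₂ c₃ c₄ : ℝ} :
    ((fun ε : ℝ => c₀ + ε * c₁ + ε ^ 2 * c₂ + ε ^ 3 * c₃ + ε ^ 4 * c₄) =O[𝓝 0]
      fun ε : ℝ => ε ^ 3) ↔ c₀ = 0 ∧ c₁ = 0 ∧ c₂ = 0 := by
  have tail : (fun ε : ℝ => ε ^ 3 * c₃ + ε ^ 4 * c₄) =O[𝓝 0] fun ε : ℝ => ε ^ 3 := by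
    have : (fun ε : ℝ => ε ^ 3 * (c₃ + ε * c₄)) =O[𝓝 0] fun ε : ℝ => ε ^ 3 * 1 := by
      refine (isBigO_refl _ _).mul ((Continuous.tendsto (by fun_prop) 0).isBigO_one ℝ)
    refine this.congr (fun ε => by ring) fun ε => by ring
  constructor
  · intro h
    have h' : (fun ε : ℝ => c₀ + ε * c₁ + ε ^ 2 * c₂) =O[𝓝 0] fun ε : ℝ => ε ^ 3 :=
      (h.sub tail).congr_left fun ε => by ring
    have lim : ∀ {f : ℝ → ℝ} {k : ℕ}, Continuous f →
        (fun ε : ℝ => ε ^ k * f ε) =O[𝓝 0] (fun ε : ℝ => ε ^ (k + 1)) → f 0 = 0 := by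
      intro f k hf hb
      have hb' : (fun ε : ℝ => ε ^ k * f ε) =O[𝓝[≠] 0] fun ε : ℝ => ε ^ (k + 1) :=
        hb.mono nhdsWithin_le_nhds
      have h1 : (fun ε : ℝ => (ε ^ k)⁻¹ * (ε ^ k * f ε)) =O[𝓝[≠] 0]
          fun ε : ℝ => (ε ^ k)⁻¹ * ε ^ (k + 1) := (isBigO_refl _ _).mul hb'
      have h2 : f =O[𝓝[≠] 0] fun ε : ℝ => ε := by
        refine h1.congr' ?_ ?_
        · filter_upwards [self_mem_nhdsWithin] with ε hε
          rw [← mul_assoc, inv_mul_cancel₀ (pow_ne_zero k hε), one_mul]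
        · filter_upwards [self_mem_nhdsWithin] with ε hε
          rw [pow_succ, ← mul_assoc, inv_mul_cancel₀ (pow_ne_zero k hε), one_mul]
      have h3 : Tendsto f (𝓝[≠] 0) (𝓝 0) :=
        h2.trans_tendsto (tendsto_id.mono_left nhdsWithin_le_nhds)
      exact tendsto_nhds_unique (hf.continuousAt.tendsto.mono_left nhdsWithin_le_nhds) h3
    have hle : ∀ {j k : ℕ}, j ≤ k → (fun ε : ℝ => ε ^ k) =O[𝓝 0] fun ε : ℝ => ε ^ j := by
      intro j k hjk
      have : (fun ε : ℝ => ε ^ j * ε ^ (k - j)) =O[𝓝 0] fun ε : ℝ => ε ^ j * 1 := by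
        refine (isBigO_refl _ _).mul ((Continuous.tendsto (by fun_prop) 0).isBigO_one ℝ)
      refine this.congr (fun ε => by rw [← pow_add, Nat.add_sub_cancel' hjk]) fun ε => by ring
    have e0 : c₀ = 0 := by
      have := lim (f := fun ε => c₀ + ε * c₁ + ε ^ 2 * c₂) (k := 0) (by fun_prop)
        ((h'.trans (hle (by norm_num))).congr_left fun ε => by ring)
      linarith
    subst e0
    have e1 : c₁ = 0 := by
      simpa using lim (f := fun ε => c₁ + ε * c₂) (k := 1) (by fun_prop)
        ((h'.trans (hle (by norm_num))).congr_left fun ε => by ring)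
    subst e1
    have e2 : c₂ = 0 := by
      simpa using lim (f := fun _ => c₂) (k := 2) (by fun_prop)
        (h'.congr_left fun ε => by ring)
    exact ⟨rfl, rfl, e2⟩
  · rintro ⟨rfl, rfl, rfl⟩
    exact tail.congr_left fun ε => by ring

section Commutator

variable {V : Opens (ℝ × ℝ)} {O : Set ℝ} {u v : ℝ → ℝ} {A : Current} {S T : System}

/-- The `ε¹` part of a current vanishes on `V`. -/
def Current.NoFirstOrder (A : Current) (V : Set (ℝ × ℝ)) : Prop :=
  ∀ z ∈ V, A.ux z = 0 ∧ A.vx z = 0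

theorem Current.ev1_eqOn_zero (hA : A.NoFirstOrder V) (hc : ∀ y ∈ O, (u y, v y) ∈ V) :
    Set.EqOn (A.ev1 u v) 0 O := fun y hy => by
  simp [Current.ev1, hA _ (hc y hy)]

theorem Current.lin1_eqOn_zero (hA : A.NoFirstOrder V) (hc : ∀ y ∈ O, (u y, v y) ∈ V)
    (f g : ℝ → ℝ) : Set.EqOn (A.lin1 u v f g) 0 O := fun y hy => by
  have z1 : ∀ a b : ℝ, pdu (0 : ℝ × ℝ → ℝ) (a, b) = 0 := fun a b => by simp [pdu]
  have z2 : ∀ a b : ℝ, pdv (0 : ℝ × ℝ → ℝ) (a, b) = 0 := fun a b => by simp [pdv]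
  have e1 : Set.EqOn A.ux 0 V := fun z hz => (hA z hz).1
  have e2 : Set.EqOn A.vx 0 V := fun z hz => (hA z hz).2
  simp only [Current.lin1]
  rw [pdu_congr V.2 e1 (hc y hy), pdu_congr V.2 e2 (hc y hy), pdv_congr V.2 e1 (hc y hy),
    pdv_congr V.2 e2 (hc y hy), e1 (hc y hy), e2 (hc y hy)]
  simp [z1, z2]

theorem Current.lin_zero_of_eqOn {f g : ℝ → ℝ} (hO : IsOpen O) (hf : Set.EqOn f 0 O)
    (hg : Set.EqOn g 0 O) :
    Set.EqOn (A.lin0 u v f g) 0 O ∧ Set.EqOn (A.lin1 u v f g) 0 O := by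
  constructor <;> intro y hy <;>
    simp [Current.lin0, Current.lin1, hf hy, hg hy, deriv_eqOn hO hf hy, deriv_eqOn hO hg hy]

theorem deriv_eqOn_zero {h : ℝ → ℝ} (hO : IsOpen O) (e : Set.EqOn h 0 O) :
    Set.EqOn (deriv h) 0 O := fun y hy => by
  rw [deriv_eqOn hO e hy]; simp

theorem Current.flow1_eqOn_zero (hO : IsOpen O) (hA : A.NoFirstOrder V)
    (h1 : T.fst.NoFirstOrder V) (h2 : T.snd.NoFirstOrder V) (hc : ∀ y ∈ O, (u y, v y) ∈ V) :
    Set.EqOn (A.flow1 T u v) 0 O := fun y hy => by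
  simp only [Current.flow1, Pi.add_apply]
  rw [(Current.lin_zero_of_eqOn hO (deriv_eqOn_zero hO (Current.ev1_eqOn_zero h1 hc))
    (deriv_eqOn_zero hO (Current.ev1_eqOn_zero h2 hc))).1 hy, Current.lin1_eqOn_zero hA hc _ _ hy]
  simp

/-- The cross term pairs the first order part of `A` with that of `T`, so it vanishes as soon as one
of them is absent. The alternative matters because the symmetry provided by integrability may have
terms of order `ε`, while the deformed system has none. -/
theorem Current.flow2_eqOn (hO : IsOpen O) (hA : A.SmoothOn V) (hT : T.SmoothOn V)
    (h : A.NoFirstOrder V ∨ T.fst.NoFirstOrder V ∧ T.snd.NoFirstOrder V)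
    (hu : ContDiffOn ℝ ∞ u O) (hv : ContDiffOn ℝ ∞ v O) (hc : ∀ y ∈ O, (u y, v y) ∈ V) :
    Set.EqOn (A.flow2 T u v)
      (((A.coeffs hA).flow (algU V) (algV V) (T.fst.coeffs hT.1) (T.snd.coeffs hT.2)).eval u v)
      O := fun y hy => by
  rw [← Current.flow_cubic hO hA hT hu hv hc hy]
  have : A.lin1 u v (deriv (T.fst.ev1 u v)) (deriv (T.snd.ev1 u v)) y = 0 := by
    rcases h with h | ⟨h1, h2⟩
    · exact Current.lin1_eqOn_zero h hc _ _ hy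
    · exact (Current.lin_zero_of_eqOn hO (deriv_eqOn_zero hO (Current.ev1_eqOn_zero h1 hc))
        (deriv_eqOn_zero hO (Current.ev1_eqOn_zero h2 hc))).2 hy
  simp only [Current.flow2, Pi.add_apply, this, add_zero]

theorem Current.flow0_eqOn (hO : IsOpen O) (hA : A.SmoothOn V) (hT : T.SmoothOn V)
    (hu : ContDiffOn ℝ ∞ u O) (hv : ContDiffOn ℝ ∞ v O) (hc : ∀ y ∈ O, (u y, v y) ∈ V) :
    Set.EqOn (A.flow0 T u v) (fun y =>
      extend ((A.coeffs hA).flowLead (algU V) (algV V) (T.fst.coeffs hT.1)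
        (T.snd.coeffs hT.2)).1 (u y, v y) * deriv u y
      + extend ((A.coeffs hA).flowLead (algU V) (algV V) (T.fst.coeffs hT.1)
        (T.snd.coeffs hT.2)).2 (u y, v y) * deriv v y) O := fun y hy => by
  have hz := hc y hy
  have a1u : pdu A.lead (u y, v y) = extend (algU V (A.coeffs hA).lead) (u y, v y) :=
    pdu_eq_extend hA.1 hz
  have a1v : pdv A.lead (u y, v y) = extend (algV V (A.coeffs hA).lead) (u y, v y) :=
    pdv_eq_extend hA.1 hz
  simp only [Current.flow0, Current.lin0]
  rw [a1u, a1v, (T.fst.deriv_ev0 hO hT.1 hc).trans (deriv_extend hO hu hv hc _) hy,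
    (T.snd.deriv_ev0 hO hT.2 hc).trans (deriv_extend hO hu hv hc _) hy]
  simp only [AlgCurrent.flowLead, extend_eq_evalAt _ hz, map_add, map_mul]
  ring

theorem System.commutator_expansion (hS : S.SmoothOn V) (hT : T.SmoothOn V)
    (hO : IsOpen O) (hu : ContDiffOn ℝ ∞ u O) (hv : ContDiffOn ℝ ∞ v O)
    (hc : ∀ y ∈ O, (u y, v y) ∈ V) {x : ℝ} (hx : x ∈ O) :
    (∃ d₃ d₄ : ℝ, ∀ ε, (S.commutator T ε u v x).1 =
      (deriv (S.fst.flow0 T u v) x - deriv (T.fst.flow0 S u v) x)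
      + ε * (deriv (S.fst.flow1 T u v) x - deriv (T.fst.flow1 S u v) x)
      + ε ^ 2 * (deriv (S.fst.flow2 T u v) x - deriv (T.fst.flow2 S u v) x)
      + ε ^ 3 * d₃ + ε ^ 4 * d₄) ∧
    (∃ d₃ d₄ : ℝ, ∀ ε, (S.commutator T ε u v x).2 =
      (deriv (S.snd.flow0 T u v) x - deriv (T.snd.flow0 S u v) x)
      + ε * (deriv (S.snd.flow1 T u v) x - deriv (T.snd.flow1 S u v) x)
      + ε ^ 2 * (deriv (S.snd.flow2 T u v) x - deriv (T.snd.flow2 S u v) x)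
      + ε ^ 3 * d₃ + ε ^ 4 * d₄) := by
  have key : ∀ {A B : Current}, A.SmoothOn V → B.SmoothOn V → ∃ d₃ d₄ : ℝ, ∀ ε,
      T.derivAlong ε (A.rate ε) u v x - S.derivAlong ε (B.rate ε) u v x =
      (deriv (A.flow0 T u v) x - deriv (B.flow0 S u v) x)
      + ε * (deriv (A.flow1 T u v) x - deriv (B.flow1 S u v) x)
      + ε ^ 2 * (deriv (A.flow2 T u v) x - deriv (B.flow2 S u v) x)
      + ε ^ 3 * d₃ + ε ^ 4 * d₄ := by
    intro A B hA hB
    obtain ⟨a₃, a₄, ha⟩ := Current.deriv_lin_rate V.2 hO hA hT hu hv hc hx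
    obtain ⟨b₃, b₄, hb⟩ := Current.deriv_lin_rate V.2 hO hB hS hu hv hc hx
    refine ⟨a₃ - b₃, a₄ - b₄, fun ε => ?_⟩
    rw [System.derivAlong_rate V.2 hO hA hT hu hv hc ε ε hx,
      System.derivAlong_rate V.2 hO hB hS hu hv hc ε ε hx, ha, hb]
    ring
  exact ⟨key hS.1 hT.1, key hS.2 hT.2⟩

theorem isOpen_curve_preimage (V : Opens (ℝ × ℝ)) (hu : ContDiff ℝ ∞ u) (hv : ContDiff ℝ ∞ v) :
    IsOpen {y : ℝ | (u y, v y) ∈ V} :=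
  V.2.preimage (hu.continuous.prodMk hv.continuous)

/-- Commutation up to order `ε²` forces the coefficients of the commutator to vanish. -/
theorem System.CommutesToSecondOrder.flow_eq (hS : S.SmoothOn V) (hT : T.SmoothOn V)
    (h1 : S.fst.NoFirstOrder V) (h2 : S.snd.NoFirstOrder V)
    (h : S.CommutesToSecondOrder T V) :
    (S.fst.coeffs hS.1).flow (algU V) (algV V) (T.fst.coeffs hT.1) (T.snd.coeffs hT.2) =
      (T.fst.coeffs hT.1).flow (algU V) (algV V) (S.fst.coeffs hS.1) (S.snd.coeffs hS.2) ∧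
    (S.snd.coeffs hS.2).flow (algU V) (algV V) (T.fst.coeffs hT.1) (T.snd.coeffs hT.2) =
      (T.snd.coeffs hT.2).flow (algU V) (algV V) (S.fst.coeffs hS.1) (S.snd.coeffs hS.2) := by
  have key : ∀ (u v : ℝ → ℝ), ContDiff ℝ ∞ u → ContDiff ℝ ∞ v → ∀ x : ℝ, (u x, v x) ∈ V →
      deriv (S.fst.flow2 T u v) x = deriv (T.fst.flow2 S u v) x ∧
      deriv (S.snd.flow2 T u v) x = deriv (T.snd.flow2 S u v) x := by
    intro u v hu hv x hx
    obtain ⟨⟨a₃, a₄, ha⟩, b₃, b₄, hb⟩ := System.commutator_expansion hS hT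
      (isOpen_curve_preimage V hu hv) hu.contDiffOn hv.contDiffOn (fun _ hy => hy) (x := x) hx
    have hh := h u v hu hv x hx
    have ha' := polynomial_isBigO_cube.1 ((isBigO_prod_left.1 hh).1.congr_left fun ε => ha ε)
    have hb' := polynomial_isBigO_cube.1 ((isBigO_prod_left.1 hh).2.congr_left fun ε => hb ε)
    exact ⟨sub_eq_zero.1 ha'.2.2, sub_eq_zero.1 hb'.2.2⟩
  constructor
  · refine Cubic.eq_of_deriv_eval fun u v hu hv x hx => ?_
    have hO := isOpen_curve_preimage V hu hv
    rw [← deriv_eqOn hO (Current.flow2_eqOn hO hS.1 hT (.inl h1) hu.contDiffOn hv.contDiffOn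
      (fun _ hy => hy)) hx, ← deriv_eqOn hO (Current.flow2_eqOn hO hT.1 hS (.inr ⟨h1, h2⟩)
      hu.contDiffOn hv.contDiffOn (fun _ hy => hy)) hx]
    exact (key u v hu hv x hx).1
  · refine Cubic.eq_of_deriv_eval fun u v hu hv x hx => ?_
    have hO := isOpen_curve_preimage V hu hv
    rw [← deriv_eqOn hO (Current.flow2_eqOn hO hS.2 hT (.inl h2) hu.contDiffOn hv.contDiffOn
      (fun _ hy => hy)) hx, ← deriv_eqOn hO (Current.flow2_eqOn hO hT.2 hS (.inr ⟨h1, h2⟩)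
      hu.contDiffOn hv.contDiffOn (fun _ hy => hy)) hx]
    exact (key u v hu hv x hx).2

theorem Current.deriv_flow0_eq {B : Current} (hA : A.SmoothOn V) (hB : B.SmoothOn V)
    (hS : S.SmoothOn V) (hT : T.SmoothOn V)
    (h : (A.coeffs hA).flowLead (algU V) (algV V) (T.fst.coeffs hT.1) (T.snd.coeffs hT.2) =
      (B.coeffs hB).flowLead (algU V) (algV V) (S.fst.coeffs hS.1) (S.snd.coeffs hS.2))
    (hO : IsOpen O) (hu : ContDiffOn ℝ ∞ u O) (hv : ContDiffOn ℝ ∞ v O)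
    (hc : ∀ y ∈ O, (u y, v y) ∈ V) {x : ℝ} (hx : x ∈ O) :
    deriv (A.flow0 T u v) x = deriv (B.flow0 S u v) x := by
  rw [deriv_eqOn hO (Current.flow0_eqOn hO hA hT hu hv hc) hx,
    deriv_eqOn hO (Current.flow0_eqOn hO hB hS hu hv hc) hx, h]

/-- Flows whose commutator has vanishing coefficients commute up to order `ε²`. -/
theorem System.commutesToSecondOrder_of_flow_eq (hS : S.SmoothOn V) (hT : T.SmoothOn V)
    (h1 : S.fst.NoFirstOrder V) (h2 : S.snd.NoFirstOrder V)
    (k1 : T.fst.NoFirstOrder V) (k2 : T.snd.NoFirstOrder V)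
    (l1 : (S.fst.coeffs hS.1).flowLead (algU V) (algV V) (T.fst.coeffs hT.1) (T.snd.coeffs hT.2) =
      (T.fst.coeffs hT.1).flowLead (algU V) (algV V) (S.fst.coeffs hS.1) (S.snd.coeffs hS.2))
    (l2 : (S.snd.coeffs hS.2).flowLead (algU V) (algV V) (T.fst.coeffs hT.1) (T.snd.coeffs hT.2) =
      (T.snd.coeffs hT.2).flowLead (algU V) (algV V) (S.fst.coeffs hS.1) (S.snd.coeffs hS.2))
    (c1 : (S.fst.coeffs hS.1).flow (algU V) (algV V) (T.fst.coeffs hT.1) (T.snd.coeffs hT.2) =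
      (T.fst.coeffs hT.1).flow (algU V) (algV V) (S.fst.coeffs hS.1) (S.snd.coeffs hS.2))
    (c2 : (S.snd.coeffs hS.2).flow (algU V) (algV V) (T.fst.coeffs hT.1) (T.snd.coeffs hT.2) =
      (T.snd.coeffs hT.2).flow (algU V) (algV V) (S.fst.coeffs hS.1) (S.snd.coeffs hS.2)) :
    S.CommutesToSecondOrder T V := by
  intro u v hu hv x hx
  have hO := isOpen_curve_preimage V hu hv
  have hu' := hu.contDiffOn (s := {y : ℝ | (u y, v y) ∈ V})
  have hv' := hv.contDiffOn (s := {y : ℝ | (u y, v y) ∈ V})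
  have hc : ∀ y ∈ {y : ℝ | (u y, v y) ∈ V}, (u y, v y) ∈ V := fun _ hy => hy
  obtain ⟨⟨a₃, a₄, ha⟩, b₃, b₄, hb⟩ := System.commutator_expansion hS hT hO hu' hv' hc (x := x) hx
  have z1 := fun {A B : Current} (hA : A.NoFirstOrder V) (hB : B.NoFirstOrder V) =>
    show deriv (A.flow1 T u v) x - deriv (B.flow1 S u v) x = 0 by
      rw [deriv_eqOn_zero hO (Current.flow1_eqOn_zero hO hA k1 k2 hc) hx,
        deriv_eqOn_zero hO (Current.flow1_eqOn_zero hO hB h1 h2 hc) hx]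
      simp
  refine IsBigO.prod_left ?_ ?_
  · refine (polynomial_isBigO_cube.2 ⟨?_, ?_, ?_⟩).congr_left fun ε => (ha ε).symm
    · exact sub_eq_zero.2 (Current.deriv_flow0_eq hS.1 hT.1 hS hT l1 hO hu' hv' hc hx)
    · exact z1 h1 k1
    · rw [sub_eq_zero, deriv_eqOn hO (Current.flow2_eqOn hO hS.1 hT (.inl h1) hu' hv' hc) hx,
        deriv_eqOn hO (Current.flow2_eqOn hO hT.1 hS (.inr ⟨h1, h2⟩) hu' hv' hc) hx, c1]
  · refine (polynomial_isBigO_cube.2 ⟨?_, ?_, ?_⟩).congr_left fun ε => (hb ε).symm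
    · exact sub_eq_zero.2 (Current.deriv_flow0_eq hS.2 hT.2 hS hT l2 hO hu' hv' hc hx)
    · exact z1 h2 k2
    · rw [sub_eq_zero, deriv_eqOn hO (Current.flow2_eqOn hO hS.2 hT (.inl h2) hu' hv' hc) hx,
        deriv_eqOn hO (Current.flow2_eqOn hO hT.2 hS (.inr ⟨h1, h2⟩) hu' hv' hc) hx, c2]

theorem hydro_smoothOn {p q : ℝ × ℝ → ℝ} {V : Set (ℝ × ℝ)} (hp : ContDiffOn ℝ ∞ p V)
    (hq : ContDiffOn ℝ ∞ q V) : (hydro p q).SmoothOn V := by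
  have z : ContDiffOn ℝ ∞ (0 : ℝ × ℝ → ℝ) V := contDiffOn_const
  exact ⟨⟨hp, z, z, z, z, z, z, z⟩, ⟨hq, z, z, z, z, z, z, z⟩⟩

/-- At `ε = 0` the commutator is the `x`-derivative of a linear expression in `u_x` and `v_x`, and
such an expression is again determined by its `x`-derivative. -/
theorem System.dispersionlessSymmetry_iff {p q : ℝ × ℝ → ℝ} (hS : S.SmoothOn V)
    (hT : (hydro p q).SmoothOn V) :
    S.DispersionlessSymmetry p q V ↔
      (S.fst.coeffs hS.1).flowLead (algU V) (algV V) ((hydro p q).fst.coeffs hT.1)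
          ((hydro p q).snd.coeffs hT.2) =
        ((hydro p q).fst.coeffs hT.1).flowLead (algU V) (algV V) (S.fst.coeffs hS.1)
          (S.snd.coeffs hS.2) ∧
      (S.snd.coeffs hS.2).flowLead (algU V) (algV V) ((hydro p q).fst.coeffs hT.1)
          ((hydro p q).snd.coeffs hT.2) =
        ((hydro p q).snd.coeffs hT.2).flowLead (algU V) (algV V) (S.fst.coeffs hS.1)
          (S.snd.coeffs hS.2) := by
  have ext : ∀ {k l : smoothAlg V × smoothAlg V},
      (∀ u v : ℝ → ℝ, ContDiff ℝ ∞ u → ContDiff ℝ ∞ v → ∀ x : ℝ, (u x, v x) ∈ V →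
        deriv (fun y => extend k.1 (u y, v y) * deriv u y + extend k.2 (u y, v y) * deriv v y) x =
        deriv (fun y => extend l.1 (u y, v y) * deriv u y + extend l.2 (u y, v y) * deriv v y) x) →
      k = l := by
    intro k l h
    have key : ∀ (z : V) (u₂ v₂ : ℝ),
        evalAt z k.1 * u₂ + evalAt z k.2 * v₂ = evalAt z l.1 * u₂ + evalAt z l.2 * v₂ := by
      intro z u₂ v₂
      -- With vanishing first derivatives only the terms linear in `u_xx` and `v_xx` survive, and
      -- these display the coefficients.
      obtain ⟨u, hu, hu0, hu1, hu2, -⟩ := exists_jet z.1.1 0 u₂ 0 0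
      obtain ⟨v, hv, hv0, hv1, hv2, -⟩ := exists_jet z.1.2 0 v₂ 0 0
      have hz : (u 0, v 0) = z.1 := by rw [hu0, hv0]
      have hO := isOpen_curve_preimage V hu hv
      have hx : (0 : ℝ) ∈ {y : ℝ | (u y, v y) ∈ V} := by
        simp only [Set.mem_ofPred_eq, hz]; exact z.2
      have d := fun k : smoothAlg V × smoothAlg V =>
        (((hasDerivAt_extend k.1 hx (hasDerivAt_of_smoothOn hO hu.contDiffOn hx)
        (hasDerivAt_of_smoothOn hO hv.contDiffOn hx)).mul
        (hasDerivAt_of_smoothOn hO (smoothOn_deriv hO hu.contDiffOn) hx)).add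
        ((hasDerivAt_extend k.2 hx (hasDerivAt_of_smoothOn hO hu.contDiffOn hx)
        (hasDerivAt_of_smoothOn hO hv.contDiffOn hx)).mul
        (hasDerivAt_of_smoothOn hO (smoothOn_deriv hO hv.contDiffOn) hx))).deriv
      have := (d k).symm.trans ((h u v hu hv 0 hx).trans (d l))
      have ee : ∀ k : smoothAlg V, extend k (u 0, v 0) = evalAt z k := fun k => by
        rw [hz]; exact extend_apply k z
      simpa [hu1, hv1, hu2, hv2, ee] using this
    exact Prod.ext (eq_of_evalAt fun z => by simpa using key z 1 0)
      (eq_of_evalAt fun z => by simpa using key z 0 1)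
  have comm : ∀ u v : ℝ → ℝ, ContDiff ℝ ∞ u → ContDiff ℝ ∞ v → ∀ x : ℝ, (u x, v x) ∈ V →
      (S.commutator (hydro p q) 0 u v x).1 =
        deriv (S.fst.flow0 (hydro p q) u v) x - deriv ((hydro p q).fst.flow0 S u v) x ∧
      (S.commutator (hydro p q) 0 u v x).2 =
        deriv (S.snd.flow0 (hydro p q) u v) x - deriv ((hydro p q).snd.flow0 S u v) x := by
    intro u v hu hv x hx
    obtain ⟨⟨a₃, a₄, ha⟩, b₃, b₄, hb⟩ := System.commutator_expansion hS hT
      (isOpen_curve_preimage V hu hv) hu.contDiffOn hv.contDiffOn (fun _ hy => hy) (x := x) hx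
    exact ⟨by rw [ha]; ring, by rw [hb]; ring⟩
  constructor
  · intro h
    have key := fun (u v : ℝ → ℝ) hu hv (x : ℝ) hx => by
      have := comm u v hu hv x hx
      rw [h u v hu hv x hx] at this
      exact And.intro (sub_eq_zero.1 this.1.symm) (sub_eq_zero.1 this.2.symm)
    constructor
    · refine ext fun u v hu hv x hx => ?_
      have hO := isOpen_curve_preimage V hu hv
      rw [← deriv_eqOn hO (Current.flow0_eqOn hO hS.1 hT hu.contDiffOn hv.contDiffOn
        (fun _ hy => hy)) hx, ← deriv_eqOn hO (Current.flow0_eqOn hO hT.1 hS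
        hu.contDiffOn hv.contDiffOn (fun _ hy => hy)) hx]
      exact (key u v hu hv x hx).1
    · refine ext fun u v hu hv x hx => ?_
      have hO := isOpen_curve_preimage V hu hv
      rw [← deriv_eqOn hO (Current.flow0_eqOn hO hS.2 hT hu.contDiffOn hv.contDiffOn
        (fun _ hy => hy)) hx, ← deriv_eqOn hO (Current.flow0_eqOn hO hT.2 hS
        hu.contDiffOn hv.contDiffOn (fun _ hy => hy)) hx]
      exact (key u v hu hv x hx).2
  · rintro ⟨l1, l2⟩ u v hu hv x hx
    have hO := isOpen_curve_preimage V hu hv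
    obtain ⟨c1, c2⟩ := comm u v hu hv x hx
    refine Prod.ext (c1.trans (sub_eq_zero.2 ?_)) (c2.trans (sub_eq_zero.2 ?_))
    · exact Current.deriv_flow0_eq hS.1 hT.1 hS hT l1 hO hu.contDiffOn hv.contDiffOn
        (fun _ hy => hy) hx
    · exact Current.deriv_flow0_eq hS.2 hT.2 hS hT l2 hO hu.contDiffOn hv.contDiffOn
        (fun _ hy => hy) hx

end Commutator

/-! ### The deformation equations in a differential ring -/

section Algebra

variable {R : Type*} [CommRing R] [Algebra ℝ R]

/-- A real constant as an element of a real algebra. -/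
def cst (R : Type*) [CommRing R] [Algebra ℝ R] (r : ℝ) : R := algebraMap ℝ R r

theorem derivation_cst (d : Derivation ℝ R R) (r : ℝ) : d (cst R r) = 0 := d.map_algebraMap r

theorem algHom_cst (φ : R →ₐ[ℝ] ℝ) (r : ℝ) : φ (cst R r) = r := φ.commutes r

/-- A ring with commuting derivations `∂/∂u`, `∂/∂v`, an invertible coordinate `u` and an
invertible `w` proportional to `u ^ (2m - 2)`; identities can be checked at real points. -/
structure IsDihedralRing (du dv : Derivation ℝ R R) (m : ℝ) (u ui w wi : R) : Prop where
  comm : ∀ f, du (dv f) = dv (du f)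
  u_inv : u * ui = 1
  w_inv : w * wi = 1
  du_u : du u = 1
  dv_u : dv u = 0
  du_w : du w = cst R (2 * m - 2) * (w * ui)
  dv_w : dv w = 0
  ext : ∀ x y : R, (∀ φ : R →ₐ[ℝ] ℝ, φ x = φ y) → x = y

variable {du dv : Derivation ℝ R R} {m : ℝ} {u ui w wi : R}

namespace IsDihedralRing

theorem du_ui (h : IsDihedralRing du dv m u ui w wi) : du ui = -(ui * ui) := by
  have := congrArg du h.u_inv
  simp only [Derivation.leibniz, smul_eq_mul, h.du_u, Derivation.map_one_eq_zero] at this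
  linear_combination ui * this - du ui * h.u_inv

theorem dv_ui (h : IsDihedralRing du dv m u ui w wi) : dv ui = 0 := by
  have := congrArg dv h.u_inv
  simp only [Derivation.leibniz, smul_eq_mul, h.dv_u, Derivation.map_one_eq_zero] at this
  linear_combination ui * this - dv ui * h.u_inv

theorem du_wi (h : IsDihedralRing du dv m u ui w wi) :
    du wi = -(cst R (2 * m - 2) * (wi * ui)) := by
  have := congrArg du h.w_inv
  simp only [Derivation.leibniz, smul_eq_mul, h.du_w, Derivation.map_one_eq_zero] at this
  linear_combination wi * this - (du wi + cst R (2 * m - 2) * (wi * ui)) * h.w_inv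

theorem dv_wi (h : IsDihedralRing du dv m u ui w wi) : dv wi = 0 := by
  have := congrArg dv h.w_inv
  simp only [Derivation.leibniz, smul_eq_mul, h.dv_w, Derivation.map_one_eq_zero] at this
  linear_combination wi * this - dv wi * h.w_inv

theorem map_u_ne_zero (h : IsDihedralRing du dv m u ui w wi) (φ : R →ₐ[ℝ] ℝ) : φ u ≠ 0 := by
  intro h0
  have := congrArg φ h.u_inv
  simp [h0] at this

theorem map_w_ne_zero (h : IsDihedralRing du dv m u ui w wi) (φ : R →ₐ[ℝ] ℝ) : φ w ≠ 0 := by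
  intro h0
  have := congrArg φ h.w_inv
  simp [h0] at this

theorem map_ui (h : IsDihedralRing du dv m u ui w wi) (φ : R →ₐ[ℝ] ℝ) : φ ui = (φ u)⁻¹ := by
  have := congrArg φ h.u_inv
  rw [map_mul, map_one] at this
  exact (inv_eq_of_mul_eq_one_right this).symm

theorem map_wi (h : IsDihedralRing du dv m u ui w wi) (φ : R →ₐ[ℝ] ℝ) : φ wi = (φ w)⁻¹ := by
  have := congrArg φ h.w_inv
  rw [map_mul, map_one] at this
  exact (inv_eq_of_mul_eq_one_right this).symm

end IsDihedralRing

/-- The first component of the normal form with `a23 = a`, `a24 = b`. -/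
noncomputable def normalFst (du dv : R → R) (m : ℝ) (ui wi l a b : R) : AlgCurrent R where
  lead := l
  uxx := 0
  vxx := 0
  uxux := -(cst R (1 / 2) * dv a)
    - cst R (1 / 4) * (du b + cst R ((m - 2) / (m - 1)) * (b * ui))
  vxvx := cst R (1 / 4) * wi * (du b + cst R ((m - 2) / (m - 1)) * (b * ui))
  uxvx := -(cst R (1 / 2) * dv b)

/-- The coefficient `a25` of the normal form with `a23 = a`, `a24 = b`. -/
noncomputable def normalCoeff (dv : R → R) (m : ℝ) (ui w a b : R) : R :=
  cst R (1 / 2) * (w * dv b) - cst R ((2 * m - 3) / (4 * (m - 1))) * (a * ui)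

/-- The second component of the normal form with `a23 = a`, `a24 = b`. -/
noncomputable def normalSnd (dv : R → R) (m : ℝ) (ui w wi l a b : R) : AlgCurrent R where
  lead := l
  uxx := a
  vxx := b
  uxux := normalCoeff dv m ui w a b
  vxvx := -(wi * normalCoeff dv m ui w a b)
  uxvx := 0

/-- The coefficient of `v_x²` in the correction of a symmetry with `∂p/∂v = α`. -/
noncomputable def symmetryCoeffV (du dv : R → R) (m : ℝ) (u w wi a b α : R) : R :=
  cst R (1 / (2 * (m - 1))) * (u * wi) *
    (a * dv (du α) + w * b * dv (dv α) - cst R (1 / 2) * (du a * dv α + du b * du α))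

/-- The coefficient of `u_x v_x` in the correction of a symmetry with `∂p/∂v = α`. -/
noncomputable def symmetryCoeffUV (du dv : R → R) (m : ℝ) (u ui w wi a b α : R) : R :=
  cst R (1 / (2 * (m - 1))) * (u * wi) *
    (w * (a * dv (dv α) + b * dv (du α)) + w * (a * dv (dv α) + b * dv (du α)) - du a * du α
      - (w * du b - cst R (2 * m - 2) * (w * ui) * b) * dv α)

/-- The first component of the extension of a dispersionless symmetry to the normal form. -/
noncomputable def symmetryFst (du dv : R → R) (m : ℝ) (u ui w wi a b p α : R) : AlgCurrent R where
  lead := p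
  uxx := cst R (1 / (m - 1)) * u * (a * dv α + b * du α)
  vxx := cst R (1 / (m - 1)) * u * (wi * a * du α + b * dv α)
  uxux := α * (normalFst du dv m ui wi 0 a b).uxux + w * symmetryCoeffV du dv m u w wi a b α
    + cst R (3 / 2) * (a * dv α + b * du α)
  vxvx := α * (normalFst du dv m ui wi 0 a b).vxvx + symmetryCoeffV du dv m u w wi a b α
  uxvx := α * (normalFst du dv m ui wi 0 a b).uxvx + symmetryCoeffUV du dv m u ui w wi a b α

/-- The second component of the extension of a dispersionless symmetry to the normal form. -/
noncomputable def symmetrySnd (du dv : R → R) (m : ℝ) (u ui w wi a b q α : R) : AlgCurrent R where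
  lead := q
  uxx := α * a + w * (cst R (1 / (m - 1)) * u * (wi * a * du α + b * dv α))
  vxx := α * b + cst R (1 / (m - 1)) * u * (a * dv α + b * du α)
  uxux := α * normalCoeff dv m ui w a b
    + cst R (1 / 2) * (w * symmetryCoeffUV du dv m u ui w wi a b α)
    + cst R (3 / 2) * (a * du α + w * b * dv α)
  vxvx := α * -(wi * normalCoeff dv m ui w a b)
    + cst R (1 / 2) * symmetryCoeffUV du dv m u ui w wi a b α
  uxvx := w * symmetryCoeffV du dv m u w wi a b α + w * symmetryCoeffV du dv m u w wi a b α
    + (a * dv α + b * du α)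

set_option maxHeartbeats 4000000 in
/-- The extension of a dispersionless symmetry commutes with the normal form. -/
theorem normal_flow_symmetry (h : IsDihedralRing du dv m u ui w wi) (hm : m ≠ 1)
    {l₁ l₂ a b p q α β : R} (hl1u : du l₁ = 0) (hl1v : dv l₁ = 1) (hl2u : du l₂ = w)
    (hl2v : dv l₂ = 0) (ha : du a = w * dv b + cst R (2 * m - 3) * (a * ui))
    (hb : du b = dv a + cst R (m - 2) * (b * ui))
    (hpu : du p = β) (hpv : dv p = α) (hqu : du q = w * α) (hqv : dv q = β)
    (hβu : du β = w * dv α) (hβv : dv β = du α) (hα : du (du α) = w * dv (dv α)) :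
    (normalFst du dv m ui wi l₁ a b).flow du dv (symmetryFst du dv m u ui w wi a b p α)
        (symmetrySnd du dv m u ui w wi a b q α) =
      (symmetryFst du dv m u ui w wi a b p α).flow du dv (normalFst du dv m ui wi l₁ a b)
        (normalSnd dv m ui w wi l₂ a b) ∧
    (normalSnd dv m ui w wi l₂ a b).flow du dv (symmetryFst du dv m u ui w wi a b p α)
        (symmetrySnd du dv m u ui w wi a b q α) =
      (symmetrySnd du dv m u ui w wi a b q α).flow du dv (normalFst du dv m ui wi l₁ a b)
        (normalSnd dv m ui w wi l₂ a b) := by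
  have hm' : m - 1 ≠ 0 := sub_ne_zero.2 hm
  -- All twenty coefficients are compared at real points. The hypotheses rewrite every
  -- `u`-derivative of `a`, `b` and every second `u`-derivative of `α`, so that both sides become
  -- rational expressions in independent quantities.
  constructor <;> ext1 <;> refine h.ext _ _ fun φ => ?_
  all_goals
    have hu := h.map_u_ne_zero φ
    have hw := h.map_w_ne_zero φ
    simp only [AlgCurrent.flow, normalFst, normalSnd, normalCoeff, symmetryFst, symmetrySnd,
      symmetryCoeffV, symmetryCoeffUV, map_add, map_sub, map_neg, map_zero, Derivation.leibniz,
      derivation_cst, Derivation.map_one_eq_zero, smul_eq_mul, h.comm, h.du_u, h.dv_u, h.du_ui, h.dv_ui, h.du_w,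
      h.dv_w, h.du_wi, h.dv_wi, hl1u, hl1v, hl2u, hl2v, ha, hb, hpu, hpv, hqu, hqv, hβu, hβv, hα,
      map_mul, map_one, map_ofNat, algHom_cst, h.map_ui φ, h.map_wi φ, mul_zero, zero_mul, add_zero, zero_add]
    field_simp <;> ring

end Algebra

/-! ### Miura transformations in a differential ring -/

section AlgebraicMiura

variable {R : Type*} [CommRing R]

/-- The effect on the component `A` of a flow `(P, Q)` of the Miura transformation
`ũ = u + ε² ∂ₓ(X₁ u_x + X₂ v_x)`, `ṽ = v + ε² ∂ₓ(Y₁ u_x + Y₂ v_x)`, where `Z₁ u_x + Z₂ v_x` is the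
expression that belongs to `A`. -/
def AlgCurrent.miura (du dv : R → R) (A : AlgCurrent R) (p q : R) (Z₁ Z₂ X₁ X₂ Y₁ Y₂ : R) :
    AlgCurrent R where
  lead := A.lead
  uxx := A.uxx + (Z₁ * du p + Z₂ * du q) - (du A.lead * X₁ + dv A.lead * Y₁)
  vxx := A.vxx + (Z₁ * dv p + Z₂ * dv q) - (du A.lead * X₂ + dv A.lead * Y₂)
  uxux := A.uxux + (Z₁ * du (du p) + Z₂ * du (du q) + du Z₁ * du p + dv Z₁ * du q)
    - (du A.lead * du X₁ + dv A.lead * du Y₁)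
  vxvx := A.vxvx + (Z₁ * dv (dv p) + Z₂ * dv (dv q) + du Z₂ * dv p + dv Z₂ * dv q)
    - (du A.lead * dv X₂ + dv A.lead * dv Y₂)
  uxvx := A.uxvx + (Z₁ * dv (du p) + Z₁ * dv (du p) + (Z₂ * dv (du q) + Z₂ * dv (du q))
      + du Z₁ * dv p + dv Z₁ * dv q + du Z₂ * du p + dv Z₂ * du q)
    - (du A.lead * (dv X₁ + du X₂) + dv A.lead * (dv Y₁ + du Y₂))

variable [Algebra ℝ R] {du dv : Derivation ℝ R R}

set_option maxHeartbeats 4000000 in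
/-- Miura transformations preserve commutation with a flow. -/
theorem miura_flow_eq (comm : ∀ f, du (dv f) = dv (du f)) {w α β : R} (hw : dv w = 0)
    {A₁ A₂ P Q : AlgCurrent R} (X₁ X₂ Y₁ Y₂ : R)
    (h1u : du A₁.lead = 0) (h1v : dv A₁.lead = 1) (h2u : du A₂.lead = w) (h2v : dv A₂.lead = 0)
    (hpu : du P.lead = β) (hpv : dv P.lead = α) (hqu : du Q.lead = w * α) (hqv : dv Q.lead = β)
    (hβu : du β = w * dv α) (hβv : dv β = du α) (hα : du (du α) = w * dv (dv α))
    (e1 : A₁.flow du dv P Q = P.flow du dv A₁ A₂) (e2 : A₂.flow du dv P Q = Q.flow du dv A₁ A₂) :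
    (A₁.miura du dv A₁.lead A₂.lead X₁ X₂ X₁ X₂ Y₁ Y₂).flow du dv
        (P.miura du dv P.lead Q.lead X₁ X₂ X₁ X₂ Y₁ Y₂)
        (Q.miura du dv P.lead Q.lead Y₁ Y₂ X₁ X₂ Y₁ Y₂) =
      (P.miura du dv P.lead Q.lead X₁ X₂ X₁ X₂ Y₁ Y₂).flow du dv
        (A₁.miura du dv A₁.lead A₂.lead X₁ X₂ X₁ X₂ Y₁ Y₂)
        (A₂.miura du dv A₁.lead A₂.lead Y₁ Y₂ X₁ X₂ Y₁ Y₂) ∧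
    (A₂.miura du dv A₁.lead A₂.lead Y₁ Y₂ X₁ X₂ Y₁ Y₂).flow du dv
        (P.miura du dv P.lead Q.lead X₁ X₂ X₁ X₂ Y₁ Y₂)
        (Q.miura du dv P.lead Q.lead Y₁ Y₂ X₁ X₂ Y₁ Y₂) =
      (Q.miura du dv P.lead Q.lead Y₁ Y₂ X₁ X₂ Y₁ Y₂).flow du dv
        (A₁.miura du dv A₁.lead A₂.lead X₁ X₂ X₁ X₂ Y₁ Y₂)
        (A₂.miura du dv A₁.lead A₂.lead Y₁ Y₂ X₁ X₂ Y₁ Y₂) := by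
  simp only [Cubic.ext_iff, AlgCurrent.flow] at e1 e2
  obtain ⟨a1, a2, a3, a4, a5, a6, a7, a8, a9, a10⟩ := e1
  obtain ⟨b1, b2, b3, b4, b5, b6, b7, b8, b9, b10⟩ := e2
  simp only [map_zero, Derivation.map_one_eq_zero, comm, hw, h1u, h1v, h2u, h2v, hpu, hpv, hqu, hqv,
    hβu, hβv, hα, Derivation.leibniz, map_add, smul_eq_mul, mul_zero, zero_mul, add_zero, zero_add,
    one_mul, mul_one] at a1 a2 a3 a4 a5 a6 a7 a8 a9 a10 b1 b2 b3 b4 b5 b6 b7 b8 b9 b10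
  constructor <;> ext1
  all_goals
    simp only [AlgCurrent.flow, AlgCurrent.miura, map_add, map_sub, map_zero, Derivation.leibniz,
      Derivation.map_one_eq_zero, smul_eq_mul, comm, hw, h1u, h1v, h2u, h2v, hpu, hpv, hqu, hqv,
      hβu, hβv, hα, mul_zero, zero_mul, add_zero, zero_add, one_mul, mul_one]
  -- Each new equation differs from the old one only by terms in `X₁`, `X₂`, `Y₁`, `Y₂`. Once the
  -- relations between the leading parts are inserted, these cancel identically: a common change of
  -- variables cannot destroy the commutation of the leading flows.
  · linear_combination a1
  · linear_combination a2
  · linear_combination a3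
  · linear_combination a4
  · linear_combination a5
  · linear_combination a6
  · linear_combination a7
  · linear_combination a8
  · linear_combination a9
  · linear_combination a10
  · linear_combination b1
  · linear_combination b2
  · linear_combination b3
  · linear_combination b4
  · linear_combination b5
  · linear_combination b6
  · linear_combination b7
  · linear_combination b8
  · linear_combination b9
  · linear_combination b10

end AlgebraicMiura

/-! ### Consequences of a single symmetry for a reduced deformation -/

section Elimination

set_option linter.unusedSimpArgs false

variable {R : Type*} [CommRing R] [Algebra ℝ R] {du dv : Derivation ℝ R R} {m : ℝ} {u ui w wi : R}

-- The equations for the symmetry with `α = u` form an overdetermined system for the coefficients of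
-- `P`, `Q` and of the deformation. It is solved by descending order of derivatives: the third
-- derivatives give `Q₃`, `Q₄`; the entries with a second derivative give `P₃`, `P₄`, the two
-- differential equations for `a`, `b` and four more unknowns; the entries cubic in first
-- derivatives give the rest.
set_option maxHeartbeats 4000000 in
theorem normal_of_flow (h : IsDihedralRing du dv m u ui w wi) (hm : m ≠ 1)
    {l₁ l₂ a₁₅ a₁₆ a₁₇ a b c t : R} {P Q : AlgCurrent R}
    (hl1u : du l₁ = 0) (hl1v : dv l₁ = 1) (hl2u : du l₂ = w) (hl2v : dv l₂ = 0)
    (htu : du t = 0) (htv : dv t = 1)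
    (hpu : du P.lead = t) (hpv : dv P.lead = u) (hqu : du Q.lead = w * u) (hqv : dv Q.lead = t)
    (e1 : (⟨l₁, 0, 0, a₁₅, a₁₆, a₁₇⟩ : AlgCurrent R).flow du dv P Q
      = P.flow du dv ⟨l₁, 0, 0, a₁₅, a₁₆, a₁₇⟩ ⟨l₂, a, b, c, -(wi * c), 0⟩)
    (e2 : (⟨l₂, a, b, c, -(wi * c), 0⟩ : AlgCurrent R).flow du dv P Q
      = Q.flow du dv ⟨l₁, 0, 0, a₁₅, a₁₆, a₁₇⟩ ⟨l₂, a, b, c, -(wi * c), 0⟩) :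
    du a = w * dv b + cst R (2 * m - 3) * (a * ui) ∧
    du b = dv a + cst R (m - 2) * (b * ui) ∧
    (⟨l₁, 0, 0, a₁₅, a₁₆, a₁₇⟩ : AlgCurrent R) = normalFst du dv m ui wi l₁ a b ∧
    (⟨l₂, a, b, c, -(wi * c), 0⟩ : AlgCurrent R) = normalSnd dv m ui w wi l₂ a b := by
  obtain ⟨p, P₃, P₄, P₅, P₆, P₇⟩ := P
  obtain ⟨q, Q₃, Q₄, Q₅, Q₆, Q₇⟩ := Q
  -- Subtracting `α = u` times the coefficients of the deformation removes `a₁₅`, `a₁₆`, `a₁₇` and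
  -- `c` from the entries that contain a second derivative. The same shift is built into
  -- `symmetryFst` and `symmetrySnd`.
  obtain ⟨P₅, rfl⟩ : ∃ x, P₅ = u * a₁₅ + x := ⟨P₅ - u * a₁₅, by ring⟩
  obtain ⟨P₆, rfl⟩ : ∃ x, P₆ = u * a₁₆ + x := ⟨P₆ - u * a₁₆, by ring⟩
  obtain ⟨P₇, rfl⟩ : ∃ x, P₇ = u * a₁₇ + x := ⟨P₇ - u * a₁₇, by ring⟩
  obtain ⟨Q₅, rfl⟩ : ∃ x, Q₅ = u * c + x := ⟨Q₅ - u * c, by ring⟩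
  obtain ⟨Q₆, rfl⟩ : ∃ x, Q₆ = -(u * (wi * c)) + x := ⟨Q₆ + u * (wi * c), by ring⟩
  simp only [Cubic.ext_iff, AlgCurrent.flow] at e1 e2 hpu hpv hqu hqv
  obtain ⟨a1, a2, a3, a4, a5, a6, a7, a8, a9, a10⟩ := e1
  -- The two discarded entries repeat `a2` (multiplied by `w`) and `a1`.
  obtain ⟨-, -, b3, b4, b5, b6, b7, b8, b9, b10⟩ := e2
  simp only [map_add, map_neg, map_zero, Derivation.leibniz, Derivation.map_one_eq_zero,
    smul_eq_mul, h.comm, h.du_u, h.dv_u, h.du_w, h.dv_w, h.du_wi, h.dv_wi, hl1u, hl1v, hl2u, hl2v,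
    htu, htv, hpu, hpv, hqu, hqv, mul_zero, zero_mul, add_zero, zero_add, mul_one, one_mul, neg_zero]
    at a1 a2 a3 a4 a5 a6 a7 a8 a9 a10 b3 b4 b5 b6 b7 b8 b9 b10
  have hQ3 : Q₃ = w * P₄ + u * a := by linear_combination a1
  have hQ4 : Q₄ = P₃ + u * b := by linear_combination a2
  subst hQ3 hQ4
  simp only [map_add, map_neg, map_sub, map_zero, Derivation.leibniz, Derivation.map_one_eq_zero,
    derivation_cst, smul_eq_mul, h.comm, h.du_u, h.dv_u, h.du_ui, h.dv_ui, h.du_w, h.dv_w, h.du_wi,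
    h.dv_wi, mul_zero, zero_mul, add_zero, zero_add, mul_one, one_mul]
    at a3 a4 a5 a6 a7 a8 a9 a10 b3 b4 b5 b6 b7 b8 b9 b10
  have hm' : m - 1 ≠ 0 := sub_ne_zero.2 hm
  -- In this combination of four entries all derivatives and all unknown quadratic coefficients
  -- cancel. What remains is algebraic, with `P₄` multiplied by `w_u`, hence by `m - 1` up to
  -- invertible factors. The next step treats `P₃` by the complementary four entries.
  have hP4 : P₄ = cst R (1 / (m - 1)) * (u * (wi * a)) := by
    refine h.ext _ _ fun φ => ?_
    have hu := h.map_u_ne_zero φ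
    have hw := h.map_w_ne_zero φ
    have fa3 := congrArg φ a3
    have fb5 := congrArg φ b5
    have fa6 := congrArg φ a6
    have fb4 := congrArg φ b4
    simp only [map_add, map_sub, map_neg, map_mul, map_zero, map_one, map_ofNat, algHom_cst,
      h.map_ui φ, h.map_wi φ] at fa3 fb5 fa6 fb4 ⊢
    linear_combination (norm := (field_simp; ring)) -(φ u / (6 * (m - 1) * φ w)) * (fa3 + fb5 + φ w * fa6 + fb4)
  have hP3 : P₃ = cst R (1 / (m - 1)) * (u * b) := by
    refine h.ext _ _ fun φ => ?_
    have hu := h.map_u_ne_zero φ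
    have hw := h.map_w_ne_zero φ
    have fa4 := congrArg φ a4
    have fb6 := congrArg φ b6
    have fa5 := congrArg φ a5
    have fb3 := congrArg φ b3
    simp only [map_add, map_sub, map_neg, map_mul, map_zero, map_one, map_ofNat, algHom_cst,
      h.map_ui φ, h.map_wi φ] at fa4 fb6 fa5 fb3 ⊢
    linear_combination (norm := (field_simp; ring)) -(φ u / (6 * (m - 1) * φ w)) * (φ w * (fa4 + fb6) + (φ w * fa5 + fb3))
  subst hP4 hP3
  simp only [map_add, map_neg, map_sub, map_zero, Derivation.leibniz, Derivation.map_one_eq_zero,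
    derivation_cst, smul_eq_mul, h.comm, h.du_u, h.dv_u, h.du_ui, h.dv_ui, h.du_w, h.dv_w, h.du_wi,
    h.dv_wi, mul_zero, zero_mul, add_zero, zero_add, mul_one, one_mul]
    at a3 a4 a5 a6 a7 a8 a9 a10 b3 b4 b5 b6 b7 b8 b9 b10
  -- With `P₃` and `P₄` known, two sums of second order entries are free of the remaining unknowns
  -- and become the compatibility conditions for `a` and `b`.
  have hda : du a = w * dv b + cst R (2 * m - 3) * (a * ui) := by
    refine h.ext _ _ fun φ => ?_
    have hu := h.map_u_ne_zero φ
    have hw := h.map_w_ne_zero φ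
    have fa3 := congrArg φ a3
    have fb5 := congrArg φ b5
    simp only [map_add, map_sub, map_neg, map_mul, map_zero, map_one, map_ofNat, algHom_cst,
      h.map_ui φ, h.map_wi φ] at fa3 fb5 ⊢
    linear_combination (norm := (field_simp; ring)) (m - 1) / (2 * φ u) * (fa3 + fb5)
  have hdb : du b = dv a + cst R (m - 2) * (b * ui) := by
    refine h.ext _ _ fun φ => ?_
    have hu := h.map_u_ne_zero φ
    have hw := h.map_w_ne_zero φ
    have fa4 := congrArg φ a4
    have fb6 := congrArg φ b6
    simp only [map_add, map_sub, map_neg, map_mul, map_zero, map_one, map_ofNat, algHom_cst,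
      h.map_ui φ, h.map_wi φ] at fa4 fb6 ⊢
    linear_combination (norm := (field_simp; ring)) -((m - 1) / (2 * φ u)) * (fa4 + fb6)
  simp only [map_add, map_neg, map_sub, map_zero, Derivation.leibniz, Derivation.map_one_eq_zero,
    derivation_cst, smul_eq_mul, h.comm, h.du_u, h.dv_u, h.du_ui, h.dv_ui, h.du_w, h.dv_w, h.du_wi,
    h.dv_wi, hda, hdb, mul_zero, zero_mul, add_zero, zero_add, mul_one, one_mul]
    at a3 a4 a5 a6 a7 a8 a9 a10 b3 b4 b5 b6 b7 b8 b9 b10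
  have hQ5 : Q₅ = cst R (1 / 2) * (w * P₇) + cst R (3 / 2) * a := by
    refine h.ext _ _ fun φ => ?_
    have hu := h.map_u_ne_zero φ
    have hw := h.map_w_ne_zero φ
    have fa3 := congrArg φ a3
    simp only [map_add, map_sub, map_neg, map_mul, map_zero, map_one, map_ofNat, algHom_cst,
      h.map_ui φ, h.map_wi φ] at fa3 ⊢
    linear_combination (norm := (field_simp; ring)) 1 / 2 * fa3
  have hQ6 : Q₆ = cst R (1 / 2) * P₇ := by
    refine h.ext _ _ fun φ => ?_
    have hu := h.map_u_ne_zero φ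
    have hw := h.map_w_ne_zero φ
    have fa6 := congrArg φ a6
    simp only [map_add, map_sub, map_neg, map_mul, map_zero, map_one, map_ofNat, algHom_cst,
      h.map_ui φ, h.map_wi φ] at fa6 ⊢
    linear_combination (norm := (field_simp; ring)) 1 / 2 * fa6
  have hQ7 : Q₇ = w * P₆ + w * P₆ + b := by
    refine h.ext _ _ fun φ => ?_
    have hu := h.map_u_ne_zero φ
    have hw := h.map_w_ne_zero φ
    have fa4 := congrArg φ a4
    simp only [map_add, map_sub, map_neg, map_mul, map_zero, map_one, map_ofNat, algHom_cst,
      h.map_ui φ, h.map_wi φ] at fa4 ⊢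
    linear_combination (norm := (field_simp; ring)) fa4
  subst hQ5 hQ6 hQ7
  have hP5 : P₅ = w * P₆ + cst R (3 / 2) * b := by
    refine h.ext _ _ fun φ => ?_
    have hu := h.map_u_ne_zero φ
    have hw := h.map_w_ne_zero φ
    have fa5 := congrArg φ a5
    simp only [map_add, map_sub, map_neg, map_mul, map_zero, map_one, map_ofNat, algHom_cst,
      h.map_ui φ, h.map_wi φ] at fa5 ⊢
    linear_combination (norm := (field_simp; ring)) -(1 / 2) * fa5
  subst hP5
  clear a3 a4 a5 a6 b3 b4 b5 b6
  simp only [map_add, map_neg, map_sub, map_zero, Derivation.leibniz, Derivation.map_one_eq_zero,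
    derivation_cst, smul_eq_mul, h.comm, h.du_u, h.dv_u, h.du_ui, h.dv_ui, h.du_w, h.dv_w, h.du_wi,
    h.dv_wi, hda, hdb, mul_zero, zero_mul, add_zero, zero_add, mul_one, one_mul]
    at a7 a8 a9 a10 b7 b8 b9 b10
  -- From here on only the entries cubic in `u_x`, `v_x` are used. In the differences of entries
  -- taken for `a₁₇`, `P₆` and `P₇` the derivatives of the unknowns drop out.
  have h17 : a₁₇ = -(cst R (1 / 2) * dv b) := by
    refine h.ext _ _ fun φ => ?_
    have hu := h.map_u_ne_zero φ
    have hw := h.map_w_ne_zero φ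
    have fa9 := congrArg φ a9
    have fb10 := congrArg φ b10
    simp only [map_add, map_sub, map_neg, map_mul, map_zero, map_one, map_ofNat, algHom_cst,
      h.map_ui φ, h.map_wi φ] at fa9 fb10 ⊢
    linear_combination (norm := (field_simp; ring)) 1 / 2 * (fa9 - fb10)
  have hP6 : P₆ = -(cst R (1 / (4 * (m - 1))) * (u * wi * (dv a + cst R (m - 2) * (b * ui)))) := by
    refine h.ext _ _ fun φ => ?_
    have hu := h.map_u_ne_zero φ
    have hw := h.map_w_ne_zero φ
    have fb9 := congrArg φ b9
    have fa10 := congrArg φ a10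
    simp only [map_add, map_sub, map_neg, map_mul, map_zero, map_one, map_ofNat, algHom_cst,
      h.map_ui φ, h.map_wi φ] at fb9 fa10 ⊢
    linear_combination (norm := (field_simp; ring)) -(φ u / (4 * (m - 1) * φ w)) * (fb9 - φ w * fa10)
  have hP7 : P₇ = -(cst R (1 / (2 * (m - 1))) * (u * wi * (w * dv b + cst R (2 * m - 3) * (a * ui)))) := by
    refine h.ext _ _ fun φ => ?_
    have hu := h.map_u_ne_zero φ
    have hw := h.map_w_ne_zero φ
    have fa7 := congrArg φ a7
    have fb8 := congrArg φ b8
    simp only [map_add, map_sub, map_neg, map_mul, map_zero, map_one, map_ofNat, algHom_cst,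
      h.map_ui φ, h.map_wi φ] at fa7 fb8 ⊢
    linear_combination (norm := (field_simp; ring)) φ u / (2 * (m - 1) * φ w) * (fa7 - fb8)
  subst h17 hP6 hP7
  simp only [map_add, map_neg, map_sub, map_zero, Derivation.leibniz, Derivation.map_one_eq_zero,
    derivation_cst, smul_eq_mul, h.comm, h.du_u, h.dv_u, h.du_ui, h.dv_ui, h.du_w, h.dv_w, h.du_wi,
    h.dv_wi, hda, hdb, mul_zero, zero_mul, add_zero, zero_add, mul_one, one_mul]
    at a8 a10 b10
  have h16 : a₁₆ = cst R (1 / 4) * wi * (dv a + cst R (m - 2) * (b * ui) +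
      cst R ((m - 2) / (m - 1)) * (b * ui)) := by
    refine h.ext _ _ fun φ => ?_
    have hu := h.map_u_ne_zero φ
    have hw := h.map_w_ne_zero φ
    have fa10 := congrArg φ a10
    simp only [map_add, map_sub, map_neg, map_mul, map_zero, map_one, map_ofNat, algHom_cst,
      h.map_ui φ, h.map_wi φ] at fa10 ⊢
    linear_combination (norm := (field_simp; ring)) fa10
  have hc : c = normalCoeff dv m ui w a b := by
    refine h.ext _ _ fun φ => ?_
    have hu := h.map_u_ne_zero φ
    have hw := h.map_w_ne_zero φ
    have fb10 := congrArg φ b10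
    simp only [map_add, map_sub, map_neg, map_mul, map_zero, map_one, map_ofNat, algHom_cst,
      h.map_ui φ, h.map_wi φ] at fb10
    simp only [normalCoeff, map_add, map_sub, map_neg, map_mul, map_zero, map_one, map_ofNat, algHom_cst,
      h.map_ui φ, h.map_wi φ]
    linear_combination (norm := (field_simp; ring)) -(φ w) * fb10
  subst h16
  have h15 : a₁₅ = -(cst R (1 / 2) * dv a) - cst R (1 / 4) * (dv a + cst R (m - 2) * (b * ui) +
      cst R ((m - 2) / (m - 1)) * (b * ui)) := by
    refine h.ext _ _ fun φ => ?_
    have hu := h.map_u_ne_zero φ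
    have hw := h.map_w_ne_zero φ
    have fa8 := congrArg φ a8
    simp only [map_add, map_sub, map_neg, map_mul, map_zero, map_one, map_ofNat, algHom_cst,
      h.map_ui φ, h.map_wi φ] at fa8 ⊢
    linear_combination (norm := (field_simp; ring)) 1 / 3 * fa8
  refine ⟨hda, hdb, ?_, ?_⟩
  · rw [h15]
    simp only [normalFst, hdb]
  · rw [normalSnd, ← hc]

end Elimination

/-! ### Miura transformations of deformed systems -/

/-- The argument `ε²` is nonnegative, so Taylor's formula on an interval to the right of `0` is
enough; its quadratic remainder is `O(ε⁴)`. -/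
theorem isBigO_taylor_one {K : ℝ → ℝ} {k : ℝ} (hK : ContDiffAt ℝ ∞ K 0) (hk : HasDerivAt K k 0) :
    (fun ε : ℝ => K (ε ^ 2) - K 0 - ε ^ 2 * k) =O[𝓝 0] fun ε : ℝ => ε ^ 3 := by
  obtain ⟨s, hs, hKs⟩ : ∃ s ∈ 𝓝 (0 : ℝ), ContDiffOn ℝ 2 K s := by
    obtain ⟨s, hs, h⟩ := (hK.of_le (m := 2) (by exact ENat.LEInfty.out)).contDiffOn (m := 2) le_rfl
      (by simp)
    exact ⟨s, by simpa using hs, h⟩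
  obtain ⟨r, hr, hrs⟩ := Metric.mem_nhds_iff.1 hs
  have hsub : Set.Icc 0 (r / 2) ⊆ s := fun y hy => hrs (by
    rw [Metric.mem_ball, Real.dist_eq, sub_zero, abs_of_nonneg hy.1]; linarith [hy.2])
  have hb : (0 : ℝ) < r / 2 := by linarith
  obtain ⟨C, hC⟩ := exists_taylor_mean_remainder_bound (f := K) (n := 1) hb.le (hKs.mono hsub)
  have h1 : derivWithin K (Set.Icc 0 (r / 2)) 0 = k :=
    hk.hasDerivWithinAt.derivWithin (uniqueDiffOn_Icc hb 0 ⟨le_rfl, hb.le⟩)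
  have hev : ∀ᶠ ε : ℝ in 𝓝 0, ε ^ 2 ≤ r / 2 :=
    (Continuous.tendsto' (by fun_prop) 0 0 (by simp) : Tendsto (fun ε : ℝ => ε ^ 2) (𝓝 0) (𝓝 0))
      |>.eventually_le_const hb
  have h4 : (fun ε : ℝ => K (ε ^ 2) - K 0 - ε ^ 2 * k) =O[𝓝 0] fun ε : ℝ => ε ^ 4 := by
    refine IsBigO.of_bound C ?_
    filter_upwards [hev] with ε hε
    have := hC (ε ^ 2) ⟨sq_nonneg ε, hε⟩
    rw [taylorWithinEval_succ, taylor_within_zero_eval, iteratedDerivWithin_one, h1] at this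
    have e1 : ‖ε ^ 4‖ = (ε ^ 2 - 0) ^ (1 + 1) := by
      rw [Real.norm_of_nonneg (by positivity)]; ring
    rw [e1]
    refine le_trans (le_of_eq (congrArg norm ?_)) this
    simp
    ring
  refine h4.trans ?_
  have : (fun ε : ℝ => ε ^ 3 * ε) =O[𝓝 0] fun ε : ℝ => ε ^ 3 * 1 :=
    (isBigO_refl _ _).mul ((Continuous.tendsto continuous_id 0).isBigO_one ℝ)
  exact this.congr (fun ε => by ring) fun ε => by ring

/-- The current `ε (f u_x + g v_x)`. -/
def firstOrderCurrent (f g : ℝ × ℝ → ℝ) : Current where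
  lead := 0
  ux := f
  vx := g
  uxx := 0
  vxx := 0
  uxux := 0
  vxvx := 0
  uxvx := 0

/-- The dispersionless part of a current. -/
def Current.leadPart (A : Current) : Current where
  lead := A.lead
  ux := 0
  vx := 0
  uxx := 0
  vxx := 0
  uxux := 0
  vxvx := 0
  uxvx := 0

/-- The second order part of a current. -/
def Current.quadPart (A : Current) : Current where
  lead := 0
  ux := 0
  vx := 0
  uxx := A.uxx
  vxx := A.vxx
  uxux := A.uxux
  vxvx := A.vxvx
  uxvx := A.uxvx

theorem smoothOn_zero {V : Set (ℝ × ℝ)} : ContDiffOn ℝ ∞ (0 : ℝ × ℝ → ℝ) V := contDiffOn_const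

theorem firstOrderCurrent_smoothOn {V : Set (ℝ × ℝ)} {f g : ℝ × ℝ → ℝ} (hf : ContDiffOn ℝ ∞ f V)
    (hg : ContDiffOn ℝ ∞ g V) : (firstOrderCurrent f g).SmoothOn V :=
  ⟨smoothOn_zero, hf, hg, smoothOn_zero, smoothOn_zero, smoothOn_zero, smoothOn_zero, smoothOn_zero⟩

theorem Current.SmoothOn.mono {A : Current} {V U : Set (ℝ × ℝ)} (h : A.SmoothOn V) (hU : U ⊆ V) :
    A.SmoothOn U := by
  obtain ⟨h1, h2, h3, h4, h5, h6, h7, h8⟩ := h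
  exact ⟨h1.mono hU, h2.mono hU, h3.mono hU, h4.mono hU, h5.mono hU, h6.mono hU, h7.mono hU,
    h8.mono hU⟩

section Transforms

variable {U : Set (ℝ × ℝ)} {O : Set ℝ} {u v ξ η : ℝ → ℝ} {A : Current}

/-- Without first order terms the current along the shifted curve depends on `ε` only through `s =
ε²`. The claim is the first order Taylor expansion in `s`, whose linear coefficient combines the
shift of the leading part with the unshifted second order part. -/
theorem rate_variation_taylor (hU : IsOpen U) (hO : IsOpen O) (hA : A.SmoothOn U)
    (hux : A.ux = 0) (hvx : A.vx = 0)
    (hu : ContDiffOn ℝ ∞ u O) (hv : ContDiffOn ℝ ∞ v O) (hc : ∀ y ∈ O, (u y, v y) ∈ U)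
    (hξ : ContDiffOn ℝ ∞ ξ O) (hη : ContDiffOn ℝ ∞ η O) {x : ℝ} (hx : x ∈ O) :
    (fun ε : ℝ => A.rate ε (u + ε ^ 2 • ξ) (v + ε ^ 2 • η) x
      - deriv (A.ev0 u v) x - ε ^ 2 * deriv (A.lin0 u v ξ η + A.ev2 u v) x)
      =O[𝓝 0] fun ε : ℝ => ε ^ 3 := by
  have hL : A.leadPart.SmoothOn U := ⟨hA.1, smoothOn_zero, smoothOn_zero, smoothOn_zero,
    smoothOn_zero, smoothOn_zero, smoothOn_zero, smoothOn_zero⟩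
  have hM : A.quadPart.SmoothOn U := ⟨smoothOn_zero, smoothOn_zero, smoothOn_zero, hA.2.2.2⟩
  have hW := isOpen_variationDomain hU hO hu hv hξ hη
  have sL := Current.smoothOn_variation hO hL hu hv hξ hη 0
  have sM := Current.smoothOn_variation hO hM hu hv hξ hη 1
  have h0 : ∀ y ∈ O, ((0 : ℝ), y) ∈ variationDomain U O u v ξ η := fun y hy =>
    ⟨hy, by simpa using hc y hy⟩
  -- The explicit factor `ε²` in front of the second order part becomes the coordinate `s`; the
  -- values `0` and `1` of `ε` merely switch the two parts of the current on without further
  -- weights.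
  set Ψ : ℝ × ℝ → ℝ := A.leadPart.variation 0 u v ξ η + Prod.fst * A.quadPart.variation 1 u v ξ η
    with hΨ
  have sF : ContDiffOn ℝ ∞ (Prod.fst : ℝ × ℝ → ℝ) (variationDomain U O u v ξ η) :=
    contDiff_fst.contDiffOn
  have sFM : ContDiffOn ℝ ∞ (Prod.fst * A.quadPart.variation 1 u v ξ η)
      (variationDomain U O u v ξ η) := sF.mul sM
  have sΨ : ContDiffOn ℝ ∞ Ψ (variationDomain U O u v ξ η) := sL.add sFM
  have hΨ_eval : ∀ ε y, Ψ (ε ^ 2, y) = A.eval ε (u + ε ^ 2 • ξ) (v + ε ^ 2 • η) y := by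
    intro ε y
    simp [hΨ, Current.variation, Current.eval, Current.leadPart, Current.quadPart, hux, hvx]
  have hrate : ∀ ε, A.rate ε (u + ε ^ 2 • ξ) (v + ε ^ 2 • η) x = pdv Ψ (ε ^ 2, x) := by
    intro ε
    simp only [Current.rate, pdv, hΨ_eval]
  have hpdu : Set.EqOn (fun y => pdu Ψ (0, y)) (A.lin0 u v ξ η + A.ev2 u v) O := by
    intro y hy
    have e1 := pdu_add hW sL sFM (h0 y hy)
    have e2 := pdu_mul hW sF sM (h0 y hy)
    have e3 : pdu (Prod.fst : ℝ × ℝ → ℝ) (0, y) = 1 := by simp [pdu]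
    have e4 := Current.pdu_variation hU hO hL hu hv hc hξ hη 0 hy
    have e5 : A.quadPart.variation 1 u v ξ η (0, y) = A.ev2 u v y := by
      simp [Current.variation, Current.quadPart, Current.eval, Current.ev2]
    simp only [hΨ]
    rw [e1, e2, e3, e4, e5]
    simp [Current.lin, Current.lin0, Current.leadPart]
  have hderiv : HasDerivAt (fun s => pdv Ψ (s, x)) (deriv (A.lin0 u v ξ η + A.ev2 u v) x) 0 := by
    have h := hasDerivAt_pdu hW (smoothOn_pdv hW sΨ) (h0 x hx)
    rw [pdu_pdv_comm hW sΨ (h0 x hx)] at h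
    rw [← deriv_eqOn hO hpdu hx]
    exact h
  have hsmooth : ContDiffAt ℝ ∞ (fun s => pdv Ψ (s, x)) 0 :=
    ((smoothOn_pdv hW sΨ).contDiffAt (hW.mem_nhds (h0 x hx))).comp (0 : ℝ)
      (contDiffAt_id.prodMk contDiffAt_const)
  have hzero : pdv Ψ (0, x) = deriv (A.ev0 u v) x := by
    have := (hrate 0).symm
    simp only [ne_eq, OfNat.ofNat_ne_zero, not_false_eq_true, zero_pow, zero_smul, add_zero] at this
    rw [this]
    simp only [Current.rate]
    congr 1
    funext y
    simp [Current.eval, Current.ev0]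
  refine (isBigO_taylor_one hsmooth hderiv).congr_left fun ε => ?_
  simp only [hrate, hzero]

/-- The effect of a Miura transformation on a component of a system. -/
theorem miura_component {S : System} {A B : Current} {β : Miura} {b₁ b₂ : ℝ × ℝ → ℝ}
    (hU : IsOpen U) (hO : IsOpen O) (hS : S.SmoothOn U) (hβ : β.SmoothOn U)
    (hA : A.SmoothOn U) (hB : B.SmoothOn U) (hux : B.ux = 0) (hvx : B.vx = 0)
    (hA1 : ∀ z ∈ U, A.ux z = 0 ∧ A.vx z = 0)
    (hb₁ : ContDiffOn ℝ ∞ b₁ U) (hb₂ : ContDiffOn ℝ ∞ b₂ U)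
    (hu : ContDiffOn ℝ ∞ u O) (hv : ContDiffOn ℝ ∞ v O) (hc : ∀ y ∈ O, (u y, v y) ∈ U)
    (hlead : Set.EqOn A.lead B.lead U)
    (hξ : ξ = deriv ((firstOrderCurrent β.b11 β.b12).ev1 u v))
    (hη : η = deriv ((firstOrderCurrent β.b21 β.b22).ev1 u v))
    (hquad : Set.EqOn (A.ev2 u v + (firstOrderCurrent b₁ b₂).flow1 S u v)
      (B.lin0 u v ξ η + B.ev2 u v) O) {x : ℝ} (hx : x ∈ O) :
    (fun ε : ℝ => A.rate ε u v x + ε * deriv ((firstOrderCurrent b₁ b₂).lin ε u v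
        (S.fst.rate ε u v) (S.snd.rate ε u v)) x
      - B.rate ε (β.mapU ε u v) (β.mapV ε u v) x) =O[𝓝 0] fun ε : ℝ => ε ^ 3 := by
  obtain ⟨h11, h12, h21, h22⟩ := hβ
  have c1 := firstOrderCurrent_smoothOn h11 h12
  have c2 := firstOrderCurrent_smoothOn h21 h22
  have c := firstOrderCurrent_smoothOn hb₁ hb₂
  have sξ : ContDiffOn ℝ ∞ ξ O := hξ ▸ smoothOn_deriv hO (Current.smoothOn_ev1 hO c1 hu hv hc)
  have sη : ContDiffOn ℝ ∞ η O := hη ▸ smoothOn_deriv hO (Current.smoothOn_ev1 hO c2 hu hv hc)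
  have hmapU : ∀ ε, β.mapU ε u v = u + ε ^ 2 • ξ := fun ε => by rw [hξ]; rfl
  have hmapV : ∀ ε, β.mapV ε u v = v + ε ^ 2 • η := fun ε => by rw [hη]; rfl
  obtain ⟨d₃, d₄, hd⟩ := Current.deriv_lin_rate hU hO c hS hu hv hc hx
  have z1 : Set.EqOn (A.ev1 u v) 0 O := fun y hy => by simp [Current.ev1, hA1 _ (hc y hy)]
  have hrate : ∀ ε, A.rate ε u v x = deriv (A.ev0 u v) x + ε ^ 2 * deriv (A.ev2 u v) x := by
    intro ε
    rw [Current.rate_eqOn hO hA hu hv hc ε hx]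
    simp only [Pi.add_apply, Pi.smul_apply, smul_eq_mul]
    rw [deriv_eqOn_zero hO z1 hx]
    simp
  have hflow0 : deriv ((firstOrderCurrent b₁ b₂).flow0 S u v) x = 0 := by
    have : (firstOrderCurrent b₁ b₂).flow0 S u v = fun _ => 0 := by
      funext y
      simp [Current.flow0, Current.lin0, firstOrderCurrent, pdu, pdv]
    rw [this]; simp
  have hev0 : deriv (A.ev0 u v) x = deriv (B.ev0 u v) x :=
    deriv_eqOn hO (fun y hy => hlead (hc y hy)) hx
  have hsum : deriv (A.ev2 u v) x + deriv ((firstOrderCurrent b₁ b₂).flow1 S u v) x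
      = deriv (B.lin0 u v ξ η + B.ev2 u v) x := by
    rw [← deriv_eqOn hO hquad hx]
    exact ((hasDerivAt_of_smoothOn hO (Current.smoothOn_ev2 hO hA hu hv hc) hx).add
      (hasDerivAt_of_smoothOn hO (Current.lin_rate hU hO c hS hu hv hc).2.1 hx)).deriv.symm
  have hB := rate_variation_taylor hU hO hB hux hvx hu hv hc sξ sη hx
  -- The linearized first order current carries an extra factor `ε` and has no leading part. Its
  -- `flow1` term therefore enters at `ε²`, where `hquad` matches it, while `flow2` and the two
  -- remainders move to `ε³`, `ε⁴` and `ε⁵`.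
  have hpoly := (polynomial_isBigO_cube (c₀ := 0) (c₁ := 0) (c₂ := 0)
    (c₃ := deriv ((firstOrderCurrent b₁ b₂).flow2 S u v) x) (c₄ := d₃)).2 ⟨rfl, rfl, rfl⟩
  have h5 : (fun ε : ℝ => ε ^ 5 * d₄) =O[𝓝 0] fun ε : ℝ => ε ^ 3 := by
    have : (fun ε : ℝ => ε ^ 3 * (ε ^ 2 * d₄)) =O[𝓝 0] fun ε : ℝ => ε ^ 3 * 1 :=
      (isBigO_refl _ _).mul ((Continuous.tendsto (by fun_prop) 0).isBigO_one ℝ)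
    exact this.congr (fun ε => by ring) fun ε => by ring
  refine ((hpoly.add h5).sub hB).congr_left fun ε => ?_
  rw [hrate, hd, hflow0, hmapU, hmapV, hev0, ← hsum]
  ring

end Transforms

/-! ### Miura transformations in terms of coefficients -/

section MiuraCoefficients

variable {V : Opens (ℝ × ℝ)} {U : Set (ℝ × ℝ)} {O : Set ℝ} {u v : ℝ → ℝ}

/-- On `U`, the coefficients of the current `B` are those of `K`, without terms of order `ε`. -/
def Current.HasCoeffsOn (B : Current) (K : AlgCurrent (smoothAlg V)) (U : Set (ℝ × ℝ)) : Prop :=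
  B.ux = 0 ∧ B.vx = 0 ∧ Set.EqOn B.lead (extend K.lead) U ∧ Set.EqOn B.uxx (extend K.uxx) U ∧
  Set.EqOn B.vxx (extend K.vxx) U ∧ Set.EqOn B.uxux (extend K.uxux) U ∧
  Set.EqOn B.vxvx (extend K.vxvx) U ∧ Set.EqOn B.uxvx (extend K.uxvx) U

theorem Current.HasCoeffsOn.smoothOn {B : Current} {K : AlgCurrent (smoothAlg V)}
    (h : B.HasCoeffsOn K U) (hU : U ⊆ V) : B.SmoothOn U := by
  obtain ⟨h1, h2, h3, h4, h5, h6, h7, h8⟩ := h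
  have e := fun {f : ℝ × ℝ → ℝ} {k : smoothAlg V} (hf : Set.EqOn f (extend k) U) =>
    ((smoothOn_extend k).mono hU).congr hf
  exact ⟨e h3, h1 ▸ smoothOn_zero, h2 ▸ smoothOn_zero, e h4, e h5, e h6, e h7, e h8⟩

theorem deriv_firstOrder_extend (hO : IsOpen O) (hu : ContDiffOn ℝ ∞ u O)
    (hv : ContDiffOn ℝ ∞ v O) (hc : ∀ y ∈ O, (u y, v y) ∈ V) (X₁ X₂ : smoothAlg V) :
    Set.EqOn (deriv ((firstOrderCurrent (extend X₁) (extend X₂)).ev1 u v)) (fun y =>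
      extend X₁ (u y, v y) * deriv (deriv u) y + extend X₂ (u y, v y) * deriv (deriv v) y
      + extend (algU V X₁) (u y, v y) * deriv u y ^ 2
      + extend (algV V X₂) (u y, v y) * deriv v y ^ 2
      + (extend (algV V X₁) (u y, v y) + extend (algU V X₂) (u y, v y))
        * (deriv u y * deriv v y)) O := by
  intro y hy
  have e := fun k : smoothAlg V => hasDerivAt_extend k (hc y hy) (hasDerivAt_of_smoothOn hO hu hy)
    (hasDerivAt_of_smoothOn hO hv hy)
  have hu2 := hasDerivAt_of_smoothOn hO (smoothOn_deriv hO hu) hy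
  have hv2 := hasDerivAt_of_smoothOn hO (smoothOn_deriv hO hv) hy
  refine (((e X₁).mul hu2).add ((e X₂).mul hv2)).deriv.trans ?_
  ring

/-- This verifies the formulas of `AlgCurrent.miura`. On the left, `Z₁ u_x + Z₂ v_x` is
differentiated in time along the leading flow; on the right, the leading current of the target is
linearized in the shifts of `u` and `v`. -/
theorem miura_quad {S : System} (hS : S.SmoothOn V) {A B : Current} (hA : A.SmoothOn V)
    (hUo : IsOpen U) (hU : U ⊆ V) (Z₁ Z₂ X₁ X₂ Y₁ Y₂ : smoothAlg V)
    (hB : B.HasCoeffsOn ((A.coeffs hA).miura (algU V) (algV V) (S.fst.coeffs hS.1).lead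
      (S.snd.coeffs hS.2).lead Z₁ Z₂ X₁ X₂ Y₁ Y₂) U)
    (hO : IsOpen O) (hu : ContDiffOn ℝ ∞ u O) (hv : ContDiffOn ℝ ∞ v O)
    (hc : ∀ y ∈ O, (u y, v y) ∈ U) :
    Set.EqOn (A.ev2 u v + (firstOrderCurrent (extend Z₁) (extend Z₂)).flow1 S u v)
      (B.lin0 u v (deriv ((firstOrderCurrent (extend X₁) (extend X₂)).ev1 u v))
        (deriv ((firstOrderCurrent (extend Y₁) (extend Y₂)).ev1 u v)) + B.ev2 u v) O := by
  intro y hy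
  have hcV : ∀ y ∈ O, (u y, v y) ∈ V := fun y hy => hU (hc y hy)
  have hz := hcV y hy
  have f1 := S.fst.deriv_ev0 hO hS.1 hcV
  have g1 := S.snd.deriv_ev0 hO hS.2 hcV
  have f1' := f1.trans (deriv_extend hO hu hv hcV _)
  have g1' := g1.trans (deriv_extend hO hu hv hcV _)
  have f2 := (deriv_eqOn hO f1).trans (deriv2_extend hO hu hv hcV _)
  have g2 := (deriv_eqOn hO g1).trans (deriv2_extend hO hu hv hcV _)
  have k := fun {h : ℝ × ℝ → ℝ} (hh : ContDiffOn ℝ ∞ h V) =>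
    (show h (u y, v y) = extend (toAlg h hh) (u y, v y) from (extend_toAlg hh hz).symm)
  have ku : ∀ Z : smoothAlg V, pdu (extend Z) (u y, v y) = extend (algU V Z) (u y, v y) := fun Z => by
    rw [pdu_eq_extend (smoothOn_extend Z) hz, toAlg_extend]
  have kv : ∀ Z : smoothAlg V, pdv (extend Z) (u y, v y) = extend (algV V Z) (u y, v y) := fun Z => by
    rw [pdv_eq_extend (smoothOn_extend Z) hz, toAlg_extend]
  obtain ⟨-, -, b3, b4, b5, b6, b7, b8⟩ := hB
  have a4 : A.uxx (u y, v y) = extend (A.coeffs hA).uxx (u y, v y) := k hA.2.2.2.1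
  have a5 : A.vxx (u y, v y) = extend (A.coeffs hA).vxx (u y, v y) := k hA.2.2.2.2.1
  have a6 : A.uxux (u y, v y) = extend (A.coeffs hA).uxux (u y, v y) := k hA.2.2.2.2.2.1
  have a7 : A.vxvx (u y, v y) = extend (A.coeffs hA).vxvx (u y, v y) := k hA.2.2.2.2.2.2.1
  have a8 : A.uxvx (u y, v y) = extend (A.coeffs hA).uxvx (u y, v y) := k hA.2.2.2.2.2.2.2
  have z1 : ∀ a b : ℝ, pdu (0 : ℝ × ℝ → ℝ) (a, b) = 0 := fun a b => by simp [pdu]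
  have z2 : ∀ a b : ℝ, pdv (0 : ℝ × ℝ → ℝ) (a, b) = 0 := fun a b => by simp [pdv]
  have hflow : (firstOrderCurrent (extend Z₁) (extend Z₂)).flow1 S u v y
      = (firstOrderCurrent (extend Z₁) (extend Z₂)).lin1 u v (deriv (S.fst.ev0 u v))
        (deriv (S.snd.ev0 u v)) y := by
    simp [Current.flow1, Current.lin0, firstOrderCurrent, z1, z2]
  simp only [Pi.add_apply]
  rw [hflow]
  simp only [Current.lin0, Current.lin1, Current.ev2, firstOrderCurrent]
  rw [f1' hy, g1' hy, f2 hy, g2 hy]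
  have x1 := deriv_firstOrder_extend hO hu hv hcV X₁ X₂ hy
  have y1 := deriv_firstOrder_extend hO hu hv hcV Y₁ Y₂ hy
  simp only [firstOrderCurrent] at x1 y1
  rw [x1, y1, pdu_congr hUo b3 (hc y hy), pdv_congr hUo b3 (hc y hy), b4 (hc y hy), b5 (hc y hy),
    b6 (hc y hy), b7 (hc y hy), b8 (hc y hy), a4, a5, a6, a7, a8]
  simp only [ku, kv]
  clear * - hz
  generalize A.coeffs hA = a
  change _ = _
  have fl : (S.fst.coeffs hS.1).lead = toAlg S.fst.lead hS.1.1 := rfl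
  have gl : (S.snd.coeffs hS.2).lead = toAlg S.snd.lead hS.2.1 := rfl
  rw [fl, gl]
  generalize (toAlg S.fst.lead hS.1.1 : smoothAlg V) = p
  generalize (toAlg S.snd.lead hS.2.1 : smoothAlg V) = q
  simp only [AlgCurrent.miura, extend_eq_evalAt _ hz, map_add, map_sub, map_mul]
  ring

/-- The Miura correction `ε² ∂ₓ(f u_x + g v_x)` is thus `ε` times the rate of a first order current,
so the linearization results for currents apply to it. -/
theorem firstOrderCurrent_rate (f g : ℝ × ℝ → ℝ) (ε : ℝ) (a b : ℝ → ℝ) (x : ℝ) :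
    (firstOrderCurrent f g).rate ε a b x
      = ε * deriv (fun y => f (a y, b y) * deriv a y + g (a y, b y) * deriv b y) x := by
  have : (firstOrderCurrent f g).eval ε a b
      = fun y => ε * (f (a y, b y) * deriv a y + g (a y, b y) * deriv b y) := by
    funext y
    simp [Current.eval, firstOrderCurrent]
  rw [← deriv_const_mul_field, ← this]
  rfl

theorem hasDerivAt_miura_term {S : System} {f g : ℝ × ℝ → ℝ} (hU : IsOpen U) (hO : IsOpen O)
    (hS : S.SmoothOn U) (hf : ContDiffOn ℝ ∞ f U) (hg : ContDiffOn ℝ ∞ g U)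
    (hu : ContDiffOn ℝ ∞ u O) (hv : ContDiffOn ℝ ∞ v O) (hc : ∀ y ∈ O, (u y, v y) ∈ U)
    (ε : ℝ) {x : ℝ} (hx : x ∈ O) :
    HasDerivAt (fun s : ℝ => ε ^ 2 * deriv (fun y =>
      f ((u + s • S.fst.rate ε u v) y, (v + s • S.snd.rate ε u v) y)
        * deriv (u + s • S.fst.rate ε u v) y
      + g ((u + s • S.fst.rate ε u v) y, (v + s • S.snd.rate ε u v) y)
        * deriv (v + s • S.snd.rate ε u v) y) x)
      (ε * deriv ((firstOrderCurrent f g).lin ε u v (S.fst.rate ε u v) (S.snd.rate ε u v)) x) 0 := by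
  have h := (Current.hasDerivAt_rate hU hO (firstOrderCurrent_smoothOn hf hg) hu hv
    hc (S.fst.smoothOn_rate hO hS.1 hu hv hc ε) (S.snd.smoothOn_rate hO hS.2 hu hv hc ε)
    ε hx).const_mul ε
  refine h.congr_of_eventuallyEq (Filter.Eventually.of_forall fun s => ?_)
  simp only [firstOrderCurrent_rate]
  ring

/-- A Miura transformation carries a system to the system with the transformed coefficients. -/
theorem miura_transforms {S S' : System} (hS : S.SmoothOn V) (h1 : S.fst.NoFirstOrder V)
    (h2 : S.snd.NoFirstOrder V) (hUo : IsOpen U) (hU : U ⊆ V) (X₁ X₂ Y₁ Y₂ : smoothAlg V)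
    (hB₁ : S'.fst.HasCoeffsOn ((S.fst.coeffs hS.1).miura (algU V) (algV V)
      (S.fst.coeffs hS.1).lead (S.snd.coeffs hS.2).lead X₁ X₂ X₁ X₂ Y₁ Y₂) U)
    (hB₂ : S'.snd.HasCoeffsOn ((S.snd.coeffs hS.2).miura (algU V) (algV V)
      (S.fst.coeffs hS.1).lead (S.snd.coeffs hS.2).lead Y₁ Y₂ X₁ X₂ Y₁ Y₂) U) :
    (Miura.mk (extend X₁) (extend X₂) (extend Y₁) (extend Y₂)).Transforms S S' U := by
  intro u v hu hv x hx
  have hSU : S.SmoothOn U := ⟨hS.1.mono hU, hS.2.mono hU⟩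
  have sm := fun Z : smoothAlg V => (smoothOn_extend Z).mono hU
  set O : Set ℝ := {y | (u y, v y) ∈ U} with hOdef
  have hO : IsOpen O := hUo.preimage (hu.continuous.prodMk hv.continuous)
  have hc : ∀ y ∈ O, (u y, v y) ∈ U := fun y hy => hy
  have hu' := hu.contDiffOn (s := O)
  have hv' := hv.contDiffOn (s := O)
  have lead_eq : ∀ {A B : Current} (hA : A.SmoothOn V) {Z₁ Z₂ : smoothAlg V},
      B.HasCoeffsOn ((A.coeffs hA).miura (algU V) (algV V) (S.fst.coeffs hS.1).lead
        (S.snd.coeffs hS.2).lead Z₁ Z₂ X₁ X₂ Y₁ Y₂) U → Set.EqOn A.lead B.lead U := by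
    intro A B hA Z₁ Z₂ h z hz
    rw [h.2.2.1 hz]
    exact (extend_toAlg hA.1 (hU hz)).symm
  have term := fun (Z₁ Z₂ : smoothAlg V) (ε : ℝ) => hasDerivAt_miura_term hUo hO hSU (sm Z₁) (sm Z₂)
    hu' hv' hc ε (show x ∈ O from hx)
  have q1 := miura_quad hS hS.1 hUo hU X₁ X₂ X₁ X₂ Y₁ Y₂ hB₁ hO hu' hv' hc
  have q2 := miura_quad hS hS.2 hUo hU Y₁ Y₂ X₁ X₂ Y₁ Y₂ hB₂ hO hu' hv' hc
  set β : Miura := ⟨extend X₁, extend X₂, extend Y₁, extend Y₂⟩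
  have hβ : β.SmoothOn U := ⟨sm X₁, sm X₂, sm Y₁, sm Y₂⟩
  have c1 := miura_component (β := β) hUo hO hSU hβ hSU.1 (hB₁.smoothOn hU) hB₁.1 hB₁.2.1
      (fun z hz => h1 z (hU hz)) (sm X₁) (sm X₂) hu' hv' hc (lead_eq hS.1 hB₁) rfl rfl q1 hx
  have c2 := miura_component (β := β) hUo hO hSU hβ hSU.2 (hB₂.smoothOn hU) hB₂.1 hB₂.2.1
      (fun z hz => h2 z (hU hz)) (sm Y₁) (sm Y₂) hu' hv' hc (lead_eq hS.2 hB₂) rfl rfl q2 hx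
  have m1 : ∀ ε, S.derivAlong ε (β.mapU ε) u v x = S.fst.rate ε u v x
      + ε * deriv ((firstOrderCurrent (extend X₁) (extend X₂)).lin ε u v (S.fst.rate ε u v)
        (S.snd.rate ε u v)) x := fun ε =>
    ((hasDerivAt_affine (u x) (S.fst.rate ε u v x) 0).add (term X₁ X₂ ε)).deriv
  have m2 : ∀ ε, S.derivAlong ε (β.mapV ε) u v x = S.snd.rate ε u v x
      + ε * deriv ((firstOrderCurrent (extend Y₁) (extend Y₂)).lin ε u v (S.fst.rate ε u v)
        (S.snd.rate ε u v)) x := fun ε =>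
    ((hasDerivAt_affine (v x) (S.snd.rate ε u v x) 0).add (term Y₁ Y₂ ε)).deriv
  simp only [m1, m2]
  exact ⟨c1, c2⟩

end MiuraCoefficients

/-! ### The ring of smooth functions on a subset of the half plane -/

section HalfPlane

theorem smoothOn_fst_rpow {V : Set (ℝ × ℝ)} (hV : ∀ z ∈ V, 0 < z.1) (c : ℝ) :
    ContDiffOn ℝ ∞ (fun z : ℝ × ℝ => z.1 ^ c) V :=
  contDiff_fst.contDiffOn.rpow_const_of_ne fun z hz => (hV z hz).ne'

variable {V : Opens (ℝ × ℝ)}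

/-- The function `u ^ c`. -/
noncomputable def uPow (hV : ∀ z ∈ V, 0 < z.1) (c : ℝ) : smoothAlg V :=
  toAlg (fun z => z.1 ^ c) (smoothOn_fst_rpow hV c)

/-- The function `v`. -/
noncomputable def coordV (V : Opens (ℝ × ℝ)) : smoothAlg V :=
  toAlg (fun z => z.2) contDiff_snd.contDiffOn

variable (hV : ∀ z ∈ V, 0 < z.1)

theorem evalAt_uPow (c : ℝ) (z : V) : evalAt z (uPow hV c) = z.1.1 ^ c := rfl

theorem uPow_mul (a b : ℝ) : uPow hV a * uPow hV b = uPow hV (a + b) :=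
  eq_of_evalAt fun z => by
    rw [map_mul, evalAt_uPow, evalAt_uPow, evalAt_uPow, Real.rpow_add (hV z z.2)]

theorem uPow_zero : uPow hV 0 = 1 := eq_of_evalAt fun z => by
  rw [evalAt_uPow, Real.rpow_zero, map_one]

theorem algU_uPow (c : ℝ) : algU V (uPow hV c) = cst _ c * uPow hV (c - 1) := by
  rw [uPow, algU_toAlg]
  refine eq_of_evalAt fun z => ?_
  rw [map_mul, algHom_cst, evalAt_uPow, evalAt_toAlg]
  exact (Real.hasDerivAt_rpow_const (Or.inl (hV z z.2).ne')).deriv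

theorem algV_uPow (c : ℝ) : algV V (uPow hV c) = 0 := by
  rw [uPow, algV_toAlg]
  refine eq_of_evalAt fun z => ?_
  rw [evalAt_toAlg, map_zero]
  simp [pdv]

theorem algU_coordV : algU V (coordV V) = 0 := by
  rw [coordV, algU_toAlg]
  refine eq_of_evalAt fun z => ?_
  rw [evalAt_toAlg, map_zero]
  simp [pdu]

theorem algV_coordV : algV V (coordV V) = 1 := by
  rw [coordV, algV_toAlg]
  refine eq_of_evalAt fun z => ?_
  rw [evalAt_toAlg, map_one]
  simp [pdv]

/-- The function `w = 4 m² u ^ (2m - 2)`. -/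
noncomputable def waveSpeed (m : ℝ) : smoothAlg V := cst _ (4 * m ^ 2) * uPow hV (2 * m - 2)

/-- The inverse of `waveSpeed`. -/
noncomputable def waveSpeedInv (m : ℝ) : smoothAlg V :=
  cst _ (1 / (4 * m ^ 2)) * uPow hV (-(2 * m - 2))

/-- The function `4m²/(2m-1) u ^ (2m - 1)`. -/
noncomputable def sndLead (m : ℝ) : smoothAlg V :=
  cst _ (4 * m ^ 2 / (2 * m - 1)) * uPow hV (2 * m - 1)

theorem isDihedralRing {m : ℝ} (hm : m ≠ 0) :
    IsDihedralRing (algU V) (algV V) m (uPow hV 1) (uPow hV (-1)) (waveSpeed hV m)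
      (waveSpeedInv hV m) where
  comm f := (algV_algU_comm f).symm
  u_inv := by rw [uPow_mul, add_neg_cancel, uPow_zero]
  w_inv := eq_of_evalAt fun z => by
    have h : z.1.1 ^ (2 * m - 2) ≠ 0 := (Real.rpow_pos_of_pos (hV z z.2) _).ne'
    simp only [waveSpeed, waveSpeedInv, map_mul, algHom_cst, evalAt_uPow, map_one,
      Real.rpow_neg (hV z z.2).le]
    generalize z.1.1 ^ (2 * m - 2) = r at h
    field_simp
  du_u := by rw [algU_uPow, sub_self, uPow_zero, cst, map_one, one_mul]
  dv_u := algV_uPow hV 1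
  du_w := by
    rw [waveSpeed, Derivation.leibniz, derivation_cst, algU_uPow, sub_eq_add_neg (2 * m - 2) 1,
      ← uPow_mul]
    simp only [smul_eq_mul]
    ring
  dv_w := by
    rw [waveSpeed, Derivation.leibniz, derivation_cst, algV_uPow]
    simp
  ext _ _ := eq_of_algHom

theorem algU_sndLead {m : ℝ} (hm : 2 * m - 1 ≠ 0) : algU V (sndLead hV m) = waveSpeed hV m := by
  rw [sndLead, Derivation.leibniz, derivation_cst, algU_uPow, waveSpeed]
  refine eq_of_evalAt fun z => ?_
  simp only [smul_eq_mul, mul_zero, add_zero, map_mul, algHom_cst, evalAt_uPow]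
  rw [show 2 * m - 1 - 1 = 2 * m - 2 by ring, ← mul_assoc, div_mul_cancel₀ _ hm]

theorem algV_sndLead (m : ℝ) : algV V (sndLead hV m) = 0 := by
  rw [sndLead, Derivation.leibniz, derivation_cst, algV_uPow]
  simp

/-! ### The coefficients of the normal form -/

theorem hasDerivAt_extend_fst (f : smoothAlg V) (z : V) :
    HasDerivAt (fun s => extend f (s, z.1.2)) (evalAt z (algU V f)) z.1.1 :=
  hasDerivAt_pdu V.2 (smoothOn_extend f) z.2

theorem hasDerivAt_extend_snd (f : smoothAlg V) (z : V) :
    HasDerivAt (fun s => extend f (z.1.1, s)) (evalAt z (algV V f)) z.1.2 :=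
  hasDerivAt_pdv V.2 (smoothOn_extend f) z.2

/-- The two hypotheses on `G` determine `G_u` and `G_v` on `U` through `b` and `a`, and hence `G_uv`
and `G_vv`. The equations for `a_u` and `b_u` then turn the printed coefficients into those written
in terms of `a` and `b` alone. -/
theorem normalForm_hasCoeffsOn {m : ℝ} (hm0 : m ≠ 0) (hm1 : m ≠ 1) {a b : smoothAlg V}
    (ha : algU V a = waveSpeed hV m * algV V b + cst _ (2 * m - 3) * (a * uPow hV (-1)))
    (hb : algU V b = algV V a + cst _ (m - 2) * (b * uPow hV (-1)))
    {U : Set (ℝ × ℝ)} (hUo : IsOpen U) (hU : U ⊆ V) {G : ℝ × ℝ → ℝ}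
    (hGa : Set.EqOn (a23 m G) (extend a) U) (hGb : Set.EqOn (a24 m G) (extend b) U) :
    (normalForm m G).fst.HasCoeffsOn (normalFst (algU V) (algV V) m (uPow hV (-1))
      (waveSpeedInv hV m) (coordV V) a b) U ∧
    (normalForm m G).snd.HasCoeffsOn (normalSnd (algV V) m (uPow hV (-1)) (waveSpeed hV m)
      (waveSpeedInv hV m) (sndLead hV m) a b) U := by
  have hm1' : m - 1 ≠ 0 := sub_ne_zero.2 hm1
  have hGv : Set.EqOn (pdv G) (fun z => -2 * extend a z * z.1 ^ (3 - 2 * m)) U := fun z hz => by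
    have hp := hV z (hU hz)
    have : z.1 ^ (2 * m - 3) ≠ 0 := (Real.rpow_pos_of_pos hp _).ne'
    simp only [← hGa hz, a23]
    rw [show 3 - 2 * m = -(2 * m - 3) by ring, Real.rpow_neg hp.le]
    field_simp
  have hGu : Set.EqOn (pdu G) (fun z => -(8 * m ^ 2) * z.1 * extend b z) U := fun z hz => by
    have hp := (hV z (hU hz)).ne'
    simp only [← hGb hz, a24]
    field_simp
  -- All real powers involving `m` are expressed through `r = u^(2m-3)` and integer powers of `u`,
  -- so that the identities become rational.
  have hrpow : ∀ z ∈ U, ∃ r ≠ 0, z.1 ^ (2 * m - 3) = r ∧ z.1 ^ (2 * m - 4) = r / z.1 ∧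
      z.1 ^ (2 * m) = r * (z.1 * z.1 * z.1) ∧ z.1 ^ (-2 * m + 2) = (r * z.1)⁻¹ ∧ z.1 ^ (3 - 2 * m) = r⁻¹ ∧
      z.1 ^ (2 * m - 2) = r * z.1 ∧ z.1 ^ (3 - 2 * m - 1) = r⁻¹ / z.1 := fun z hz => by
    have hp := hV z (hU hz)
    refine ⟨z.1 ^ (2 * m - 3), (Real.rpow_pos_of_pos hp _).ne', rfl, ?_, ?_, ?_, ?_, ?_, ?_⟩
    · rw [← Real.rpow_sub_one hp.ne']; ring_nf
    · rw [← mul_assoc, ← mul_assoc, ← Real.rpow_add_one hp.ne', ← Real.rpow_add_one hp.ne',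
        ← Real.rpow_add_one hp.ne']
      ring_nf
    · rw [← Real.rpow_add_one hp.ne', ← Real.rpow_neg hp.le]; ring_nf
    · rw [← Real.rpow_neg hp.le]; ring_nf
    · rw [← Real.rpow_add_one hp.ne']; ring_nf
    · rw [← Real.rpow_neg hp.le, ← Real.rpow_sub_one hp.ne']; ring_nf
  have hvv : ∀ (z : ℝ × ℝ) (hz : z ∈ U), pdv (pdv G) z
      = -2 * evalAt ⟨z, hU hz⟩ (algV V a) * z.1 ^ (3 - 2 * m) := fun z hz => by
    rw [pdv_congr hUo hGv hz]
    exact (((hasDerivAt_extend_snd a ⟨z, hU hz⟩).const_mul (-2)).mul_const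
      (z.1 ^ (3 - 2 * m))).deriv
  have huv : ∀ (z : ℝ × ℝ) (hz : z ∈ U), pdu (pdv G) z
      = -2 * evalAt ⟨z, hU hz⟩ (algU V a) * z.1 ^ (3 - 2 * m)
        + -2 * evalAt ⟨z, hU hz⟩ a * ((3 - 2 * m) * z.1 ^ (3 - 2 * m - 1)) := fun z hz => by
    rw [pdu_congr hUo hGv hz, ← extend_eq_evalAt a (hU hz)]
    exact (((hasDerivAt_extend_fst a ⟨z, hU hz⟩).const_mul (-2)).mul
      (Real.hasDerivAt_rpow_const (Or.inl (hV z (hU hz)).ne'))).deriv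
  have ka : ∀ (z : ℝ × ℝ) (hz : z ∈ U), _ := fun z hz => congrArg (evalAt ⟨z, hU hz⟩) ha
  have kb : ∀ (z : ℝ × ℝ) (hz : z ∈ U), _ := fun z hz => congrArg (evalAt ⟨z, hU hz⟩) hb
  have ea : ∀ (z : ℝ × ℝ) (hz : z ∈ U), extend a z = evalAt ⟨z, hU hz⟩ a := fun z hz =>
    extend_eq_evalAt a (hU hz)
  have eb : ∀ (z : ℝ × ℝ) (hz : z ∈ U), extend b z = evalAt ⟨z, hU hz⟩ b := fun z hz =>
    extend_eq_evalAt b (hU hz)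
  have h25 : Set.EqOn (a25 m G) (extend (normalCoeff (algV V) m (uPow hV (-1)) (waveSpeed hV m)
      a b)) U := fun z hz => by
    obtain ⟨r, hr, r1, r2, r3, r4, r5, r6, r7⟩ := hrpow z hz
    have hp := (hV z (hU hz)).ne'
    have ka := ka z hz
    simp only [waveSpeed, map_add, map_mul, algHom_cst, evalAt_uPow, Real.rpow_neg_one, r6] at ka
    simp only [a25]
    rw [huv z hz, hGv hz, extend_eq_evalAt _ (hU hz)]
    simp only [normalCoeff, waveSpeed, map_sub, map_mul, algHom_cst, evalAt_uPow,
      Real.rpow_neg_one, ka, ea z hz, r1, r2, r5, r6, r7]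
    field_simp
    ring
  have hzero : Set.EqOn (0 : ℝ × ℝ → ℝ) (extend (0 : smoothAlg V)) U := fun z hz => by
    rw [extend_eq_evalAt _ (hU hz), map_zero]; rfl
  refine ⟨⟨rfl, rfl, ?_, hzero, hzero, ?_, ?_, ?_⟩, rfl, rfl, ?_, hGa, hGb, h25, ?_, hzero⟩
  · exact fun z hz => (extend_toAlg (contDiff_snd.contDiffOn) (hU hz)).symm
  · intro z hz
    obtain ⟨r, hr, r1, r2, r3, r4, r5, r6, r7⟩ := hrpow z hz
    have hp := (hV z (hU hz)).ne'
    have kb := kb z hz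
    simp only [map_add, map_mul, algHom_cst, evalAt_uPow, Real.rpow_neg_one] at kb
    simp only [normalForm, a15]
    rw [hvv z hz, hGu hz, extend_eq_evalAt _ (hU hz)]
    simp only [normalFst, map_add, map_sub, map_neg, map_mul, algHom_cst, evalAt_uPow,
      Real.rpow_neg_one, kb, eb z hz, r1, r5]
    field_simp
    ring
  · intro z hz
    obtain ⟨r, hr, r1, r2, r3, r4, r5, r6, r7⟩ := hrpow z hz
    have hp := (hV z (hU hz)).ne'
    have kb := kb z hz
    simp only [map_add, map_mul, algHom_cst, evalAt_uPow, Real.rpow_neg_one] at kb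
    simp only [normalForm, a16]
    rw [hvv z hz, hGu hz, extend_eq_evalAt _ (hU hz)]
    simp only [normalFst, waveSpeedInv, map_add, map_mul, algHom_cst, evalAt_uPow,
      Real.rpow_one, kb, eb z hz, r3, r5, Real.rpow_neg (hV z (hU hz)).le, r6]
    field_simp
    ring
  · intro z hz
    obtain ⟨r, hr, r1, r2, r3, r4, r5, r6, r7⟩ := hrpow z hz
    have hp := (hV z (hU hz)).ne'
    have ka := ka z hz
    simp only [waveSpeed, map_add, map_mul, algHom_cst, evalAt_uPow, Real.rpow_neg_one, r6] at ka
    simp only [normalForm, a17]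
    rw [huv z hz, extend_eq_evalAt _ (hU hz)]
    simp only [normalFst, map_neg, map_mul, algHom_cst, ka, r5, r7]
    field_simp
    ring
  · exact fun z hz => (extend_toAlg (contDiffOn_const.mul (smoothOn_fst_rpow hV _)) (hU hz)).symm
  · intro z hz
    obtain ⟨r, hr, r1, r2, r3, r4, r5, r6, r7⟩ := hrpow z hz
    have hp := (hV z (hU hz)).ne'
    simp only [normalForm]
    rw [h25 hz, extend_eq_evalAt _ (hU hz), extend_eq_evalAt _ (hU hz)]
    simp only [normalSnd, waveSpeedInv, map_neg, map_mul, algHom_cst, evalAt_uPow, r4,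
      Real.rpow_neg (hV z (hU hz)).le, r6]
    field_simp

/-- The coefficients `a23`, `a24` given by a solution of the wave equation. -/
theorem normal_equations_of_wave {m : ℝ} (hm0 : m ≠ 0) {g : smoothAlg V}
    (hg : algU V (algU V g) = cst _ (m - 1) * (uPow hV (-1) * algU V g)
      + waveSpeed hV m * algV V (algV V g)) {a b : smoothAlg V}
    (ha : a = -(cst _ (1 / 2) * (algV V g * uPow hV (2 * m - 3))))
    (hb : b = -(cst _ (1 / (8 * m ^ 2)) * (algU V g * uPow hV (-1)))) :
    algU V a = waveSpeed hV m * algV V b + cst _ (2 * m - 3) * (a * uPow hV (-1)) ∧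
    algU V b = algV V a + cst _ (m - 2) * (b * uPow hV (-1)) := by
  subst ha hb
  simp only [map_neg, Derivation.leibniz, derivation_cst, algU_uPow, algV_uPow, smul_eq_mul,
    mul_zero, add_zero, zero_add, hg, algV_algU_comm]
  constructor <;> refine eq_of_evalAt fun z => ?_ <;> have hp := hV z z.2
  · have r1 : z.1.1 ^ (2 * m - 3 - 1) = z.1.1 ^ (2 * m - 3) / z.1.1 := Real.rpow_sub_one hp.ne' _
    have r2 : z.1.1 ^ (2 * m - 2) = z.1.1 ^ (2 * m - 3) * z.1.1 := by
      rw [← Real.rpow_add_one hp.ne']; ring_nf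
    simp only [waveSpeed, map_add, map_neg, map_mul, algHom_cst, evalAt_uPow,
      Real.rpow_neg_one, r1, r2]
    field_simp
    ring
  · have r1 : z.1.1 ^ (-1 - 1 : ℝ) = (z.1.1)⁻¹ / z.1.1 := by
      rw [Real.rpow_sub_one hp.ne', Real.rpow_neg_one]
    have r2 : z.1.1 ^ (2 * m - 2) = z.1.1 ^ (2 * m - 3) * z.1.1 := by
      rw [← Real.rpow_add_one hp.ne']; ring_nf
    simp only [waveSpeed, map_add, map_neg, map_mul, algHom_cst, evalAt_uPow,
      Real.rpow_neg_one, r1, r2]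
    field_simp
    ring

end HalfPlane

/-! ### Riemann invariants -/

/-- The Riemann invariant `v + κ u ^ m`. -/
noncomputable def riemannInv (m κ : ℝ) (z : ℝ × ℝ) : ℝ := z.2 + κ * z.1 ^ m

theorem riemannPlus_eq (m : ℝ) : riemannPlus m = riemannInv m 2 := rfl

theorem riemannMinus_eq (m : ℝ) : riemannMinus m = riemannInv m (-2) := by
  funext z
  simp [riemannMinus, riemannInv]
  ring

/-- For fixed `u` the map `r ↦ (u, r - κ u^m)` is a continuous section, so nearby values are
attained as well. Openness gives meaning to derivatives of functions that are smooth on the image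
only. -/
theorem isOpen_image_riemannInv (m κ : ℝ) {V : Set (ℝ × ℝ)} (hV : IsOpen V) :
    IsOpen (riemannInv m κ '' V) := by
  rw [isOpen_iff_mem_nhds]
  rintro _ ⟨z, hz, rfl⟩
  have hcont : Continuous fun r : ℝ => (z.1, r - κ * z.1 ^ m) := by fun_prop
  have : (fun r : ℝ => (z.1, r - κ * z.1 ^ m)) ⁻¹' V ∈ 𝓝 (riemannInv m κ z) :=
    (hV.preimage hcont).mem_nhds (by simpa [riemannInv] using hz)
  filter_upwards [this] with r hr
  exact ⟨_, hr, by simp [riemannInv]⟩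

section RiemannInvariants

theorem smoothOn_riemannInv {V : Set (ℝ × ℝ)} (hV : ∀ z ∈ V, 0 < z.1) (m κ : ℝ) :
    ContDiffOn ℝ ∞ (riemannInv m κ) V :=
  contDiff_snd.contDiffOn.add (contDiffOn_const.mul (smoothOn_fst_rpow hV m))

theorem smoothOn_comp_riemannInv {V : Set (ℝ × ℝ)} (hV : ∀ z ∈ V, 0 < z.1) {m κ : ℝ} {F : ℝ → ℝ}
    (hF : ContDiffOn ℝ ∞ F (riemannInv m κ '' V)) : ContDiffOn ℝ ∞ (F ∘ riemannInv m κ) V :=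
  hF.comp (smoothOn_riemannInv hV m κ) (Set.mapsTo_image _ _)

variable {V : Opens (ℝ × ℝ)} (hV : ∀ z ∈ V, 0 < z.1) {m κ : ℝ} {F : ℝ → ℝ}

/-- The function `F(v + κ u ^ m)`. -/
noncomputable def riemannComp (hF : ContDiffOn ℝ ∞ F (riemannInv m κ '' V)) : smoothAlg V :=
  toAlg (F ∘ riemannInv m κ) (smoothOn_comp_riemannInv hV hF)

theorem smoothOn_deriv_image (hF : ContDiffOn ℝ ∞ F (riemannInv m κ '' V)) :
    ContDiffOn ℝ ∞ (deriv F) (riemannInv m κ '' V) :=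
  smoothOn_deriv (isOpen_image_riemannInv m κ V.2) hF

theorem algV_riemannComp (hF : ContDiffOn ℝ ∞ F (riemannInv m κ '' V)) :
    algV V (riemannComp hV hF) = riemannComp hV (smoothOn_deriv_image hF) := by
  rw [riemannComp, algV_toAlg]
  refine eq_of_evalAt fun z => ?_
  have hR : HasDerivAt (fun s => riemannInv m κ (z.1.1, s)) 1 z.1.2 :=
    (hasDerivAt_id z.1.2).add_const (κ * z.1.1 ^ m)
  have h := hasDerivAt_of_smoothOn (isOpen_image_riemannInv m κ V.2) hF ⟨z.1, z.2, rfl⟩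
  refine (HasDerivAt.comp (h₂ := F) z.1.2 h hR).deriv.trans ?_
  rw [mul_one]
  rfl

theorem algU_riemannComp (hF : ContDiffOn ℝ ∞ F (riemannInv m κ '' V)) :
    algU V (riemannComp hV hF)
      = cst _ (κ * m) * (uPow hV (m - 1) * riemannComp hV (smoothOn_deriv_image hF)) := by
  rw [riemannComp, algU_toAlg]
  refine eq_of_evalAt fun z => ?_
  have hR : HasDerivAt (fun s => riemannInv m κ (s, z.1.2)) (κ * (m * z.1.1 ^ (m - 1))) z.1.1 :=
    ((Real.hasDerivAt_rpow_const (Or.inl (hV z z.2).ne')).const_mul κ).const_add _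
  have h := hasDerivAt_of_smoothOn (isOpen_image_riemannInv m κ V.2) hF ⟨z.1, z.2, rfl⟩
  refine (HasDerivAt.comp (h₂ := F) z.1.1 h hR).deriv.trans ?_
  rw [map_mul, map_mul, algHom_cst, evalAt_uPow, riemannComp, evalAt_toAlg]
  simp only [Function.comp_apply]
  ring

/-- Two `u`-derivatives of `F(v + κ u^m)` produce `κ² m² u^(2m-2) F''`, which is `w F''` precisely
because `κ² = 4`, together with the term from differentiating `u^(m-1)`. By linearity the equation
holds for `F₁(v + 2u^m) + F₂(v - 2u^m)`. -/
theorem riemannComp_wave (hF : ContDiffOn ℝ ∞ F (riemannInv m κ '' V)) (hκ : κ ^ 2 = 4) :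
    algU V (algU V (riemannComp hV hF))
      = cst _ (m - 1) * (uPow hV (-1) * algU V (riemannComp hV hF))
        + waveSpeed hV m * algV V (algV V (riemannComp hV hF)) := by
  have h1 := algU_riemannComp hV hF
  have h2 := algU_riemannComp hV (smoothOn_deriv_image hF)
  simp only [h1, h2, algV_riemannComp, Derivation.leibniz, derivation_cst, algU_uPow, smul_eq_mul]
  refine eq_of_evalAt fun z => ?_
  have hp := hV z z.2
  have r1 : z.1.1 ^ (m - 1 - 1) = z.1.1 ^ (m - 1) / z.1.1 := Real.rpow_sub_one hp.ne' _
  have r2 : z.1.1 ^ (2 * m - 2) = z.1.1 ^ (m - 1) * z.1.1 ^ (m - 1) := by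
    rw [← Real.rpow_add hp]; ring_nf
  simp only [waveSpeed, map_add, map_mul, map_zero, algHom_cst, evalAt_uPow, Real.rpow_neg_one, r1,
    r2, ← hκ]
  field_simp
  ring

end RiemannInvariants

/-! ### The normal forms are integrable -/

section NormalForm

variable {V : Opens (ℝ × ℝ)}

theorem Current.HasCoeffsOn.coeffs_eq {B : Current} {K : AlgCurrent (smoothAlg V)}
    (h : B.HasCoeffsOn K V) (hB : B.SmoothOn V) : B.coeffs hB = K := by
  obtain ⟨-, -, h3, h4, h5, h6, h7, h8⟩ := h
  have e := fun {f : ℝ × ℝ → ℝ} {k : smoothAlg V} (hf : ContDiffOn ℝ ∞ f V)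
    (hk : Set.EqOn f (extend k) V) =>
    (toAlg_congr hf (smoothOn_extend k) hk).trans (toAlg_extend k)
  obtain ⟨b1, -, -, b4, b5, b6, b7, b8⟩ := id hB
  exact AlgCurrent.ext (e b1 h3) (e b4 h4) (e b5 h5) (e b6 h6) (e b7 h7) (e b8 h8)

theorem Current.HasCoeffsOn.noFirstOrder {B : Current} {K : AlgCurrent (smoothAlg V)}
    {U : Set (ℝ × ℝ)} (h : B.HasCoeffsOn K U) : B.NoFirstOrder U := fun z _ => by
  rw [h.1, h.2.1]
  exact ⟨rfl, rfl⟩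

/-- A current with given coefficients. -/
noncomputable def AlgCurrent.toCurrent (K : AlgCurrent (smoothAlg V)) (p : ℝ × ℝ → ℝ) :
    Current where
  lead := p
  ux := 0
  vx := 0
  uxx := extend K.uxx
  vxx := extend K.vxx
  uxux := extend K.uxux
  vxvx := extend K.vxvx
  uxvx := extend K.uxvx

theorem AlgCurrent.toCurrent_hasCoeffsOn (K : AlgCurrent (smoothAlg V)) {p : ℝ × ℝ → ℝ}
    (hp : ContDiffOn ℝ ∞ p V) (hK : K.lead = toAlg p hp) : (K.toCurrent p).HasCoeffsOn K V :=
  ⟨rfl, rfl, hK ▸ (extend_toAlg hp).symm, fun _ _ => rfl, fun _ _ => rfl, fun _ _ => rfl,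
    fun _ _ => rfl, fun _ _ => rfl⟩

variable (hV : ∀ z ∈ V, 0 < z.1) {m : ℝ}

theorem toAlg_potential {F₁ F₂ : ℝ → ℝ} (h1 : ContDiffOn ℝ ∞ F₁ (riemannInv m 2 '' V))
    (h2 : ContDiffOn ℝ ∞ F₂ (riemannInv m (-2) '' V)) :
    ∃ sG : ContDiffOn ℝ ∞ (potential m F₁ F₂) V,
      (toAlg (potential m F₁ F₂) sG : smoothAlg V) = riemannComp hV h1 + riemannComp hV h2 := by
  have hG : potential m F₁ F₂ = F₁ ∘ riemannInv m 2 + F₂ ∘ riemannInv m (-2) := by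
    funext z
    simp [potential, riemannPlus_eq, riemannMinus_eq]
  refine ⟨hG ▸ (smoothOn_comp_riemannInv hV h1).add (smoothOn_comp_riemannInv hV h2),
    eq_of_evalAt fun z => ?_⟩
  rw [map_add, evalAt_toAlg, hG]
  rfl

theorem exists_normal_coeffs (hm0 : m ≠ 0) (hm1 : m ≠ 1) {F₁ F₂ : ℝ → ℝ}
    (h1 : ContDiffOn ℝ ∞ F₁ (riemannInv m 2 '' V))
    (h2 : ContDiffOn ℝ ∞ F₂ (riemannInv m (-2) '' V)) :
    ∃ a b : smoothAlg V,
      algU V a = waveSpeed hV m * algV V b + cst _ (2 * m - 3) * (a * uPow hV (-1)) ∧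
      algU V b = algV V a + cst _ (m - 2) * (b * uPow hV (-1)) ∧
      (normalForm m (potential m F₁ F₂)).fst.HasCoeffsOn (normalFst (algU V) (algV V) m
        (uPow hV (-1)) (waveSpeedInv hV m) (coordV V) a b) V ∧
      (normalForm m (potential m F₁ F₂)).snd.HasCoeffsOn (normalSnd (algV V) m (uPow hV (-1))
        (waveSpeed hV m) (waveSpeedInv hV m) (sndLead hV m) a b) V := by
  obtain ⟨sG, hg⟩ := toAlg_potential hV h1 h2
  obtain ⟨ha, hb⟩ := normal_equations_of_wave hV hm0 (g := toAlg (potential m F₁ F₂) sG) (by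
    rw [hg, map_add, map_add, map_add, map_add, riemannComp_wave hV h1 (by norm_num),
      riemannComp_wave hV h2 (by norm_num)]
    ring) rfl rfl
  refine ⟨_, _, ha, hb, normalForm_hasCoeffsOn hV hm0 hm1 ha hb V.2 subset_rfl ?_ ?_⟩
  · intro z hz
    rw [extend_eq_evalAt _ hz]
    simp only [map_neg, map_mul, algHom_cst, evalAt_uPow, algV_toAlg, evalAt_toAlg, a23]
    ring
  · intro z hz
    rw [extend_eq_evalAt _ hz]
    simp only [map_neg, map_mul, algHom_cst, evalAt_uPow, algU_toAlg, evalAt_toAlg, a24,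
      Real.rpow_neg_one]
    ring

theorem isSecondOrderDeformation_normalForm {D : Set (ℝ × ℝ)} {F : ℝ × ℝ → ℝ}
    (h : (normalForm m F).SmoothOn D) : IsSecondOrderDeformation m D (normalForm m F) :=
  ⟨h, fun _ _ => ⟨rfl, rfl, rfl, rfl, rfl, rfl⟩⟩

/-- The dispersionless symmetries in terms of the linear system for their currents. -/
theorem symmetry_equations (hm : 2 * m - 1 ≠ 0) {S : System} (hS : S.SmoothOn V)
    (hl1 : (S.fst.coeffs hS.1).lead = coordV V) (hl2 : (S.snd.coeffs hS.2).lead = sndLead hV m)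
    {p q : ℝ × ℝ → ℝ} (hp : ContDiffOn ℝ ∞ p V) (hq : ContDiffOn ℝ ∞ q V) :
    S.DispersionlessSymmetry p q V ↔
      algU V (toAlg q hq) = waveSpeed hV m * algV V (toAlg p hp) ∧
      algV V (toAlg q hq) = algU V (toAlg p hp) := by
  have hT := hydro_smoothOn hp hq
  have p' : ((hydro p q).fst.coeffs hT.1).lead = toAlg p hp := rfl
  have q' : ((hydro p q).snd.coeffs hT.2).lead = toAlg q hq := rfl
  rw [System.dispersionlessSymmetry_iff hS hT]
  simp only [AlgCurrent.flowLead, hl1, hl2, p', q', algU_coordV, algV_coordV, algU_sndLead hV hm,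
    algV_sndLead, mul_zero, zero_mul, zero_add, add_zero, mul_one, one_mul, Prod.mk.injEq]
  constructor
  -- The equations from the second component repeat those of the first, up to a factor `w`.
  · rintro ⟨⟨h1, h2⟩, -⟩
    exact ⟨h1.trans (mul_comm _ _), h2⟩
  · rintro ⟨h1, h2⟩
    rw [h1, h2]
    exact ⟨⟨mul_comm _ _, rfl⟩, mul_comm _ _, rfl⟩

/-- The extension is explicit and has no terms of order `ε`. Everything it needs follows from the
linear system for `(p, q)`: mixed partials of `q` give `p_uu = w p_vv`, and a further `v`-derivative
gives the same equation for `α = p_v`. -/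
theorem normalForm_extends_symmetry (hV : ∀ z ∈ V, 0 < z.1) (hm0 : m ≠ 0) (hm1 : m ≠ 1) (hm : 2 * m - 1 ≠ 0)
    {F₁ F₂ : ℝ → ℝ} (h1 : ContDiffOn ℝ ∞ F₁ (riemannInv m 2 '' V))
    (h2 : ContDiffOn ℝ ∞ F₂ (riemannInv m (-2) '' V)) {p q : ℝ × ℝ → ℝ} (hp : ContDiffOn ℝ ∞ p V)
    (hq : ContDiffOn ℝ ∞ q V)
    (hpq : (normalForm m (potential m F₁ F₂)).DispersionlessSymmetry p q V) :
    ∃ T : System, T.SmoothOn V ∧ T.fst.lead = p ∧ T.snd.lead = q ∧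
      (normalForm m (potential m F₁ F₂)).CommutesToSecondOrder T V := by
  obtain ⟨a, b, ha, hb, k1, k2⟩ := exists_normal_coeffs hV hm0 hm1 h1 h2
  have hS : (normalForm m (potential m F₁ F₂)).SmoothOn V :=
    ⟨k1.smoothOn subset_rfl, k2.smoothOn subset_rfl⟩
  have c1 := k1.coeffs_eq hS.1
  have c2 := k2.coeffs_eq hS.2
  obtain ⟨hqu, hqv⟩ := (symmetry_equations hV hm hS (congrArg AlgCurrent.lead c1)
    (congrArg AlgCurrent.lead c2) hp hq).1 hpq
  have h := isDihedralRing hV hm0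
  have hβu : algU V (algU V (toAlg p hp)) = waveSpeed hV m * algV V (algV V (toAlg p hp)) := by
    rw [← hqv, ← algV_algU_comm, hqu, Derivation.leibniz, h.dv_w]
    simp
  have hα : algU V (algU V (algV V (toAlg p hp)))
      = waveSpeed hV m * algV V (algV V (algV V (toAlg p hp))) := by
    rw [← algV_algU_comm, ← algV_algU_comm, hβu, Derivation.leibniz, h.dv_w]
    simp
  obtain ⟨e1, e2⟩ := normal_flow_symmetry (l₁ := coordV V) (l₂ := sndLead hV m) h hm1 algU_coordV
    algV_coordV (algU_sndLead hV hm) (algV_sndLead hV m) ha hb rfl rfl hqu hqv hβu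
    (algV_algU_comm _) hα
  have t1 := AlgCurrent.toCurrent_hasCoeffsOn (symmetryFst (algU V) (algV V) m (uPow hV 1)
    (uPow hV (-1)) (waveSpeed hV m) (waveSpeedInv hV m) a b (toAlg p hp) (algV V (toAlg p hp)))
    hp rfl
  have t2 := AlgCurrent.toCurrent_hasCoeffsOn (symmetrySnd (algU V) (algV V) m (uPow hV 1)
    (uPow hV (-1)) (waveSpeed hV m) (waveSpeedInv hV m) a b (toAlg q hq) (algV V (toAlg p hp)))
    hq rfl
  have s1 := t1.smoothOn subset_rfl
  have s2 := t2.smoothOn subset_rfl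
  set T₁ := AlgCurrent.toCurrent _ p
  set T₂ := AlgCurrent.toCurrent _ q
  let T : System := ⟨T₁, T₂⟩
  have hT : T.SmoothOn V := ⟨s1, s2⟩
  have d1 : T.fst.coeffs hT.1 = _ := t1.coeffs_eq s1
  have d2 : T.snd.coeffs hT.2 = _ := t2.coeffs_eq s2
  refine ⟨T, hT, rfl, rfl, System.commutesToSecondOrder_of_flow_eq hS hT
    k1.noFirstOrder k2.noFirstOrder t1.noFirstOrder t2.noFirstOrder ?_ ?_ ?_ ?_⟩
  · rw [c1, c2, d1, d2]
    simp only [AlgCurrent.flowLead, normalFst, normalSnd, symmetryFst, symmetrySnd, algU_coordV,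
      algV_coordV, algU_sndLead hV hm, algV_sndLead, hqu, hqv, mul_zero, zero_mul, zero_add,
      add_zero, mul_one, one_mul, mul_comm (waveSpeed hV m)]
  · rw [c1, c2, d1, d2]
    simp only [AlgCurrent.flowLead, normalFst, normalSnd, symmetryFst, symmetrySnd, algU_coordV,
      algV_coordV, algU_sndLead hV hm, algV_sndLead, hqu, hqv, mul_zero, zero_mul, zero_add,
      add_zero, mul_one, mul_comm (waveSpeed hV m)]
  · rw [c1, c2, d1, d2]
    exact e1
  · rw [c1, c2, d1, d2]
    exact e2

end NormalForm

/-! ### Reduction of an integrable deformation to the normal form -/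

section Reduction

variable {V : Opens (ℝ × ℝ)}

/-- Removing `u_xx` and `v_xx` from the first current forces `Y₁` and `Y₂` in terms of `X₁`, `X₂`.
The two remaining conditions then lose all derivatives of `X₁` and `X₂`, and each becomes linear in
one unknown with coefficient `w_u = (2m-2) w/u`, which is invertible since `m ≠ 1`. No differential
equation is solved, so the transformation exists on the whole domain. -/
theorem miura_reduces {R : Type*} [CommRing R] [Algebra ℝ R] {du dv : Derivation ℝ R R} {m : ℝ}
    {u ui w wi : R} (h : IsDihedralRing du dv m u ui w wi) (hm : m ≠ 1) {A₁ A₂ : AlgCurrent R}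
    (h1u : du A₁.lead = 0) (h1v : dv A₁.lead = 1) (h2u : du A₂.lead = w) (h2v : dv A₂.lead = 0) :
    ∃ X₁ X₂ Y₁ Y₂ a₁₅ a₁₆ a₁₇ a b c,
      A₁.miura du dv A₁.lead A₂.lead X₁ X₂ X₁ X₂ Y₁ Y₂ = ⟨A₁.lead, 0, 0, a₁₅, a₁₆, a₁₇⟩ ∧
      A₂.miura du dv A₁.lead A₂.lead Y₁ Y₂ X₁ X₂ Y₁ Y₂ = ⟨A₂.lead, a, b, c, -(wi * c), 0⟩ := by
  have hm' : 2 * m - 2 ≠ 0 := fun h0 => hm (by linarith)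
  obtain ⟨k, hk⟩ : ∃ k : R, cst R (2 * m - 2) * (w * ui) * k = 1 := by
    refine ⟨cst R (1 / (2 * m - 2)) * (wi * u), ?_⟩
    have : cst R (2 * m - 2) * cst R (1 / (2 * m - 2)) = 1 := by
      rw [cst, cst, ← map_mul, mul_one_div_cancel hm', map_one]
    linear_combination this + (cst R (2 * m - 2) * cst R (1 / (2 * m - 2))) *
      (u * ui * h.w_inv + h.u_inv)
  set X₂ := -(k * (A₂.uxvx + du A₁.uxx + w * dv A₁.vxx))
  set X₁ := -(k * (A₂.uxux + w * dv A₁.uxx + cst R (2 * m - 2) * (w * ui) * A₁.vxx + w * A₂.vxvx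
    + w * du A₁.vxx))
  have e2 : cst R (2 * m - 2) * (w * ui) * X₂ = -(A₂.uxvx + du A₁.uxx + w * dv A₁.vxx) := by
    linear_combination -(A₂.uxvx + du A₁.uxx + w * dv A₁.vxx) * hk
  have e1 : cst R (2 * m - 2) * (w * ui) * X₁ = -(A₂.uxux + w * dv A₁.uxx
      + cst R (2 * m - 2) * (w * ui) * A₁.vxx + w * A₂.vxvx + w * du A₁.vxx) := by
    linear_combination -(A₂.uxux + w * dv A₁.uxx
      + cst R (2 * m - 2) * (w * ui) * A₁.vxx + w * A₂.vxvx + w * du A₁.vxx) * hk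
  clear_value X₁ X₂
  refine ⟨X₁, X₂, A₁.uxx + w * X₂, A₁.vxx + X₁, _, _, _, _, _, _,
    AlgCurrent.ext rfl ?_ ?_ rfl rfl rfl, AlgCurrent.ext rfl rfl rfl rfl ?_ ?_⟩
  all_goals
    simp only [AlgCurrent.miura, h1u, h1v, h2u, h2v, h.du_w, h.dv_w, map_add, map_zero,
      Derivation.map_one_eq_zero, Derivation.leibniz, smul_eq_mul]
  · ring
  · ring
  · linear_combination wi * e1 - (A₂.vxvx + du A₁.vxx + du X₁ - w * dv X₂) * h.w_inv
  · linear_combination e2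

/-- The symmetry used for the reduction: `p_u = q_v = v`, `p_v = u` and `q_u = w u`. Constant `α`
would be of no use here: `p = u` and `p = v` give translation in `x` and the system itself. -/
theorem smoothOn_symmetry (hV : ∀ z ∈ V, 0 < z.1) (m : ℝ) :
    ContDiffOn ℝ ∞ (fun z : ℝ × ℝ => z.1 * z.2) V ∧
    ContDiffOn ℝ ∞ (fun z : ℝ × ℝ => 1 / 2 * (z.2 * z.2) + 2 * m * z.1 ^ (2 * m)) V :=
  ⟨contDiff_fst.contDiffOn.mul contDiff_snd.contDiffOn,
    (contDiffOn_const.mul (contDiff_snd.contDiffOn.mul contDiff_snd.contDiffOn)).add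
      (contDiffOn_const.mul (smoothOn_fst_rpow hV _))⟩

theorem exists_miura_normal (hV : ∀ z ∈ V, 0 < z.1) {m : ℝ} (hm0 : m ≠ 0) (hm1 : m ≠ 1)
    (hm : 2 * m - 1 ≠ 0) {S : System} (hS : IsSecondOrderDeformation m V S)
    (hint : S.IntegrableToSecondOrder V) :
    ∃ X₁ X₂ Y₁ Y₂ a b : smoothAlg V,
      algU V a = waveSpeed hV m * algV V b + cst _ (2 * m - 3) * (a * uPow hV (-1)) ∧
      algU V b = algV V a + cst _ (m - 2) * (b * uPow hV (-1)) ∧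
      (S.fst.coeffs hS.1.1).miura (algU V) (algV V) (S.fst.coeffs hS.1.1).lead
        (S.snd.coeffs hS.1.2).lead X₁ X₂ X₁ X₂ Y₁ Y₂
        = normalFst (algU V) (algV V) m (uPow hV (-1)) (waveSpeedInv hV m) (coordV V) a b ∧
      (S.snd.coeffs hS.1.2).miura (algU V) (algV V) (S.fst.coeffs hS.1.1).lead
        (S.snd.coeffs hS.1.2).lead Y₁ Y₂ X₁ X₂ Y₁ Y₂
        = normalSnd (algV V) m (uPow hV (-1)) (waveSpeed hV m) (waveSpeedInv hV m)
          (sndLead hV m) a b := by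
  obtain ⟨hSm, hSD⟩ := hS
  have h := isDihedralRing hV hm0
  have hl1 : (S.fst.coeffs hSm.1).lead = coordV V := eq_of_evalAt fun z => (hSD z z.2).1
  have hl2 : (S.snd.coeffs hSm.2).lead = sndLead hV m := eq_of_evalAt fun z => (hSD z z.2).2.1
  have n1 : S.fst.NoFirstOrder V := fun z hz => ⟨(hSD z hz).2.2.1, (hSD z hz).2.2.2.1⟩
  have n2 : S.snd.NoFirstOrder V := fun z hz => (hSD z hz).2.2.2.2
  obtain ⟨hp, hq⟩ := smoothOn_symmetry hV m
  have ep : (toAlg _ hp : smoothAlg V) = uPow hV 1 * coordV V := eq_of_evalAt fun z => by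
    rw [map_mul, evalAt_uPow, Real.rpow_one]; rfl
  have eq : (toAlg _ hq : smoothAlg V)
      = cst _ (1 / 2) * (coordV V * coordV V) + cst _ (2 * m) * uPow hV (2 * m) := rfl
  have pu : algU V (toAlg _ hp) = coordV V := by
    rw [ep, Derivation.leibniz, h.du_u, algU_coordV]; simp
  have pv : algV V (toAlg _ hp) = uPow hV 1 := by
    rw [ep, Derivation.leibniz, h.dv_u, algV_coordV]; simp
  have qu : algU V (toAlg _ hq) = waveSpeed hV m * uPow hV 1 := by
    rw [eq, waveSpeed, mul_assoc, uPow_mul, show 2 * m - 2 + 1 = 2 * m - 1 by ring]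
    simp only [map_add, Derivation.leibniz, derivation_cst, algU_coordV, algU_uPow]
    refine eq_of_evalAt fun z => ?_
    simp only [smul_eq_mul, map_add, map_mul, map_zero, algHom_cst, evalAt_uPow]
    ring
  have qv : algV V (toAlg _ hq) = coordV V := by
    rw [eq]
    simp only [map_add, Derivation.leibniz, derivation_cst, algV_coordV, algV_uPow]
    refine eq_of_evalAt fun z => ?_
    simp only [smul_eq_mul, map_add, map_mul, map_zero, map_one, algHom_cst]
    ring
  have hsym := (symmetry_equations hV hm hSm hl1 hl2 hp hq).2 ⟨by rw [qu, pv], by rw [qv, pu]⟩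
  -- The only use of integrability: one symmetry, on the whole domain.
  obtain ⟨T, hT, hTp, hTq, hcomm⟩ := hint V V.2 subset_rfl _ _ hp hq hsym
  obtain ⟨e1, e2⟩ := System.CommutesToSecondOrder.flow_eq hSm hT n1 n2 hcomm
  have hPl : (T.fst.coeffs hT.1).lead = toAlg _ hp := by
    refine eq_of_evalAt fun z => ?_
    exact congrFun hTp z
  have hQl : (T.snd.coeffs hT.2).lead = toAlg _ hq := by
    refine eq_of_evalAt fun z => ?_
    exact congrFun hTq z
  rw [← hPl] at pu pv
  rw [← hQl] at qu qv
  have u1 : algU V (S.fst.coeffs hSm.1).lead = 0 := by rw [hl1, algU_coordV]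
  have v1 : algV V (S.fst.coeffs hSm.1).lead = 1 := by rw [hl1, algV_coordV]
  have u2 : algU V (S.snd.coeffs hSm.2).lead = waveSpeed hV m := by rw [hl2, algU_sndLead hV hm]
  have v2 : algV V (S.snd.coeffs hSm.2).lead = 0 := by rw [hl2, algV_sndLead]
  rw [← hl1, ← hl2]
  clear hl1 hl2 hPl hQl hcomm hsym hTp hTq n1 n2 hint ep eq
  generalize S.fst.coeffs hSm.1 = A₁ at *
  generalize S.snd.coeffs hSm.2 = A₂ at *
  generalize T.fst.coeffs hT.1 = P at *
  generalize T.snd.coeffs hT.2 = Q at *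
  obtain ⟨X₁, X₂, Y₁, Y₂, a₁₅, a₁₆, a₁₇, a, b, c, m1, m2⟩ := miura_reduces h hm1 u1 v1 u2 v2
  have hmf := miura_flow_eq (α := uPow hV 1) (β := coordV V) h.comm h.dv_w X₁ X₂ Y₁ Y₂ u1 v1 u2 v2
    pu pv qu qv (by rw [algU_coordV, h.dv_u, mul_zero]) (by rw [algV_coordV, h.du_u])
    (by rw [h.du_u, h.dv_u, map_zero, mul_zero, Derivation.map_one_eq_zero]) e1 e2
  rw [m1, m2] at hmf
  obtain ⟨ha, hb, k1, k2⟩ := normal_of_flow (t := coordV V)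
    (P := P.miura (algU V) (algV V) P.lead Q.lead X₁ X₂ X₁ X₂ Y₁ Y₂)
    (Q := Q.miura (algU V) (algV V) P.lead Q.lead Y₁ Y₂ X₁ X₂ Y₁ Y₂) h hm1 u1 v1 u2 v2
    algU_coordV algV_coordV pu pv qu qv hmf.1 hmf.2
  exact ⟨X₁, X₂, Y₁, Y₂, a, b, ha, hb, m1.trans k1, m2.trans k2⟩

end Reduction

/-! ### Local existence of the functions `F₁`, `F₂` -/

section LocalPotential

theorem exists_smooth_antideriv {p : ℝ → ℝ} {r₀ δ : ℝ} (hp : ContDiffOn ℝ ∞ p (Metric.ball r₀ δ)) :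
    ∃ F : ℝ → ℝ, ContDiffOn ℝ ∞ F (Metric.ball r₀ δ) ∧ ∀ r ∈ Metric.ball r₀ δ, deriv F r = p r := by
  rcases le_or_gt δ 0 with hδ | hδ
  · rw [Metric.ball_eq_empty.2 hδ]
    exact ⟨0, contDiffOn_empty, fun r hr => hr.elim⟩
  have hd : ∀ r ∈ Metric.ball r₀ δ, HasDerivAt (fun r => ∫ t in r₀..r, p t) (p r) r := fun r hr => by
    have hsub : Set.uIcc r₀ r ⊆ Metric.ball r₀ δ := by
      rw [← segment_eq_uIcc]
      exact (convex_ball r₀ δ).segment_subset (Metric.mem_ball_self hδ) hr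
    exact intervalIntegral.integral_hasDerivAt_right
      (hp.continuousOn.mono hsub).intervalIntegrable
      (hp.continuousOn.stronglyMeasurableAtFilter Metric.isOpen_ball r hr)
      (hp.continuousOn.continuousAt (Metric.isOpen_ball.mem_nhds hr))
  refine ⟨_, ?_, fun r hr => (hd r hr).deriv⟩
  rw [contDiffOn_infty_iff_deriv_of_isOpen Metric.isOpen_ball]
  exact ⟨fun r hr => (hd r hr).differentiableAt.differentiableWithinAt,
    hp.congr fun r hr => (hd r hr).deriv⟩

variable {V : Opens (ℝ × ℝ)}

/-- A function that is constant along a family of characteristics is locally a function of the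
Riemann invariant. -/
theorem exists_local_riemann (hV : ∀ z ∈ V, 0 < z.1) {m κ : ℝ} {P : smoothAlg V}
    (hP : algU V P = cst _ (κ * m) * (uPow hV (m - 1) * algV V P)) {z₀ : ℝ × ℝ} (hz₀ : z₀ ∈ V) :
    ∃ U : Set (ℝ × ℝ), IsOpen U ∧ z₀ ∈ U ∧ U ⊆ V ∧ ∃ F : ℝ → ℝ,
      ContDiffOn ℝ ∞ F (riemannInv m κ '' U) ∧
      ∀ z ∈ U, deriv F (riemannInv m κ z) = extend P z := by
  have hu₀ := hV z₀ hz₀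
  have hRc : ContinuousOn (riemannInv m κ) V := (smoothOn_riemannInv hV m κ).continuousOn
  have hR₀ : ContinuousAt (riemannInv m κ) z₀ := hRc.continuousAt (V.2.mem_nhds hz₀)
  have hΨ : ContinuousAt (fun y : (ℝ × ℝ) × ℝ => (y.2, riemannInv m κ y.1 - κ * y.2 ^ m))
      (z₀, z₀.1) :=
    continuousAt_snd.prodMk ((hR₀.comp (x := (z₀, z₀.1)) (f := Prod.fst) continuousAt_fst).sub
      (continuousAt_const.mul (continuousAt_snd.rpow_const (Or.inl hu₀.ne'))))
  have hmem : ∀ᶠ y in 𝓝 (z₀, z₀.1), (y.2, riemannInv m κ y.1 - κ * y.2 ^ m) ∈ V := by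
    refine hΨ.eventually (V.2.mem_nhds ?_)
    simpa [riemannInv] using hz₀
  obtain ⟨ε, hε, hball⟩ := Metric.eventually_nhds_iff_ball.1 hmem
  have hball' : ∀ z ∈ Metric.ball z₀ ε, ∀ t ∈ Metric.ball z₀.1 ε,
      (t, riemannInv m κ z - κ * t ^ m) ∈ V := fun z hz t ht =>
    hball (z, t) (by rw [← ball_prod_same]; exact ⟨hz, ht⟩)
  -- The characteristic through `z` is the curve `t ↦ (t, R(z) - κ t^m)` with `R` the Riemann
  -- invariant. The function is constant along it, and its value at `t = z₀.1` depends on `R(z)`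
  -- alone; the ball was chosen so that the curve stays in `V` in between.
  have hconst : ∀ z ∈ Metric.ball z₀ ε, extend P z
      = extend P (z₀.1, riemannInv m κ z - κ * z₀.1 ^ m) := fun z hz => by
    have hd : ∀ t ∈ Metric.ball z₀.1 ε,
        HasDerivAt (fun t => extend P (t, riemannInv m κ z - κ * t ^ m)) 0 t := fun t ht => by
      have hz' := hball' z hz t ht
      have e := congrArg (evalAt ⟨_, hz'⟩) hP
      simp only [map_mul, algHom_cst, evalAt_uPow] at e
      refine (hasDerivAt_extend (u := fun t => t) (v := fun t => riemannInv m κ z - κ * t ^ m) P hz'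
        (hasDerivAt_id t) (((Real.hasDerivAt_rpow_const (Or.inl (hV _ hz').ne')).const_mul
          κ).const_sub _)).congr_deriv ?_
      rw [extend_eq_evalAt _ hz', extend_eq_evalAt _ hz', e]
      ring
    have := Metric.isOpen_ball.is_const_of_deriv_eq_zero (convex_ball z₀.1 ε).isPreconnected
      (fun t ht => (hd t ht).differentiableAt.differentiableWithinAt) (fun t ht => (hd t ht).deriv)
      (show z.1 ∈ Metric.ball z₀.1 ε by
        rw [← ball_prod_same] at hz
        exact hz.1)
      (Metric.mem_ball_self hε)
    simpa [riemannInv] using this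
  have hcont : Continuous fun r : ℝ => (z₀.1, r - κ * z₀.1 ^ m) := by fun_prop
  obtain ⟨δ, hδ, hδV⟩ := Metric.isOpen_iff.1 (V.2.preimage hcont) (riemannInv m κ z₀)
    (by simpa [riemannInv] using hz₀)
  have hp : ContDiffOn ℝ ∞ (fun r => extend P (z₀.1, r - κ * z₀.1 ^ m))
      (Metric.ball (riemannInv m κ z₀) δ) :=
    (smoothOn_extend P).comp (contDiff_const.prodMk (contDiff_id.sub contDiff_const)).contDiffOn hδV
  obtain ⟨F, hF, hF'⟩ := exists_smooth_antideriv hp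
  refine ⟨(V ∩ riemannInv m κ ⁻¹' Metric.ball (riemannInv m κ z₀) δ) ∩ Metric.ball z₀ ε,
    (hRc.isOpen_inter_preimage V.2 Metric.isOpen_ball).inter Metric.isOpen_ball,
    ⟨⟨hz₀, Metric.mem_ball_self hδ⟩, Metric.mem_ball_self hε⟩, fun z hz => hz.1.1, F,
    hF.mono ?_, fun z hz => ?_⟩
  · rintro _ ⟨z, hz, rfl⟩
    exact hz.1.2
  · rw [hF' _ hz.1.2, hconst z hz.2]

/-- If `a` and `b` come from a potential `F`, then `P` is half of `F_v + F_u / (κ m u^(m-1))`, that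
is `F₁'` for `κ = 2` and `F₂'` for `κ = -2`. The system for `a` and `b` says that these combinations
are transported along the characteristics. -/
theorem riemann_equation (hV : ∀ z ∈ V, 0 < z.1) {m κ : ℝ} (hκ : κ ^ 2 = 4) {a b : smoothAlg V}
    (ha : algU V a = waveSpeed hV m * algV V b + cst _ (2 * m - 3) * (a * uPow hV (-1)))
    (hb : algU V b = algV V a + cst _ (m - 2) * (b * uPow hV (-1))) {P : smoothAlg V}
    (hP : P = -(a * uPow hV (3 - 2 * m)) - cst _ (κ * m) * (b * uPow hV (2 - m))) :
    algU V P = cst _ (κ * m) * (uPow hV (m - 1) * algV V P) := by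
  subst hP
  simp only [map_neg, map_sub, Derivation.leibniz, derivation_cst, algU_uPow, algV_uPow, smul_eq_mul,
    mul_zero, add_zero, zero_add, ha, hb]
  refine eq_of_evalAt fun z => ?_
  have hp := hV z z.2
  have hs : z.1.1 ^ (m - 1) ≠ 0 := (Real.rpow_pos_of_pos hp _).ne'
  have r1 : z.1.1 ^ (3 - 2 * m) = z.1.1 / z.1.1 ^ (m - 1) / z.1.1 ^ (m - 1) := by
    rw [show 3 - 2 * m = 1 - (m - 1) - (m - 1) by ring, Real.rpow_sub hp, Real.rpow_sub hp,
      Real.rpow_one]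
  have r2 : z.1.1 ^ (3 - 2 * m - 1) = z.1.1 ^ (3 - 2 * m) / z.1.1 := Real.rpow_sub_one hp.ne' _
  have r3 : z.1.1 ^ (2 - m) = z.1.1 / z.1.1 ^ (m - 1) := by
    rw [show 2 - m = 1 - (m - 1) by ring, Real.rpow_sub hp, Real.rpow_one]
  have r4 : z.1.1 ^ (2 - m - 1) = z.1.1 ^ (2 - m) / z.1.1 := Real.rpow_sub_one hp.ne' _
  have r5 : z.1.1 ^ (2 * m - 2) = z.1.1 ^ (m - 1) * z.1.1 ^ (m - 1) := by
    rw [← Real.rpow_add hp]; ring_nf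
  simp only [waveSpeed, map_add, map_sub, map_neg, map_mul, algHom_cst, evalAt_uPow,
    Real.rpow_neg_one, r2, r4, r1, r3, r5, ← hκ]
  generalize z.1.1 ^ (m - 1) = s at *
  field_simp
  ring

/-- Antiderivatives of the two transported functions serve as `F₁` and `F₂`: their sum of
derivatives recovers `a` through `F_v`, their difference recovers `b` through `F_u`. The
construction is local because a level set of a Riemann invariant may be disconnected in a general
`V`. -/
theorem exists_local_potential (hV : ∀ z ∈ V, 0 < z.1) {m : ℝ} (hm0 : m ≠ 0) {a b : smoothAlg V}
    (ha : algU V a = waveSpeed hV m * algV V b + cst _ (2 * m - 3) * (a * uPow hV (-1)))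
    (hb : algU V b = algV V a + cst _ (m - 2) * (b * uPow hV (-1))) {z₀ : ℝ × ℝ} (hz₀ : z₀ ∈ V) :
    ∃ U : Set (ℝ × ℝ), IsOpen U ∧ z₀ ∈ U ∧ U ⊆ V ∧ ∃ F₁ F₂ : ℝ → ℝ,
      ContDiffOn ℝ ∞ F₁ (riemannInv m 2 '' U) ∧ ContDiffOn ℝ ∞ F₂ (riemannInv m (-2) '' U) ∧
      Set.EqOn (a23 m (potential m F₁ F₂)) (extend a) U ∧
      Set.EqOn (a24 m (potential m F₁ F₂)) (extend b) U := by
  obtain ⟨U₁, hU₁, hz₁, hUV₁, F₁, hF₁, hd₁⟩ := exists_local_riemann hV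
    (riemann_equation hV (κ := 2) (by norm_num) ha hb rfl) hz₀
  obtain ⟨U₂, hU₂, hz₂, hUV₂, F₂, hF₂, hd₂⟩ := exists_local_riemann hV
    (riemann_equation hV (κ := -2) (by norm_num) ha hb rfl) hz₀
  let U : Opens (ℝ × ℝ) := ⟨U₁ ∩ U₂, hU₁.inter hU₂⟩
  have hUV : ∀ z ∈ U, z ∈ V := fun z hz => hUV₁ hz.1
  have hU : ∀ z ∈ U, 0 < z.1 := fun z hz => hV z (hUV z hz)
  have h1 : ContDiffOn ℝ ∞ F₁ (riemannInv m 2 '' U) :=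
    hF₁.mono (Set.image_mono Set.inter_subset_left)
  have h2 : ContDiffOn ℝ ∞ F₂ (riemannInv m (-2) '' U) :=
    hF₂.mono (Set.image_mono Set.inter_subset_right)
  obtain ⟨sG, hG⟩ := toAlg_potential hU h1 h2
  have hGv : ∀ z ∈ U, pdv (potential m F₁ F₂) z
      = deriv F₁ (riemannInv m 2 z) + deriv F₂ (riemannInv m (-2) z) := fun z hz => by
    have := congrArg (evalAt ⟨z, hz⟩) (congrArg (algV U) hG)
    rw [algV_toAlg, map_add, algV_riemannComp, algV_riemannComp, map_add] at this
    exact this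
  have hGu : ∀ z ∈ U, pdu (potential m F₁ F₂) z
      = 2 * m * (z.1 ^ (m - 1) * deriv F₁ (riemannInv m 2 z))
        + -2 * m * (z.1 ^ (m - 1) * deriv F₂ (riemannInv m (-2) z)) := fun z hz => by
    have := congrArg (evalAt ⟨z, hz⟩) (congrArg (algU U) hG)
    rw [algU_toAlg, map_add, algU_riemannComp, algU_riemannComp, map_add] at this
    exact this
  refine ⟨U, U.2, ⟨hz₁, hz₂⟩, hUV, F₁, F₂, h1, h2, fun z hz => ?_, fun z hz => ?_⟩
  · have hp := hU z hz
    have hs : z.1 ^ (2 * m - 3) ≠ 0 := (Real.rpow_pos_of_pos hp _).ne'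
    have r1 : z.1 ^ (3 - 2 * m) = (z.1 ^ (2 * m - 3))⁻¹ := by
      rw [← Real.rpow_neg hp.le]; ring_nf
    simp only [a23]
    rw [hGv z hz, hd₁ z hz.1, hd₂ z hz.2]
    simp only [extend_eq_evalAt _ (hUV z hz), map_sub, map_neg, map_mul, algHom_cst, evalAt_uPow, r1]
    field_simp
    ring
  · have hp := hU z hz
    have hs : z.1 ^ (m - 1) ≠ 0 := (Real.rpow_pos_of_pos hp _).ne'
    have r1 : z.1 ^ (2 - m) = z.1 / z.1 ^ (m - 1) := by
      rw [show 2 - m = 1 - (m - 1) by ring, Real.rpow_sub hp, Real.rpow_one]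
    simp only [a24]
    rw [hGu z hz, hd₁ z hz.1, hd₂ z hz.2]
    simp only [extend_eq_evalAt _ (hUV z hz), map_sub, map_neg, map_mul, algHom_cst, evalAt_uPow, r1]
    generalize z.1 ^ (m - 1) = s at *
    field_simp
    ring

end LocalPotential

end DihedralDeformation

/-! ### The main theorem -/

theorem mainTheorem8 (n : ℕ) (hn : 3 ≤ n) (m : ℝ) (hm : m = (n : ℝ) / 2)
    (D : Set (ℝ × ℝ)) (hD : IsOpen D) (hpos : ∀ z ∈ D, 0 < z.1) :
    (∀ S : System, IsSecondOrderDeformation m D S → S.IntegrableToSecondOrder D →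
      ∃ β : Miura, β.SmoothOn D ∧
        ∀ z₀ ∈ D, ∃ U : Set (ℝ × ℝ), IsOpen U ∧ z₀ ∈ U ∧ U ⊆ D ∧
          ∃ F₁ F₂ : ℝ → ℝ,
            ContDiffOn ℝ ∞ F₁ (riemannPlus m '' U) ∧ ContDiffOn ℝ ∞ F₂ (riemannMinus m '' U) ∧
            β.Transforms S (normalForm m (potential m F₁ F₂)) U) ∧
    (∀ F₁ F₂ : ℝ → ℝ,
      ContDiffOn ℝ ∞ F₁ (riemannPlus m '' D) → ContDiffOn ℝ ∞ F₂ (riemannMinus m '' D) →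
      IsSecondOrderDeformation m D (normalForm m (potential m F₁ F₂)) ∧
      (normalForm m (potential m F₁ F₂)).IntegrableToSecondOrder D) := by
  have hn' : (3 : ℝ) ≤ n := by exact_mod_cast hn
  -- Since `m ≥ 3/2`, the three degenerate values are excluded: `w` vanishes for `m = 0` and is
  -- constant for `m = 1`, and `2m - 1` is a denominator in (1).
  have hm0 : m ≠ 0 := fun h => by linarith
  have hm1 : m ≠ 1 := fun h => by linarith
  have hm2 : 2 * m - 1 ≠ 0 := fun h => by linarith
  rw [riemannPlus_eq, riemannMinus_eq]
  refine ⟨fun S hS hint => ?_, fun F₁ F₂ h1 h2 => ⟨?_, fun V hV hVD p q hp hq hpq => ?_⟩⟩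
  · let V : TopologicalSpace.Opens (ℝ × ℝ) := ⟨D, hD⟩
    have hV : ∀ z ∈ V, 0 < z.1 := hpos
    obtain ⟨X₁, X₂, Y₁, Y₂, a, b, ha, hb, k1, k2⟩ :=
      exists_miura_normal (V := V) hV hm0 hm1 hm2 hS hint
    -- The transformation is fixed on all of `D` before a point is chosen; only `F₁` and `F₂` depend
    -- on the neighbourhood.
    refine ⟨⟨extend X₁, extend X₂, extend Y₁, extend Y₂⟩, ⟨smoothOn_extend X₁, smoothOn_extend X₂,
      smoothOn_extend Y₁, smoothOn_extend Y₂⟩, fun z₀ hz₀ => ?_⟩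
    obtain ⟨U, hUo, hzU, hU, F₁, F₂, hF₁, hF₂, ea, eb⟩ :=
      exists_local_potential (V := V) hV hm0 ha hb hz₀
    obtain ⟨c1, c2⟩ := normalForm_hasCoeffsOn hV hm0 hm1 ha hb hUo hU ea eb
    refine ⟨U, hUo, hzU, hU, F₁, F₂, hF₁, hF₂, miura_transforms (V := V) hS.1
      (fun z hz => ⟨(hS.2 z hz).2.2.1, (hS.2 z hz).2.2.2.1⟩) (fun z hz => (hS.2 z hz).2.2.2.2)
      hUo hU X₁ X₂ Y₁ Y₂ ?_ ?_⟩
    · rw [k1]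
      exact c1
    · rw [k2]
      exact c2
  · obtain ⟨a, b, -, -, k1, k2⟩ :=
      exists_normal_coeffs (V := ⟨D, hD⟩) hpos hm0 hm1 h1 h2
    exact isSecondOrderDeformation_normalForm
      ⟨k1.smoothOn subset_rfl, k2.smoothOn subset_rfl⟩
  · exact normalForm_extends_symmetry (V := ⟨V, hV⟩) (fun z hz => hpos z (hVD hz)) hm0 hm1 hm2
      (h1.mono (Set.image_mono hVD)) (h2.mono (Set.image_mono hVD)) hp hq hpq
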